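/- For a Lebesgue measurable set $\Omega\subset\mathbb R^2$ let $$P(\Omega)=\sup\Big\{\int_\Omega\nabla\cdot\phi\,dx:\ \phi\in C^1_c(\mathbb R^2;\mathbb R^2),\ |\phi|\le 1\Big\}$$ be its perimeter, and for $m>0$ let $\mathcal A_m$ be the class of measurable $\Omega\subset\mathbb R^2$ with $P(\Omega)<\infty$ and $|\Omega|=m$. For $0<\delta<\frac12$ and $\Omega\in\mathcal A_m$ put $$E_{1,\delta}(\Omega)=P(\Omega)-\frac{1}{4|\log\delta|}\int_{\mathbb R^2}\int_{\mathbb R^2}|\chi_\Omega(x+z)-\chi_\Omega(x)|^2\,\frac{\chi_{(1,\infty)}(|z|/\delta)}{|z|^3}\,dz\,dx .$$ Let $\partial^*\Omega$ be the reduced boundary of $\Omega$ in the sense of De Giorgi, $\nu(y)$ the outer unit normal at $y\in\partial^*\Omega$, $H_-(y)=\{x:(x-y)\cdot\nu(y)<0\}$, $B_1(y)$ the disk of radius $1$ about $y$, and define $$E_{1,0}(\Omega)=-P(\Omega)+\frac12\int_{\partial^*\Omega}\int_{(\Omega\Delta H_-(y))\cap B_1(y)}\left|\nu(y)\cdot\frac{x-y}{|x-y|^3}\right|dx\,d\mathcal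 H^1(y)+\frac12\int_{\partial^*\Omega}\int_{\Omega\setminus B_1(y)}\nu(y)\cdot\frac{x-y}{|x-y|^3}\,dx\,d\mathcal H^1(y).$$ Then for every $m>0$ the $\Gamma$-limit of $|\log\delta|E_{1,\delta}$ restricted to $\mathcal A_m$, with respect to the $L^1$-topology as $\delta\to0$, is $E_{1,0}$ in the following sense. (i) (Lower bound) If $\Omega,\Omega_n\in\mathcal A_m$, $\delta_n>0$, $|\Omega_n\Delta\Omega|\to0$ and $\delta_n\to0$, then $$E_{1,0}(\Omega)\le\liminf_{n\to\infty}|\log\delta_n|E_{1,\delta_n}(\Omega_n).$$ (ii) (Upper bound) For every $\Omega\in\mathcal A_m$ the function $\delta\mapsto|\log\delta|E_{1,\delta}(\Omega)$ is non-increasing on $(0,\frac12)$, and the constant sequence is a recovery sequence: $$E_{1,0}(\Omega)=\lim_{\delta\to0}|\log\delta|E_{1,\delta}(\Omega)\in\mathbb R\cup\{+\infty\}.$$ (iii) (Compactness) If $\Omega_n\in\mathcal A_m$, $\delta_n>0$, $\delta_n\to0$, $\limsup_{n\to\infty}|\log\delta_n|E_{1,\delta_n}(\Omega_n)<\infty$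 and $\Omega_n\subset B_R(0)$ for all $n$ and some $R>0$, then there are a subsequence $(\Omega_{n_k})$ and $\Omega\in\mathcal A_m$ with $|\Omega_{n_k}\Delta\Omega|\to0$. -/

import Mathlib

open MeasureTheory Filter Topology
open scoped ENNReal

noncomputable section

namespace DipolarDrop

/-- The Euclidean plane. -/
abbrev Plane : Type := EuclideanSpace ℝ (Fin 2)

/-- The divergence of a vector field on the plane. -/
def divergence (φ : Plane → Plane) (x : Plane) : ℝ :=
  ∑ i : Fin 2, (fderiv ℝ φ x (EuclideanSpace.single i 1)) i

/-- `φ ∈ C¹_c(ℝ²; ℝ²)`. -/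
def IsTestField (φ : Plane → Plane) : Prop :=
  ContDiff ℝ 1 φ ∧ HasCompactSupport φ

/-- De Giorgi's perimeter: the supremum of `∫_Ω div φ` over `φ ∈ C¹_c(ℝ²; ℝ²)` with `|φ| ≤ 1`.
The supremum is nonnegative (take `φ = 0`), so truncating at `0` does not change it. -/
def perimeter (Ω : Set Plane) : ℝ≥0∞ :=
  ⨆ (φ : Plane → Plane) (_ : IsTestField φ ∧ ∀ x, ‖φ x‖ ≤ 1),
    ENNReal.ofReal (∫ x in Ω, divergence φ x)

/-- The admissible class `𝒜_m`: (Lebesgue) measurable sets of finite perimeter and area `m`. -/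
def admissible (m : ℝ) : Set (Set Plane) :=
  {Ω | NullMeasurableSet Ω (volume : Measure Plane) ∧ perimeter Ω < ∞ ∧
    volume Ω = ENNReal.ofReal m}

/-- The cutoff function `g = χ_{(1, ∞)}`. -/
def cutoff (r : ℝ) : ℝ := Set.indicator (Set.Ioi 1) (fun _ => 1) r

/-- The characteristic function of `Ω`. -/
def charFn (Ω : Set Plane) (x : Plane) : ℝ := Set.indicator Ω (fun _ => 1) x

/-- The energy `E_{lam, δ}(Ω)`, for `Ω` of finite perimeter and finite area. -/
def energy (lam δ : ℝ) (Ω : Set Plane) : ℝ :=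
  (perimeter Ω).toReal - lam / (4 * |Real.log δ|) *
    ∫ x : Plane, ∫ z : Plane,
      |charFn Ω (x + z) - charFn Ω x| ^ 2 * (cutoff (‖z‖ / δ) / ‖z‖ ^ 3)

/-- The polar form `σ μ` of the Gauss–Green measure of a set `Ω` of finite perimeter: `μ` is a
finite Borel measure, `σ` a Borel field with `|σ| = 1` `μ`-a.e., and
`∫_Ω div φ = ∫ φ · σ dμ` for all `φ ∈ C¹_c(ℝ²; ℝ²)`. In particular `μ` is the total variation
of `σ μ`; both are uniquely determined by `Ω` (`σ` up to `μ`-null sets). -/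
structure IsGaussGreenPair (Ω : Set Plane) (μ : Measure Plane) (σ : Plane → Plane) : Prop where
  finite : IsFiniteMeasure μ
  measurable : Measurable σ
  unit : ∀ᵐ x ∂μ, ‖σ x‖ = 1
  gauss_green : ∀ φ : Plane → Plane, IsTestField φ →
    ∫ x in Ω, divergence φ x = ∫ x, inner ℝ (φ x) (σ x) ∂μ

/-- `y` is a point of De Giorgi's reduced boundary of `Ω` with (measure-theoretic) outer unit
normal `ν`: `y` lies in the support of the Gauss–Green measure, and the quotients of the
Gauss–Green measure of `B_r(y)` and its total variation on `B_r(y)` converge to the unit vector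
`ν` as `r → 0`. -/
def HasOuterNormal (Ω : Set Plane) (y ν : Plane) : Prop :=
  ∃ (μ : Measure Plane) (σ : Plane → Plane), IsGaussGreenPair Ω μ σ ∧
    (∀ r : ℝ, 0 < r → 0 < μ (Metric.ball y r)) ∧ ‖ν‖ = 1 ∧
    Tendsto (fun r : ℝ => ⨍ x in Metric.ball y r, σ x ∂μ) (𝓝[>] 0) (𝓝 ν)

/-- The reduced boundary `∂* Ω`. -/
def reducedBoundary (Ω : Set Plane) : Set Plane := {y | ∃ ν, HasOuterNormal Ω y ν}

open Classical in
/-- The outer unit normal `ν(y)` at points of the reduced boundary (and `0` elsewhere). -/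
def outerNormal (Ω : Set Plane) (y : Plane) : Plane :=
  if h : ∃ ν, HasOuterNormal Ω y ν then h.choose else 0

/-- The half-plane `H_-(y) = {x : (x - y) · ν(y) < 0}`. -/
def halfPlane (Ω : Set Plane) (y : Plane) : Set Plane :=
  {x | inner ℝ (x - y) (outerNormal Ω y) < 0}

/-- `ν(y) · (x - y) / |x - y|³`. -/
def boundaryKernel (Ω : Set Plane) (y x : Plane) : ℝ :=
  inner ℝ (outerNormal Ω y) (x - y) / ‖x - y‖ ^ 3

/-- The near-field term
`∫_{∂*Ω} ∫_{(Ω Δ H_-(y)) ∩ B_1(y)} |ν(y) · (x - y)| / |x - y|³ dx dℋ¹(y) ∈ [0, ∞]`. -/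
def nearTerm (Ω : Set Plane) : ℝ≥0∞ :=
  ∫⁻ y in reducedBoundary Ω,
    (∫⁻ x in symmDiff Ω (halfPlane Ω y) ∩ Metric.ball y 1,
      ENNReal.ofReal |boundaryKernel Ω y x|) ∂(Measure.hausdorffMeasure 1)

/-- The far-field term
`∫_{∂*Ω} ∫_{Ω \ B_1(y)} ν(y) · (x - y) / |x - y|³ dx dℋ¹(y)`; it converges absolutely for
`Ω` of finite area and finite perimeter. -/
def farTerm (Ω : Set Plane) : ℝ :=
  ∫ y in reducedBoundary Ω,
    (∫ x in Ω \ Metric.ball y 1, boundaryKernel Ω y x) ∂(Measure.hausdorffMeasure 1)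

/-- The limit functional `E_{1,0}(Ω) = -P(Ω) + ½ nearTerm + ½ farTerm`, with values in
`ℝ ∪ {+∞}` on sets of finite perimeter and area. -/
def limitEnergy (Ω : Set Plane) : EReal :=
  ((-(perimeter Ω).toReal + 2⁻¹ * farTerm Ω : ℝ) : EReal) +
    ((2⁻¹ * nearTerm Ω : ℝ≥0∞) : EReal)

/-- The renormalized critical energy `|log δ| E_{1,δ}(Ω)`. -/
def scaledEnergy (δ : ℝ) (Ω : Set Plane) : ℝ := |Real.log δ| * energy 1 δ Ω

/-- `L¹`-convergence of sets: `|Ω_n Δ Ω| → 0`. -/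
def SetTendsto (Ωs : ℕ → Set Plane) (Ω : Set Plane) : Prop :=
  Tendsto (fun n => volume (symmDiff (Ωs n) Ω)) atTop (𝓝 0)

end DipolarDrop

end

noncomputable section

namespace DipolarDrop

theorem exists_contDiff_norm_le_one {F : Type*} [NormedAddCommGroup F] [NormedSpace ℝ F]
    {w : Plane → F} (hw : Continuous w) (hn : ∀ x, ‖w x‖ ≤ 1) {ε : ℝ} (hε : 0 < ε) :
    ∃ φ : Plane → F, ContDiff ℝ 1 φ ∧ Function.support φ ⊆ Function.support w ∧
      (∀ x, ‖φ x‖ ≤ 1) ∧ ∀ x, ‖φ x - w x‖ ≤ ε := by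
  set κ : ℝ := min (ε / 2) 1 with hκ
  have hκ0 : 0 < κ := by positivity
  have hκ1 : κ ≤ 1 := min_le_right _ _
  have hκε : κ ≤ ε / 2 := min_le_left _ _
  obtain ⟨φ, hφ, happ, hsupp⟩ := (hw.const_smul (1 - κ)).exists_contDiff_approx 1
    (ε := fun _ => κ) continuous_const (fun _ => hκ0)
  have happ' : ∀ x, ‖φ x - (1 - κ) • w x‖ ≤ κ := fun x => by
    have := (happ x).le
    rwa [dist_eq_norm] at this
  have hs : ∀ x, ‖(1 - κ) • w x‖ ≤ 1 - κ := fun x => by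
    rw [norm_smul, Real.norm_eq_abs, abs_of_nonneg (by linarith)]
    exact mul_le_of_le_one_right (by linarith) (hn x)
  refine ⟨φ, hφ, hsupp.trans (Function.support_const_smul_subset _ _), fun x => ?_, fun x => ?_⟩
  · calc ‖φ x‖ = ‖(φ x - (1 - κ) • w x) + (1 - κ) • w x‖ := by rw [sub_add_cancel]
      _ ≤ κ + (1 - κ) := (norm_add_le _ _).trans (add_le_add (happ' x) (hs x))
      _ = 1 := by ring
  · have h2 : ‖κ • w x‖ ≤ κ := by
      rw [norm_smul, Real.norm_eq_abs, abs_of_pos hκ0]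
      exact mul_le_of_le_one_right hκ0.le (hn x)
    calc ‖φ x - w x‖ = ‖(φ x - (1 - κ) • w x) - κ • w x‖ := by congr 1; module
      _ ≤ κ + κ := (norm_sub_le _ _).trans (add_le_add (happ' x) h2)
      _ ≤ ε := by linarith

/-- The radial truncation of a vector to the unit ball. -/
def truncateUnit {F : Type*} [NormedAddCommGroup F] [NormedSpace ℝ F] (v : F) : F :=
  (max 1 ‖v‖)⁻¹ • v

section truncateUnit

variable {F : Type*} [NormedAddCommGroup F] [NormedSpace ℝ F]

theorem continuous_truncateUnit : Continuous (truncateUnit : F → F) := by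
  unfold truncateUnit
  refine Continuous.smul (Continuous.inv₀ (by fun_prop) fun v => ?_) continuous_id
  have : (1 : ℝ) ≤ max 1 ‖v‖ := le_max_left _ _
  linarith

theorem norm_truncateUnit_le (v : F) : ‖truncateUnit v‖ ≤ 1 := by
  have h1 : (1 : ℝ) ≤ max 1 ‖v‖ := le_max_left _ _
  rw [truncateUnit, norm_smul, norm_inv, Real.norm_eq_abs, abs_of_pos (by linarith),
    inv_mul_le_iff₀ (by linarith), mul_one]
  exact le_max_right _ _

theorem norm_truncateUnit_sub_le {v u : F} (hu : ‖u‖ ≤ 1) :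
    ‖truncateUnit v - u‖ ≤ 2 * ‖v - u‖ := by
  have key : ‖truncateUnit v - v‖ ≤ ‖v - u‖ := by
    rcases le_total ‖v‖ 1 with h | h
    · simp [truncateUnit, max_eq_left h]
    · have hv : 0 < ‖v‖ := by linarith
      have : truncateUnit v - v = (‖v‖⁻¹ - 1) • v := by
        rw [truncateUnit, max_eq_right h]; module
      have h3 : ‖v‖⁻¹ ≤ 1 := inv_le_one_of_one_le₀ h
      rw [this, norm_smul, Real.norm_eq_abs, abs_of_nonpos (by linarith)]
      have : -(‖v‖⁻¹ - 1) * ‖v‖ = ‖v‖ - 1 := by field_simp; ring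
      rw [this]
      linarith [norm_le_norm_add_norm_sub' v u]
  calc ‖truncateUnit v - u‖ = ‖(truncateUnit v - v) + (v - u)‖ := by congr 1; abel
    _ ≤ ‖v - u‖ + ‖v - u‖ := (norm_add_le _ _).trans (add_le_add key le_rfl)
    _ = _ := by ring

end truncateUnit

/-- A measurable field bounded by one is approximated in `L¹` of a finite measure by `C¹` fields
of compact support bounded by one. -/
theorem exists_testField_integral_sub_le {F : Type*} [NormedAddCommGroup F] [NormedSpace ℝ F]
    (μ : Measure Plane) [IsFiniteMeasure μ] {u : Plane → F} (hu : AEStronglyMeasurable u μ)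
    (hn : ∀ᵐ x ∂μ, ‖u x‖ ≤ 1) {ε : ℝ} (hε : 0 < ε) :
    ∃ φ : Plane → F, ContDiff ℝ 1 φ ∧ HasCompactSupport φ ∧ (∀ x, ‖φ x‖ ≤ 1) ∧
      ∫ x, ‖φ x - u x‖ ∂μ ≤ ε := by
  have hui : Integrable u μ := (integrable_const (1 : ℝ)).mono' hu hn
  obtain ⟨v, hvs, hvi, hvc, hvint⟩ :=
    hui.exists_hasCompactSupport_integral_sub_le (ε := ε / 4) (by positivity)
  set κ : ℝ := ε / (2 * (μ.real Set.univ + 1)) with hκ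
  have hμ : 0 ≤ μ.real Set.univ := measureReal_nonneg
  have hκ0 : 0 < κ := by positivity
  obtain ⟨φ, hφ, hsupp, hφ1, happ⟩ := exists_contDiff_norm_le_one
    (w := fun x => truncateUnit (v x)) (continuous_truncateUnit.comp hvc)
    (fun x => norm_truncateUnit_le _) hκ0
  have hcs : HasCompactSupport φ := by
    refine HasCompactSupport.mono hvs (hsupp.trans fun x hx => ?_)
    contrapose! hx
    simp only [Function.mem_support, not_not] at hx ⊢
    simp [truncateUnit, hx]
  refine ⟨φ, hφ, hcs, hφ1, ?_⟩
  have hintg : Integrable (fun x => κ + 2 * ‖u x - v x‖) μ :=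
    (integrable_const κ).add ((hui.sub hvint).norm.const_mul 2)
  calc ∫ x, ‖φ x - u x‖ ∂μ ≤ ∫ x, (κ + 2 * ‖u x - v x‖) ∂μ := by
        refine integral_mono_of_nonneg (ae_of_all _ fun x => norm_nonneg _) hintg ?_
        filter_upwards [hn] with x hx
        have h1 := norm_truncateUnit_sub_le (v := v x) hx
        rw [norm_sub_rev (v x)] at h1
        calc ‖φ x - u x‖ = ‖(φ x - truncateUnit (v x)) + (truncateUnit (v x) - u x)‖ := by
              congr 1; abel
          _ ≤ _ := (norm_add_le _ _).trans (add_le_add (happ x) h1)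
    _ = κ * μ.real Set.univ + 2 * ∫ x, ‖u x - v x‖ ∂μ := by
        have hi : Integrable (fun x => 2 * ‖u x - v x‖) μ := (hui.sub hvint).norm.const_mul 2
        rw [integral_add (integrable_const κ) hi,
          integral_const, integral_const_mul, smul_eq_mul, mul_comm]
    _ ≤ ε / 2 + 2 * (ε / 4) := by
        gcongr
        rw [hκ, div_mul_eq_mul_div, div_le_div_iff₀ (by positivity) (by norm_num)]
        nlinarith
    _ = ε := by ring

/-- The `L¹` norm of a vector field is approached by testing with `C¹` fields of compact support
bounded by one. -/
theorem exists_testField_integral_inner_ge {F : Type*} [NormedAddCommGroup F]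
    [InnerProductSpace ℝ F] (μ : Measure Plane) {w : Plane → F} (hw : Integrable w μ)
    {ε : ℝ} (hε : 0 < ε) :
    ∃ φ : Plane → F, ContDiff ℝ 1 φ ∧ HasCompactSupport φ ∧ (∀ x, ‖φ x‖ ≤ 1) ∧
      ∫ x, ‖w x‖ ∂μ - ε ≤ ∫ x, inner ℝ (φ x) (w x) ∂μ := by
  have hfin : IsFiniteMeasure (μ.withDensity fun x => ‖w x‖ₑ) :=
    ⟨by rw [withDensity_apply _ MeasurableSet.univ, Measure.restrict_univ]; exact hw.2⟩
  have hac : μ.withDensity (fun x => ‖w x‖ₑ) ≪ μ := withDensity_absolutelyContinuous _ _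
  have hmeas : AEStronglyMeasurable (fun x => ‖w x‖⁻¹ • w x) μ :=
    (hw.1.norm.aemeasurable.inv.aestronglyMeasurable).smul hw.1
  obtain ⟨φ, h1, h2, h3, h4⟩ := exists_testField_integral_sub_le
    (μ.withDensity fun x => ‖w x‖ₑ) (u := fun x => ‖w x‖⁻¹ • w x)
    (hmeas.mono_ac hac)
    (ae_of_all _ fun x => by
      rw [norm_smul, norm_inv, norm_norm]
      exact inv_mul_le_one) hε
  refine ⟨φ, h1, h2, h3, ?_⟩
  have hintg : Integrable (fun x => inner ℝ (φ x) (w x)) μ := by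
    refine hw.norm.mono' (h1.continuous.aestronglyMeasurable.inner hw.1) (ae_of_all _ fun x => ?_)
    exact (norm_inner_le_norm _ _).trans (mul_le_of_le_one_left (norm_nonneg _) (h3 x))
  have hconv : ∫ x, ‖φ x - ‖w x‖⁻¹ • w x‖ ∂(μ.withDensity fun x => ‖w x‖ₑ) =
      ∫ x, ‖w x‖ * ‖φ x - ‖w x‖⁻¹ • w x‖ ∂μ := by
    rw [integral_withDensity_eq_integral_toReal_smul₀ hw.1.enorm (by simp)]
    simp
  rw [hconv] at h4
  have hintg2 : Integrable (fun x => ‖w x‖ * ‖φ x - ‖w x‖⁻¹ • w x‖) μ := by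
    refine (hw.norm.const_mul 2).mono'
      (hw.1.norm.mul (h1.continuous.aestronglyMeasurable.sub hmeas).norm) (ae_of_all _ fun x => ?_)
    rw [Real.norm_of_nonneg (by positivity), mul_comm]
    gcongr
    have h5 : ‖‖w x‖⁻¹ • w x‖ ≤ 1 := by
      rw [norm_smul, norm_inv, norm_norm]
      exact inv_mul_le_one
    linarith [norm_sub_le (φ x) (‖w x‖⁻¹ • w x), h3 x]
  have : ∫ x, ‖w x‖ ∂μ - ∫ x, inner ℝ (φ x) (w x) ∂μ ≤ ε := by
    rw [← integral_sub hw.norm hintg]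
    refine (integral_mono (hw.norm.sub hintg) hintg2 fun x => ?_).trans h4
    change ‖w x‖ - inner ℝ (φ x) (w x) ≤ _
    rcases eq_or_ne (w x) 0 with h0 | h0
    · simp [h0]
    have hpos : 0 < ‖w x‖ := norm_pos_iff.2 h0
    have e : ‖w x‖ - inner ℝ (φ x) (w x) = inner ℝ (‖w x‖⁻¹ • w x - φ x) (w x) := by
      rw [inner_sub_left, real_inner_smul_left, real_inner_self_eq_norm_sq]
      field_simp
    rw [e, mul_comm, norm_sub_rev]
    exact real_inner_le_norm _ _
  linarith

/-- The positive part of an integrable function on an open set is approached by testing with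
continuous functions with values in `[0, 1]` and compact support in the open set. -/
theorem exists_continuous_integral_mul_ge {w : Plane → ℝ} (hw : Integrable w) {U : Set Plane}
    (hU : IsOpen U) {ε : ℝ} (hε : 0 < ε) :
    ∃ f : Plane → ℝ, Continuous f ∧ HasCompactSupport f ∧ tsupport f ⊆ U ∧
      (∀ x, 0 ≤ f x) ∧ (∀ x, f x ≤ 1) ∧
      (∫ x in U, max (w x) 0) - ε ≤ ∫ x, f x * w x := by
  wlog hm : Measurable w generalizing w
  · obtain ⟨w', hw'm, hw'⟩ := hw.1.aemeasurable
    obtain ⟨f, h1, h2, h3, h4, h5, h6⟩ := this (hw.congr hw') hw'm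
    refine ⟨f, h1, h2, h3, h4, h5, ?_⟩
    have e1 : ∫ x in U, max (w x) 0 = ∫ x in U, max (w' x) 0 :=
      integral_congr_ae (ae_restrict_of_ae (hw'.mono fun x hx => by simp only [hx]))
    have e2 : ∫ x, f x * w x = ∫ x, f x * w' x :=
      integral_congr_ae (hw'.mono fun x hx => by simp only [hx])
    rwa [e1, e2]
  set ν : Measure Plane := volume.withDensity fun x => ‖w x‖ₑ with hν
  have hfin : IsFiniteMeasure ν :=
    ⟨by rw [hν, withDensity_apply _ MeasurableSet.univ, Measure.restrict_univ]; exact hw.2⟩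
  have hνr : ∀ s, MeasurableSet s → ν.real s = ∫ x in s, |w x| := fun s hs => by
    rw [measureReal_def, hν, withDensity_apply _ hs,
      ← integral_norm_eq_lintegral_enorm hw.1.restrict]
    rfl
  set S : Set Plane := U ∩ {x | 0 < w x} with hS
  have hSm : MeasurableSet S := hU.measurableSet.inter (measurableSet_lt measurable_const hm)
  obtain ⟨K, hKS, hK, hKm⟩ := hSm.exists_isCompact_lt_add (measure_ne_top ν S)
    (ENNReal.ofReal_pos.2 (half_pos hε)).ne'
  obtain ⟨V, hKV, hV, hVm⟩ := Set.exists_isOpen_lt_add K (measure_ne_top ν K)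
    (ENNReal.ofReal_pos.2 (half_pos hε)).ne'
  obtain ⟨f, hf1, hfc, hfs, hfI⟩ := exists_continuousMap_one_of_isCompact_subset_isOpen hK
    (hV.inter hU) (Set.subset_inter hKV (hKS.trans Set.inter_subset_left))
  have hKme : MeasurableSet K := hK.measurableSet
  refine ⟨f, f.continuous, hfc, hfs.trans Set.inter_subset_right, fun x => (hfI x).1,
    fun x => (hfI x).2, ?_⟩
  have e1 : ∫ x in U, max (w x) 0 = ν.real S := by
    rw [hνr S hSm, hS, ← integral_indicator hU.measurableSet, ← integral_indicator hSm]
    refine integral_congr_ae (ae_of_all _ fun x => ?_)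
    by_cases hx : x ∈ S
    · have h0 : 0 < w x := hx.2
      simp [Set.indicator_of_mem hx, Set.indicator_of_mem hx.1, abs_of_pos h0, h0.le]
    · by_cases hx' : x ∈ U
      · have h0 : w x ≤ 0 := not_lt.1 fun h => hx ⟨hx', h⟩
        simp [Set.indicator_of_notMem hx, Set.indicator_of_mem hx', h0]
      · simp [Set.indicator_of_notMem hx, Set.indicator_of_notMem hx']
  have hi : ∀ s, MeasurableSet s → Integrable (s.indicator fun x => |w x|) := fun s hs =>
    hw.abs.indicator hs
  have hfw : Integrable fun x => f x * w x := by
    refine hw.norm.mono' (f.continuous.aestronglyMeasurable.mul hw.1) (ae_of_all _ fun x => ?_)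
    rw [norm_mul, Real.norm_of_nonneg (hfI x).1]
    exact mul_le_of_le_one_left (norm_nonneg _) (hfI x).2
  have e2 : ν.real K - ν.real (V \ K) ≤ ∫ x, f x * w x := by
    rw [hνr K hKme, hνr _ (hV.measurableSet.diff hKme), ← integral_indicator hKme,
      ← integral_indicator (hV.measurableSet.diff hKme),
      ← integral_sub (hi _ hKme) (hi _ (hV.measurableSet.diff hKme))]
    refine integral_mono ((hi _ hKme).sub (hi _ (hV.measurableSet.diff hKme))) hfw fun x => ?_
    by_cases hxK : x ∈ K
    · have hpos : 0 < w x := (hKS hxK).2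
      have : f x = 1 := by simpa using hf1 hxK
      simp [hxK, this, abs_of_pos hpos]
    · by_cases hxV : x ∈ V
      · have : -(f x * w x) ≤ |w x| := by
          refine (neg_le_abs _).trans ?_
          rw [abs_mul, abs_of_nonneg (hfI x).1]
          exact mul_le_of_le_one_left (abs_nonneg _) (hfI x).2
        simp [hxK, hxV]
        linarith
      · have : f x = 0 := by
          by_contra h
          exact hxV (hfs (subset_tsupport _ h)).1
        simp [hxK, hxV, this]
  have e3 : ν.real S ≤ ν.real K + ε / 2 := by
    have := ENNReal.toReal_mono (by finiteness) hKm.le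
    rwa [ENNReal.toReal_add (by finiteness) (by finiteness),
      ENNReal.toReal_ofReal (by positivity)] at this
  have e4 : ν.real V ≤ ν.real K + ε / 2 := by
    have := ENNReal.toReal_mono (by finiteness) hVm.le
    rwa [ENNReal.toReal_add (by finiteness) (by finiteness),
      ENNReal.toReal_ofReal (by positivity)] at this
  have e5 : ν.real (V \ K) = ν.real V - ν.real K := measureReal_sdiff hKV hKme
  rw [e1]
  linarith

end DipolarDrop
end

noncomputable section

namespace DipolarDrop

/-! ### The Gauss–Green formula and translations -/

theorem continuous_divergence {φ : Plane → Plane} (hφ : ContDiff ℝ 1 φ) :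
    Continuous (divergence φ) := by
  unfold divergence
  have h := hφ.continuous_fderiv one_ne_zero
  refine continuous_finsetSum _ fun i _ => ?_
  have h2 : Continuous fun x => fderiv ℝ φ x (EuclideanSpace.single i 1) := h.clm_apply continuous_const
  fun_prop

theorem hasCompactSupport_divergence {φ : Plane → Plane} (hφ : HasCompactSupport φ) :
    HasCompactSupport (divergence φ) := by
  refine HasCompactSupport.mono (hφ.fderiv (𝕜 := ℝ)) fun x hx => ?_
  contrapose! hx
  simp only [Function.mem_support, not_not] at hx ⊢
  simp [divergence, hx]

theorem divergence_eq_sum {φ : Plane → Plane} (hφ : ContDiff ℝ 1 φ) (x : Plane) :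
    divergence φ x = ∑ i : Fin 2, fderiv ℝ (fun y => φ y i) x (EuclideanSpace.single i 1) := by
  refine Finset.sum_congr rfl fun i _ => ?_
  have hd := (hφ.differentiable one_ne_zero x).hasFDerivAt
  have := ((EuclideanSpace.proj (𝕜 := ℝ) i).hasFDerivAt.comp x hd).fderiv
  exact (congrArg (fun L => L (EuclideanSpace.single i 1)) this).symm

theorem divergence_smul_const {f : Plane → ℝ} (hf : Differentiable ℝ f) (e x : Plane) :
    divergence (fun y => f y • e) x = fderiv ℝ f x e := by
  have h : fderiv ℝ (fun y => f y • e) x = (fderiv ℝ f x).smulRight e :=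
    ((hf x).hasFDerivAt.smul_const e).fderiv
  simp only [divergence, h, ContinuousLinearMap.smulRight_apply, PiLp.smul_apply, smul_eq_mul]
  have he : e = ∑ i, e i • EuclideanSpace.single i (1 : ℝ) := by
    ext j
    fin_cases j <;> simp
  conv_rhs => rw [he, map_sum]
  refine Finset.sum_congr rfl fun i _ => ?_
  rw [map_smul, smul_eq_mul, mul_comm]

theorem isTestField_smul_const {f : Plane → ℝ} (hf : ContDiff ℝ 1 f) (hs : HasCompactSupport f)
    (e : Plane) : IsTestField fun y => f y • e :=
  ⟨hf.smul contDiff_const, hs.smul_right⟩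

theorem hasCompactSupport_comp_sub {F : Type*} [Zero F] {f : Plane → F} (hf : HasCompactSupport f)
    (a : Plane) : HasCompactSupport fun x => f (x - a) :=
  hf.comp_homeomorph (Homeomorph.subRight a)

/-- The increments of a `C¹` function of compact support, integrated over a set. -/
theorem setIntegral_sub_translate {f : Plane → ℝ} (hf : ContDiff ℝ 1 f) (hs : HasCompactSupport f)
    (Ω : Set Plane) (z : Plane) :
    ∫ x in Ω, (f x - f (x - z)) =
      ∫ t in (0 : ℝ)..1, ∫ x in Ω, fderiv ℝ f (x - t • z) z := by
  have hd := hf.continuous_fderiv one_ne_zero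
  have hderiv : ∀ x, ∀ t : ℝ,
      HasDerivAt (fun t : ℝ => - f (x - t • z)) (fderiv ℝ f (x - t • z) z) t := by
    intro x t
    have h1 : HasDerivAt (fun t : ℝ => x - t • z) (-z) t := by
      simpa using ((hasDerivAt_id t).smul_const z).const_sub x
    have h2 := ((hf.differentiable one_ne_zero) (x - t • z)).hasFDerivAt.comp_hasDerivAt t h1
    have h3 := h2.neg
    rw [map_neg, neg_neg] at h3
    exact h3
  have hc : Continuous fun p : ℝ × Plane => fderiv ℝ f (p.2 - p.1 • z) z :=
    (hd.comp (by fun_prop)).clm_apply continuous_const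
  have hFTC : ∀ x, f x - f (x - z) = ∫ t in (0 : ℝ)..1, fderiv ℝ f (x - t • z) z := by
    intro x
    rw [intervalIntegral.integral_eq_sub_of_hasDerivAt (fun t _ => hderiv x t)
      ((hc.comp (continuous_id.prodMk continuous_const)).intervalIntegrable _ _)]
    simp
    ring
  simp_rw [hFTC]
  set K := Metric.cthickening ‖z‖ (tsupport f) with hK
  have hKc : IsCompact K := IsCompact.cthickening hs
  have hzero : ∀ x, ∀ t ∈ Set.Icc (0 : ℝ) 1, x ∉ K → fderiv ℝ f (x - t • z) z = 0 := by
    intro x t ht hx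
    have : x - t • z ∉ tsupport f := fun h => hx <| by
      refine Metric.mem_cthickening_of_dist_le x _ _ _ h ?_
      rw [dist_eq_norm]
      simpa [norm_smul, abs_of_nonneg ht.1] using mul_le_of_le_one_left (norm_nonneg z) ht.2
    rw [image_eq_zero_of_notMem_tsupport fun h => this (tsupport_fderiv_subset ℝ h)]
    rfl
  have hintg : IntegrableOn (fun p : Plane × ℝ => fderiv ℝ f (p.1 - p.2 • z) z)
      (Set.univ ×ˢ Set.Ioc (0 : ℝ) 1) := by
    have h1 : IntegrableOn (fun p : Plane × ℝ => fderiv ℝ f (p.1 - p.2 • z) z)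
        (K ×ˢ Set.Icc (0 : ℝ) 1) :=
      (hc.comp continuous_swap).continuousOn.integrableOn_compact (hKc.prod isCompact_Icc)
    refine h1.of_forall_sdiff_eq_zero (MeasurableSet.univ.prod measurableSet_Ioc) ?_
    rintro ⟨x, t⟩ ⟨⟨-, ht⟩, h⟩
    exact hzero x t ⟨ht.1.le, ht.2⟩ fun hx => h ⟨hx, ht.1.le, ht.2⟩
  simp_rw [intervalIntegral.integral_of_le zero_le_one]
  refine integral_integral_swap (f := fun x t => fderiv ℝ f (x - t • z) z) ?_
  rw [Measure.prod_restrict]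
  exact hintg.mono_set (Set.prod_mono (Set.subset_univ _) subset_rfl)

namespace IsGaussGreenPair

variable {Ω : Set Plane} {μ : Measure Plane} {σ : Plane → Plane}

theorem norm_inner_le (h : IsGaussGreenPair Ω μ σ) (e : Plane) :
    ∀ᵐ x ∂μ, |inner ℝ e (σ x)| ≤ ‖e‖ := by
  filter_upwards [h.unit] with x hx
  simpa [hx] using abs_real_inner_le_norm e (σ x)

theorem integrable_inner (h : IsGaussGreenPair Ω μ σ) (e : Plane) :
    Integrable (fun x => inner ℝ e (σ x)) μ := by
  have := h.finite
  have hm := h.measurable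
  exact (integrable_const ‖e‖).mono' (Measurable.aestronglyMeasurable (by fun_prop))
    (h.norm_inner_le e)

theorem integrable (h : IsGaussGreenPair Ω μ σ) : Integrable σ μ := by
  have := h.finite
  exact (integrable_const (1 : ℝ)).mono' h.measurable.aestronglyMeasurable
    (h.unit.mono fun x hx => hx.le)

theorem integrable_mul_inner (h : IsGaussGreenPair Ω μ σ) (e : Plane) {f : Plane → ℝ}
    (hf : Measurable f) {c : ℝ} (hc : ∀ x, |f x| ≤ c) :
    Integrable (fun x => f x * inner ℝ e (σ x)) μ :=
  (h.integrable_inner e).bdd_mul hf.aestronglyMeasurable (ae_of_all _ hc)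

theorem setIntegral_fderiv (h : IsGaussGreenPair Ω μ σ) {f : Plane → ℝ} (hf : ContDiff ℝ 1 f)
    (hs : HasCompactSupport f) (e : Plane) :
    ∫ x in Ω, fderiv ℝ f x e = ∫ x, f x * inner ℝ e (σ x) ∂μ := by
  have := h.gauss_green _ (isTestField_smul_const hf hs e)
  simpa only [divergence_smul_const (hf.differentiable one_ne_zero), real_inner_smul_left]
    using this

theorem setIntegral_sub_translate_of_contDiff (h : IsGaussGreenPair Ω μ σ) {f : Plane → ℝ}
    (hf : ContDiff ℝ 1 f) (hs : HasCompactSupport f) (z : Plane) :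
    ∫ x in Ω, (f x - f (x - z)) =
      ∫ t in (0 : ℝ)..1, ∫ y, f (y - t • z) * inner ℝ z (σ y) ∂μ := by
  rw [setIntegral_sub_translate hf hs]
  refine intervalIntegral.integral_congr fun t _ => ?_
  have := h.setIntegral_fderiv (f := fun x => f (x - t • z)) (hf.comp (by fun_prop))
    (hasCompactSupport_comp_sub hs _) z
  simpa only [fderiv_comp_sub] using this

theorem continuous_integral_translate (h : IsGaussGreenPair Ω μ σ) {f : Plane → ℝ}
    (hf : Continuous f) (hs : HasCompactSupport f) (e : Plane) :
    Continuous fun z : Plane => ∫ y, f (y - z) * inner ℝ e (σ y) ∂μ := by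
  obtain ⟨c, hc⟩ := hf.bounded_above_of_compact_support hs
  refine continuous_of_dominated (bound := fun y => c * |inner ℝ e (σ y)|) (fun z => ?_)
    (fun z => ae_of_all _ fun y => ?_) ((h.integrable_inner e).abs.const_mul c)
    (ae_of_all _ fun y => by fun_prop)
  · exact ((hf.comp (by fun_prop)).aestronglyMeasurable).mul (h.integrable_inner e).1
  · rw [norm_mul, Real.norm_eq_abs (inner ℝ e (σ y))]
    exact mul_le_mul_of_nonneg_right (hc _) (abs_nonneg _)

/-- The translation formula: the Gauss–Green formula integrated along a segment. -/
theorem setIntegral_sub_translate (h : IsGaussGreenPair Ω μ σ) {f : Plane → ℝ}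
    (hf : Continuous f) (hs : HasCompactSupport f) (z : Plane) :
    ∫ x in Ω, (f x - f (x - z)) =
      ∫ t in (0 : ℝ)..1, ∫ y, f (y - t • z) * inner ℝ z (σ y) ∂μ := by
  have hfin := h.finite
  set V := volume.real (tsupport f)
  have hV : 0 ≤ V := measureReal_nonneg
  set C : ℝ := 2 * V + ‖z‖ * μ.real Set.univ with hC
  have hC0 : 0 ≤ C := by positivity
  refine eq_of_forall_dist_le fun ε hε => ?_
  set κ := ε / (C + 1)
  have hκ : 0 < κ := by positivity
  obtain ⟨φ, hφ, happ, hsupp⟩ := hf.exists_contDiff_approx 1 (ε := fun _ => κ) continuous_const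
    (fun _ => hκ)
  have hφs : HasCompactSupport φ := hs.mono hsupp
  have happ' : ∀ x, |f x - φ x| ≤ κ := fun x => by
    have := (happ x).le
    rwa [dist_comm, Real.dist_eq] at this
  set d : Plane → ℝ := fun x => f x - φ x with hd
  have hdc : Continuous d := hf.sub hφ.continuous
  have hds : Function.support d ⊆ Function.support f := fun x hx => by
    contrapose! hx
    have h1 : f x = 0 := by simpa using hx
    have h2 : φ x = 0 := by
      by_contra h2
      exact hsupp h2 h1
    simp [hd, h1, h2]
  have hdcs : HasCompactSupport d := hs.mono hds
  have hdi : Integrable d := hdc.integrable_of_hasCompactSupport hdcs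
  have hdb : ∫ x, |d x| ≤ κ * V := by
    have h0 : ∀ x, x ∉ tsupport f → |d x| = 0 := fun x hx => by
      rw [abs_eq_zero]
      by_contra h1
      exact hx (subset_tsupport _ (hds h1))
    rw [← setIntegral_eq_integral_of_forall_compl_eq_zero h0]
    have := norm_setIntegral_le_of_norm_le_const (μ := volume) (f := fun x => |d x|)
      (s := tsupport f) (C := κ) hs.measure_lt_top (fun x _ => by simpa using happ' x)
    exact (le_abs_self _).trans this
  have hfi : Integrable f := hf.integrable_of_hasCompactSupport hs
  have hφi : Integrable φ := hφ.continuous.integrable_of_hasCompactSupport hφs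
  have hL : (∫ x in Ω, (f x - f (x - z))) - ∫ x in Ω, (φ x - φ (x - z)) =
      (∫ x in Ω, d x) - ∫ x in Ω, d (x - z) := by
    rw [integral_sub hfi.restrict (hfi.comp_sub_right z).restrict,
      integral_sub hφi.restrict (hφi.comp_sub_right z).restrict,
      integral_sub hfi.restrict hφi.restrict,
      integral_sub (hfi.comp_sub_right z).restrict (hφi.comp_sub_right z).restrict]
    ring
  have hLb : |(∫ x in Ω, d x) - ∫ x in Ω, d (x - z)| ≤ 2 * (κ * V) := by
    have h1 : |∫ x in Ω, d x| ≤ κ * V :=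
      (norm_integral_le_integral_norm _).trans
        ((setIntegral_le_integral hdi.norm (ae_of_all _ fun x => norm_nonneg _)).trans hdb)
    have h2 : |∫ x in Ω, d (x - z)| ≤ κ * V := by
      refine (norm_integral_le_integral_norm _).trans
        ((setIntegral_le_integral (hdi.comp_sub_right z).norm
          (ae_of_all _ fun x => norm_nonneg _)).trans ?_)
      rw [integral_sub_right_eq_self (fun x => ‖d x‖) z]
      exact hdb
    exact (abs_sub _ _).trans (by linarith)
  have hIf : ∀ ψ : Plane → ℝ, Continuous ψ → HasCompactSupport ψ →
      IntervalIntegrable (fun t : ℝ => ∫ y, ψ (y - t • z) * inner ℝ z (σ y) ∂μ) volume 0 1 :=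
    fun ψ h1 h2 => ((h.continuous_integral_translate h1 h2 z).comp
      (by fun_prop : Continuous fun t : ℝ => t • z)).intervalIntegrable _ _
  have hR : (∫ t in (0 : ℝ)..1, ∫ y, f (y - t • z) * inner ℝ z (σ y) ∂μ) -
      (∫ t in (0 : ℝ)..1, ∫ y, φ (y - t • z) * inner ℝ z (σ y) ∂μ) =
      ∫ t in (0 : ℝ)..1, ∫ y, d (y - t • z) * inner ℝ z (σ y) ∂μ := by
    rw [← intervalIntegral.integral_sub (hIf f hf hs) (hIf φ hφ.continuous hφs)]
    refine intervalIntegral.integral_congr fun t _ => ?_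
    obtain ⟨c, hc⟩ := hf.bounded_above_of_compact_support hs
    obtain ⟨c', hc'⟩ := hφ.continuous.bounded_above_of_compact_support hφs
    have h1 := h.integrable_mul_inner z (f := fun y => f (y - t • z))
      (hf.measurable.comp (by fun_prop)) fun x => hc _
    have h2 := h.integrable_mul_inner z (f := fun y => φ (y - t • z))
      (hφ.continuous.measurable.comp (by fun_prop)) fun x => hc' _
    rw [← integral_sub h1 h2]
    refine integral_congr_ae (ae_of_all _ fun y => ?_)
    simp only [hd]
    ring
  have hRb : |∫ t in (0 : ℝ)..1, ∫ y, d (y - t • z) * inner ℝ z (σ y) ∂μ| ≤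
      κ * (‖z‖ * μ.real Set.univ) := by
    have := intervalIntegral.norm_integral_le_of_norm_le_const (a := 0) (b := 1)
      (f := fun t : ℝ => ∫ y, d (y - t • z) * inner ℝ z (σ y) ∂μ)
      (C := κ * ‖z‖ * μ.real Set.univ) (fun t _ => ?_)
    · simpa [mul_assoc] using this
    · refine norm_integral_le_of_norm_le_const ?_
      filter_upwards [h.norm_inner_le z] with y hy
      rw [norm_mul]
      exact mul_le_mul (happ' _) hy (abs_nonneg _) hκ.le
  have heq := h.setIntegral_sub_translate_of_contDiff hφ hφs z
  rw [Real.dist_eq]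
  have : (∫ x in Ω, (f x - f (x - z))) -
      (∫ t in (0 : ℝ)..1, ∫ y, f (y - t • z) * inner ℝ z (σ y) ∂μ) =
      ((∫ x in Ω, d x) - ∫ x in Ω, d (x - z)) -
      ∫ t in (0 : ℝ)..1, ∫ y, d (y - t • z) * inner ℝ z (σ y) ∂μ := by
    rw [← hL, ← hR, heq]; ring
  rw [this]
  calc _ ≤ 2 * (κ * V) + κ * (‖z‖ * μ.real Set.univ) :=
        (abs_sub _ _).trans (add_le_add hLb hRb)
    _ = κ * C := by rw [hC]; ring
    _ ≤ ε := by
        rw [div_mul_eq_mul_div, div_le_iff₀ (by positivity)]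
        nlinarith

/-- The Gauss–Green formula for Lipschitz functions of compact support. -/
theorem setIntegral_lineDeriv (h : IsGaussGreenPair Ω μ σ) {f : Plane → ℝ} {C : NNReal}
    (hf : LipschitzWith C f) (hs : HasCompactSupport f) (e : Plane) (hΩ : MeasurableSet Ω) :
    ∫ x in Ω, lineDeriv ℝ f x e = ∫ x, f x * inner ℝ e (σ x) ∂μ := by
  have hc := hf.continuous
  set K := Metric.cthickening ‖e‖ (tsupport f) with hK
  have hKc : IsCompact K := IsCompact.cthickening hs
  have hKm : MeasurableSet (Ω ∩ K) := hΩ.inter hKc.measurableSet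
  have hzero : ∀ x, x ∉ K → ∀ t ∈ Set.Icc (0 : ℝ) 1, f (x + t • e) = 0 := by
    intro x hx t ht
    refine image_eq_zero_of_notMem_tsupport fun h => hx ?_
    refine Metric.mem_cthickening_of_dist_le x _ _ _ h ?_
    rw [dist_eq_norm]
    simpa [norm_smul, abs_of_nonneg ht.1] using mul_le_of_le_one_left (norm_nonneg e) ht.2
  have hg : Integrable ((Ω ∩ K).indicator fun _ => (1 : ℝ)) :=
    (integrable_indicator_iff hKm).2 (integrableOn_const
      (measure_ne_top_of_subset Set.inter_subset_right hKc.measure_lt_top.ne))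
  have hlim := hf.integral_inv_smul_sub_mul_tendsto_integral_lineDeriv_mul hg e
  have hconv : ∀ F : Plane → ℝ, (∀ x, x ∉ K → F x = 0) →
      ∫ x, F x * (Ω ∩ K).indicator (fun _ => (1 : ℝ)) x = ∫ x in Ω, F x := fun F hF => by
    rw [← integral_indicator hΩ]
    refine integral_congr_ae (ae_of_all _ fun x => ?_)
    by_cases h1 : x ∈ Ω <;> by_cases h2 : x ∈ K <;> simp [h1, h2, hF]
  have hz : ∀ x, x ∉ K → lineDeriv ℝ f x e = 0 := fun x hx => by
    refine HasLineDerivAt.lineDeriv ?_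
    have hx' : x ∉ tsupport f := fun h' => hx (Metric.self_subset_cthickening _ h')
    have : f =ᶠ[𝓝 x] fun _ => 0 := notMem_tsupport_iff_eventuallyEq.1 hx'
    have h1 : HasFDerivAt f (0 : Plane →L[ℝ] ℝ) x :=
      (hasFDerivAt_const (0 : ℝ) x).congr_of_eventuallyEq this
    simpa using h1.hasLineDerivAt e
  rw [hconv _ hz] at hlim
  have hlim2 : Tendsto (fun t : ℝ => ∫ s in (0 : ℝ)..1,
      ∫ y, f (y - s • (-(t • e))) * inner ℝ e (σ y) ∂μ) (𝓝[>] 0)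
      (𝓝 (∫ x, f x * inner ℝ e (σ x) ∂μ)) := by
    have hcont : Continuous fun t : ℝ => ∫ s in (0 : ℝ)..1,
      ∫ y, f (y - s • (-(t • e))) * inner ℝ e (σ y) ∂μ := by
      refine intervalIntegral.continuous_parametric_intervalIntegral_of_continuous' ?_ _ _
      exact (h.continuous_integral_translate hc hs e).comp
        (by fun_prop : Continuous fun p : ℝ × ℝ => p.2 • (-(p.1 • e)))
    have := (hcont.tendsto 0).mono_left (nhdsWithin_le_nhds (s := Set.Ioi 0))
    simpa using this
  refine tendsto_nhds_unique (hlim.congr' ?_) hlim2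
  filter_upwards [Ioc_mem_nhdsGT zero_lt_one] with t ht
  have htne : t ≠ 0 := ht.1.ne'
  rw [hconv _ fun x hx => by
    have h0 := hzero x hx 0 ⟨le_rfl, zero_le_one⟩
    rw [zero_smul, add_zero] at h0
    rw [hzero x hx t ⟨ht.1.le, ht.2⟩, h0, sub_zero, smul_zero]]
  have key := h.setIntegral_sub_translate hc hs (-(t • e))
  have e1 : ∫ x in Ω, t⁻¹ • (f (x + t • e) - f x) =
      - (t⁻¹ * ∫ x in Ω, (f x - f (x - -(t • e)))) := by
    rw [← integral_const_mul, ← integral_neg]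
    refine integral_congr_ae (ae_of_all _ fun x => ?_)
    simp only [sub_neg_eq_add, smul_eq_mul]
    ring
  rw [e1, key, ← intervalIntegral.integral_const_mul, ← intervalIntegral.integral_neg]
  refine intervalIntegral.integral_congr fun s _ => ?_
  rw [← integral_const_mul, ← integral_neg]
  refine integral_congr_ae (ae_of_all _ fun y => ?_)
  simp only [inner_neg_left, real_inner_smul_left]
  field_simp

theorem _root_.DipolarDrop.integral_fderiv_eq_zero {f : Plane → ℝ} (hf : ContDiff ℝ 1 f)
    (hs : HasCompactSupport f) (e : Plane) : ∫ x, fderiv ℝ f x e = 0 := by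
  have hd : Integrable fun x => fderiv ℝ f x e :=
    ((hf.continuous_fderiv one_ne_zero).clm_apply continuous_const).integrable_of_hasCompactSupport
      (hs.fderiv_apply (𝕜 := ℝ) e)
  have := integral_mul_fderiv_eq_neg_fderiv_mul_of_integrable (μ := (volume : Measure Plane))
    (f := fun _ => (1 : ℝ)) (g := f) (v := e) (by simp) (by simpa using hd)
    (by simpa using hf.continuous.integrable_of_hasCompactSupport hs) (fun x _ => by fun_prop)
    (fun x _ => hf.differentiable one_ne_zero x)
  simpa using this

theorem _root_.DipolarDrop.integral_divergence_eq_zero {φ : Plane → Plane} (hφ : IsTestField φ) :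
    ∫ x, divergence φ x = 0 := by
  have hci : ∀ i : Fin 2, ContDiff ℝ 1 fun x => φ x i := fun i => by
    have := hφ.1
    fun_prop
  have hcs : ∀ i : Fin 2, HasCompactSupport fun x => φ x i := fun i =>
    hφ.2.comp_left (g := fun v : Plane => v i) rfl
  simp_rw [divergence_eq_sum hφ.1]
  rw [integral_finsetSum]
  · exact Finset.sum_eq_zero fun i _ => integral_fderiv_eq_zero (hci i) (hcs i) _
  · intro i _
    exact (((hci i).continuous_fderiv one_ne_zero).clm_apply
      continuous_const).integrable_of_hasCompactSupport ((hcs i).fderiv_apply (𝕜 := ℝ) _)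

theorem compl (h : IsGaussGreenPair Ω μ σ) (hΩ : NullMeasurableSet Ω) :
    IsGaussGreenPair Ωᶜ μ fun x => - σ x where
  finite := h.finite
  measurable := h.measurable.neg
  unit := by simpa using h.unit
  gauss_green φ hφ := by
    have hi : Integrable (divergence φ) :=
      (continuous_divergence hφ.1).integrable_of_hasCompactSupport
        (hasCompactSupport_divergence hφ.2)
    have h1 := integral_add_compl₀ hΩ hi
    rw [integral_divergence_eq_zero hφ, h.gauss_green φ hφ] at h1
    simp only [inner_neg_right, integral_neg]
    linarith

end IsGaussGreenPair

end DipolarDrop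
end

noncomputable section

namespace DipolarDrop

/-! ### Translates of sets of finite perimeter -/

theorem integrable_charFn {Ω : Set Plane} (hΩ : MeasurableSet Ω) (hv : volume Ω ≠ ∞) :
    Integrable (charFn Ω) :=
  (integrable_indicator_iff hΩ).2 (integrableOn_const hv)

theorem measurable_charFn {Ω : Set Plane} (hΩ : MeasurableSet Ω) : Measurable (charFn Ω) :=
  measurable_const.indicator hΩ

theorem charFn_nonneg (Ω : Set Plane) (x : Plane) : 0 ≤ charFn Ω x :=
  Set.indicator_nonneg (fun _ _ => zero_le_one) x

theorem charFn_le_one (Ω : Set Plane) (x : Plane) : charFn Ω x ≤ 1 :=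
  Set.indicator_le_self' (fun _ _ => zero_le_one) x |>.trans le_rfl

theorem charFn_of_mem {Ω : Set Plane} {x : Plane} (hx : x ∈ Ω) : charFn Ω x = 1 := by
  simp [charFn, hx]

theorem charFn_of_notMem {Ω : Set Plane} {x : Plane} (hx : x ∉ Ω) : charFn Ω x = 0 := by
  simp [charFn, hx]

theorem integrable_charFn_sub {Ω : Set Plane} (hΩ : MeasurableSet Ω) (hv : volume Ω ≠ ∞)
    (z : Plane) : Integrable fun x => charFn Ω (x + z) - charFn Ω x :=
  ((integrable_charFn hΩ hv).comp_add_right z).sub (integrable_charFn hΩ hv)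

theorem integral_mul_charFn {Ω : Set Plane} (hΩ : MeasurableSet Ω) (f : Plane → ℝ) :
    ∫ x, f x * charFn Ω x = ∫ x in Ω, f x := by
  rw [← integral_indicator hΩ]
  refine integral_congr_ae (ae_of_all _ fun x => ?_)
  by_cases hx : x ∈ Ω <;> simp [charFn, hx]

/-- Moving a translation from a characteristic function onto a test function. -/
theorem integral_mul_charFn_translate_sub {Ω : Set Plane} (hΩ : MeasurableSet Ω)
    {f : Plane → ℝ} (hf : Continuous f) (hs : HasCompactSupport f) (z : Plane) :
    ∫ x, f x * (charFn Ω (x + z) - charFn Ω x) = - ∫ x in Ω, (f x - f (x - z)) := by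
  have hfi : Integrable f := hf.integrable_of_hasCompactSupport hs
  have hb : ∀ x, ‖charFn Ω x‖ ≤ 1 := fun x => by
    rw [Real.norm_of_nonneg (charFn_nonneg _ _)]
    exact charFn_le_one _ _
  have h1 : Integrable fun x => f x * charFn Ω x :=
    hfi.mul_bdd (measurable_charFn hΩ).aestronglyMeasurable (ae_of_all _ hb)
  have h2 : Integrable fun x => f x * charFn Ω (x + z) :=
    hfi.mul_bdd ((measurable_charFn hΩ).comp (by fun_prop)).aestronglyMeasurable
      (ae_of_all _ fun x => hb (x + z))
  have e : ∫ x, f x * charFn Ω (x + z) = ∫ x in Ω, f (x - z) := by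
    rw [← integral_mul_charFn hΩ, ← integral_add_right_eq_self (fun x => f (x - z) * charFn Ω x) z]
    simp only [add_sub_cancel_right]
  simp_rw [mul_sub]
  rw [integral_sub h2 h1, integral_mul_charFn hΩ, e,
    integral_sub hfi.restrict (hfi.comp_sub_right z).restrict]
  ring

theorem setIntegral_divergence_le_perimeter {Ω : Set Plane} (hP : perimeter Ω ≠ ∞)
    {φ : Plane → Plane} (hφ : IsTestField φ) (hn : ∀ x, ‖φ x‖ ≤ 1) :
    ∫ x in Ω, divergence φ x ≤ (perimeter Ω).toReal := by
  rw [← ENNReal.ofReal_le_iff_le_toReal hP]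
  exact le_iSup₂ (f := fun (φ : Plane → Plane) (_ : IsTestField φ ∧ ∀ x, ‖φ x‖ ≤ 1) =>
    ENNReal.ofReal (∫ x in Ω, divergence φ x)) φ ⟨hφ, hn⟩

theorem setIntegral_fderiv_le_perimeter {Ω : Set Plane} (hP : perimeter Ω ≠ ∞)
    {f : Plane → ℝ} (hf : ContDiff ℝ 1 f) (hs : HasCompactSupport f) (hn : ∀ x, |f x| ≤ 1)
    (z : Plane) : ∫ x in Ω, fderiv ℝ f x z ≤ ‖z‖ * (perimeter Ω).toReal := by
  rcases eq_or_ne z 0 with rfl | hz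
  · simp
  have hz' : 0 < ‖z‖ := norm_pos_iff.2 hz
  have h1 := setIntegral_divergence_le_perimeter hP
    (isTestField_smul_const hf hs (‖z‖⁻¹ • z)) fun x => by
      rw [norm_smul, norm_smul, norm_inv, norm_norm, inv_mul_cancel₀ hz'.ne', mul_one]
      exact hn x
  simp_rw [divergence_smul_const (hf.differentiable one_ne_zero), map_smul, smul_eq_mul] at h1
  rwa [integral_const_mul, inv_mul_le_iff₀ hz'] at h1

/-- The symmetric difference of a set with its translate is controlled by the perimeter. -/
theorem integral_abs_charFn_translate_sub_le {Ω : Set Plane} (hΩ : MeasurableSet Ω)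
    (hv : volume Ω ≠ ∞) (hP : perimeter Ω ≠ ∞) (z : Plane) :
    ∫ x, |charFn Ω (x + z) - charFn Ω x| ≤ ‖z‖ * (perimeter Ω).toReal := by
  refine le_of_forall_pos_le_add fun ε hε => ?_
  obtain ⟨φ, h1, h2, h3, h4⟩ := exists_testField_integral_inner_ge volume
    (integrable_charFn_sub hΩ hv z) hε
  have h5 : ∫ x, inner ℝ (φ x) (charFn Ω (x + z) - charFn Ω x) ≤
      ‖z‖ * (perimeter Ω).toReal := by
    have e : ∀ x, inner ℝ (φ x) (charFn Ω (x + z) - charFn Ω x) =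
        φ x * (charFn Ω (x + z) - charFn Ω x) := fun x => by simp [mul_comm]
    simp_rw [e]
    rw [integral_mul_charFn_translate_sub hΩ h1.continuous h2 z,
      setIntegral_sub_translate h1 h2, ← intervalIntegral.integral_neg]
    have hle : ∀ t ∈ Set.uIoc (0 : ℝ) 1, ‖- ∫ x in Ω, fderiv ℝ φ (x - t • z) z‖ ≤
        ‖z‖ * (perimeter Ω).toReal := fun t _ => by
      have h6 := fun v => setIntegral_fderiv_le_perimeter hP (f := fun x => φ (x - t • z))
        (h1.comp (by fun_prop)) (hasCompactSupport_comp_sub h2 _) (fun x => h3 _) v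
      simp only [fderiv_comp_sub] at h6
      have h7 := h6 (-z)
      simp only [map_neg, integral_neg, norm_neg] at h7
      rw [norm_neg, Real.norm_eq_abs, abs_le]
      exact ⟨by linarith, h6 z⟩
    have := intervalIntegral.norm_integral_le_of_norm_le_const hle
    rw [sub_zero, abs_one, mul_one] at this
    exact (le_abs_self _).trans this
  simp only [Real.norm_eq_abs] at h4
  linarith

/-! ### Existence of the Gauss–Green measure -/

open CompactlySupported in
/-- A sequence of nonnegative densities of bounded mass has a vague limit along an ultrafilter. -/
theorem exists_vague_limit (w : ℕ → Plane → ℝ) (hw : ∀ n, Integrable (w n))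
    (h0 : ∀ n x, 0 ≤ w n x) (C : ℝ) (hC : ∀ n, ∫ x, w n x ≤ C) :
    ∃ m : Measure Plane, IsFiniteMeasure m ∧ ∀ f : Plane → ℝ, Continuous f → HasCompactSupport f →
      Tendsto (fun n => ∫ x, f x * w n x) (hyperfilter ℕ) (𝓝 (∫ x, f x ∂m)) := by
  have hintg : ∀ (f : C_c(Plane, ℝ)) n, Integrable fun x => f x * w n x := fun f n => by
    obtain ⟨c, hc⟩ := f.continuous.bounded_above_of_compact_support f.hasCompactSupport
    exact (hw n).bdd_mul f.continuous.aestronglyMeasurable (ae_of_all _ hc)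
  have hbd : ∀ (f : C_c(Plane, ℝ)) (c : ℝ), 0 ≤ c → (∀ x, ‖f x‖ ≤ c) → ∀ n,
      |∫ x, f x * w n x| ≤ c * C := fun f c hc0 hc n => by
    calc |∫ x, f x * w n x| ≤ ∫ x, ‖f x * w n x‖ := by
          rw [← Real.norm_eq_abs]
          exact norm_integral_le_integral_norm _
      _ ≤ ∫ x, c * w n x := by
          refine integral_mono (hintg f n).norm ((hw n).const_mul c) fun x => ?_
          simp only [norm_mul, Real.norm_of_nonneg (h0 n x)]
          exact mul_le_mul_of_nonneg_right (hc x) (h0 n x)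
      _ = c * ∫ x, w n x := integral_const_mul _ _
      _ ≤ c * C := mul_le_mul_of_nonneg_left (hC n) hc0
  have hL : ∀ f : C_c(Plane, ℝ), ∃ l : ℝ,
      Tendsto (fun n => ∫ x, f x * w n x) (hyperfilter ℕ) (𝓝 l) := fun f => by
    obtain ⟨c, hc⟩ := f.continuous.bounded_above_of_compact_support f.hasCompactSupport
    have hc0 : 0 ≤ c := (norm_nonneg _).trans (hc 0)
    have hmem : ∀ n, (∫ x, f x * w n x) ∈ Set.Icc (-(c * C)) (c * C) := fun n =>
      abs_le.1 (hbd f c hc0 hc n)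
    obtain ⟨l, -, hl⟩ := (isCompact_Icc (a := -(c * C)) (b := c * C)).ultrafilter_le_nhds
      ((hyperfilter ℕ).map fun n => ∫ x, f x * w n x)
      (le_principal_iff.2 (Ultrafilter.mem_map.2 (univ_mem' hmem)))
    exact ⟨l, hl⟩
  choose Λ hΛ using hL
  let Λ' : C_c(Plane, ℝ) →ₚ[ℝ] ℝ :=
  { toFun := Λ
    map_add' g g' := by
      refine tendsto_nhds_unique (hΛ (g + g')) (((hΛ g).add (hΛ g')).congr fun n => ?_)
      rw [← integral_add (hintg g n) (hintg g' n)]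
      refine integral_congr_ae (ae_of_all _ fun x => ?_)
      simp [add_mul]
    map_smul' c g := by
      refine tendsto_nhds_unique (hΛ (c • g)) (((hΛ g).const_smul c).congr fun n => ?_)
      rw [← integral_smul]
      refine integral_congr_ae (ae_of_all _ fun x => ?_)
      simp [mul_assoc]
    monotone' g g' hgg' := by
      refine le_of_tendsto_of_tendsto' (hΛ g) (hΛ g') fun n => ?_
      refine integral_mono (hintg g n) (hintg g' n) fun x => ?_
      exact mul_le_mul_of_nonneg_right (hgg' x) (h0 n x) }
  refine ⟨RealRMK.rieszMeasure Λ', ⟨?_⟩, fun f hf hs => ?_⟩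
  · have hball : ∀ n : ℕ, RealRMK.rieszMeasure Λ' (Metric.closedBall 0 n) ≤ ENNReal.ofReal C := by
      intro n
      obtain ⟨f, hf1, hfc, -, hfI⟩ := exists_continuousMap_one_of_isCompact_subset_isOpen
        (isCompact_closedBall (0 : Plane) n) isOpen_univ (Set.subset_univ _)
      let F : C_c(Plane, ℝ) := ⟨f, hfc⟩
      refine (RealRMK.rieszMeasure_le_of_eq_one Λ' (f := F) (fun x => (hfI x).1)
        (isCompact_closedBall (0 : Plane) n) (fun x hx => hf1 hx)).trans ?_
      refine ENNReal.ofReal_le_ofReal (le_of_tendsto (hΛ F) (Eventually.of_forall fun k => ?_))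
      have := (le_abs_self _).trans (hbd F 1 zero_le_one (fun x => by
        change ‖f x‖ ≤ 1
        rw [Real.norm_of_nonneg (hfI x).1]
        exact (hfI x).2) k)
      simpa using this
    have hun : (Set.univ : Set Plane) = ⋃ n : ℕ, Metric.closedBall 0 n := by
      rw [Metric.iUnion_closedBall_nat]
    rw [hun, Monotone.measure_iUnion fun a b hab =>
      Metric.closedBall_subset_closedBall (by exact_mod_cast hab)]
    exact (iSup_le hball).trans_lt ENNReal.ofReal_lt_top
  · have h1 := hΛ ⟨⟨f, hf⟩, hs⟩
    have h2 := RealRMK.integral_rieszMeasure Λ' ⟨⟨f, hf⟩, hs⟩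
    have h3 : ∫ x, f x ∂(RealRMK.rieszMeasure Λ') = Λ ⟨⟨f, hf⟩, hs⟩ := h2
    rw [h3]
    exact h1

/-- The distributional derivative of a set of finite perimeter in a given direction is a difference
of two finite measures. -/
theorem exists_directional_measures {Ω : Set Plane} (hΩ : MeasurableSet Ω) (hv : volume Ω ≠ ∞)
    (hP : perimeter Ω ≠ ∞) (e : Plane) :
    ∃ m₁ m₂ : Measure Plane, IsFiniteMeasure m₁ ∧ IsFiniteMeasure m₂ ∧
      ∀ f : Plane → ℝ, ContDiff ℝ 1 f → HasCompactSupport f →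
        ∫ x in Ω, fderiv ℝ f x e = ∫ x, f x ∂m₁ - ∫ x, f x ∂m₂ := by
  set h : ℕ → ℝ := fun n => 1 / ((n : ℝ) + 1) with hh
  have hpos : ∀ n, 0 < h n := fun n => Nat.one_div_pos_of_nat
  set w : ℕ → Plane → ℝ := fun n x =>
    (h n)⁻¹ * (charFn Ω (x + h n • e) - charFn Ω x) with hw
  have hwi : ∀ n, Integrable (w n) := fun n => (integrable_charFn_sub hΩ hv _).const_mul _
  have hwb : ∀ n, ∫ x, |w n x| ≤ ‖e‖ * (perimeter Ω).toReal := fun n => by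
    simp only [hw, abs_mul, abs_of_pos (inv_pos.2 (hpos n))]
    rw [integral_const_mul, inv_mul_le_iff₀ (hpos n)]
    refine (integral_abs_charFn_translate_sub_le hΩ hv hP _).trans (le_of_eq ?_)
    rw [norm_smul, Real.norm_of_nonneg (hpos n).le, mul_assoc]
  obtain ⟨m₁, hf₁, hm₁⟩ := exists_vague_limit (fun n x => max (-w n x) 0)
    (fun n => (hwi n).neg.pos_part) (fun n x => le_max_right _ _) _
    (fun n => (integral_mono (hwi n).neg.pos_part (hwi n).abs fun x =>
      max_le (neg_le_abs _) (abs_nonneg _)).trans (hwb n))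
  obtain ⟨m₂, hf₂, hm₂⟩ := exists_vague_limit (fun n x => max (w n x) 0)
    (fun n => (hwi n).pos_part) (fun n x => le_max_right _ _) _
    (fun n => (integral_mono (hwi n).pos_part (hwi n).abs fun x =>
      max_le (le_abs_self _) (abs_nonneg _)).trans (hwb n))
  refine ⟨m₁, m₂, hf₁, hf₂, fun f hf hs => ?_⟩
  obtain ⟨C, hC⟩ := hf.lipschitzWith_of_hasCompactSupport hs one_ne_zero
  have hlim := hC.integral_inv_smul_sub_mul_tendsto_integral_lineDeriv_mul
    (integrable_charFn hΩ hv) (-e)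
  rw [integral_mul_charFn hΩ] at hlim
  have hle : ∀ x, lineDeriv ℝ f x (-e) = - fderiv ℝ f x e := fun x => by
    rw [(hf.differentiable one_ne_zero x).lineDeriv_eq_fderiv, map_neg]
  simp only [hle, integral_neg] at hlim
  have hh0 : Tendsto h atTop (𝓝[>] 0) :=
    tendsto_nhdsWithin_iff.2 ⟨tendsto_one_div_add_atTop_nhds_zero_nat,
      Eventually.of_forall hpos⟩
  have hlim2 := (hlim.comp (hh0.mono_left Nat.hyperfilter_le_atTop)).neg
  rw [neg_neg] at hlim2
  refine tendsto_nhds_unique hlim2 (((hm₁ f hf.continuous hs).sub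
    (hm₂ f hf.continuous hs)).congr fun n => ?_)
  obtain ⟨c, hc⟩ := hf.continuous.bounded_above_of_compact_support hs
  have i1 : Integrable fun x => f x * max (-w n x) 0 :=
    (hwi n).neg.pos_part.bdd_mul hf.continuous.aestronglyMeasurable (ae_of_all _ hc)
  have i2 : Integrable fun x => f x * max (w n x) 0 :=
    (hwi n).pos_part.bdd_mul hf.continuous.aestronglyMeasurable (ae_of_all _ hc)
  rw [← integral_sub i1 i2]
  have e1 : ∀ x, f x * max (-w n x) 0 - f x * max (w n x) 0 =
      -(h n)⁻¹ * (f x * (charFn Ω (x + h n • e) - charFn Ω x)) := fun x => by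
    have : max (-w n x) 0 - max (w n x) 0 = -w n x := by
      rcases le_total (w n x) 0 with h | h <;> simp [h]
    rw [← mul_sub, this]
    simp only [hw]
    ring
  simp only [e1, Function.comp]
  rw [integral_const_mul, integral_mul_charFn_translate_sub hΩ hf.continuous hs,
    integral_mul_charFn hΩ, ← integral_neg, ← integral_neg, ← integral_const_mul]
  refine integral_congr_ae (ae_of_all _ fun x => ?_)
  simp only [smul_neg, ← sub_eq_add_neg, smul_eq_mul]
  ring

theorem exists_isGaussGreenPair {Ω : Set Plane} (hΩ : MeasurableSet Ω) (hv : volume Ω ≠ ∞)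
    (hP : perimeter Ω ≠ ∞) : ∃ μ σ, IsGaussGreenPair Ω μ σ := by
  have H := fun i : Fin 2 => exists_directional_measures hΩ hv hP (EuclideanSpace.single i 1)
  choose m₁ m₂ hf₁ hf₂ hm using H
  set lam : Measure Plane := ∑ i, (m₁ i + m₂ i) with hlam
  have hlamf : IsFiniteMeasure lam := by
    rw [hlam]; infer_instance
  have hle : ∀ i, m₁ i + m₂ i ≤ lam := fun i =>
    Finset.single_le_sum (f := fun i => m₁ i + m₂ i) (fun _ _ => Measure.zero_le _)
      (Finset.mem_univ i)
  have hac₁ : ∀ i, m₁ i ≪ lam := fun i =>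
    Measure.absolutelyContinuous_of_le ((Measure.le_add_right le_rfl).trans (hle i))
  have hac₂ : ∀ i, m₂ i ≪ lam := fun i =>
    Measure.absolutelyContinuous_of_le ((Measure.le_add_left le_rfl).trans (hle i))
  set s : Plane → Plane := fun x => WithLp.toLp 2 fun i =>
    ((m₁ i).rnDeriv lam x).toReal - ((m₂ i).rnDeriv lam x).toReal with hs
  have hsm : Measurable s := by
    refine (WithLp.measurable_toLp 2 _).comp (measurable_pi_lambda _ fun i => ?_)
    exact ((Measure.measurable_rnDeriv _ _).ennreal_toReal).sub
      (Measure.measurable_rnDeriv _ _).ennreal_toReal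
  have hsi : Integrable s lam := by
    have h1 : ∀ i, Integrable (fun x => s x i) lam := fun i =>
      Measure.integrable_toReal_rnDeriv.sub Measure.integrable_toReal_rnDeriv
    have h2 : Integrable (fun x => ∑ i, ‖s x i‖) lam :=
      integrable_finsetSum _ fun i _ => (h1 i).norm
    refine h2.mono' hsm.aestronglyMeasurable (ae_of_all _ fun x => ?_)
    rw [EuclideanSpace.norm_eq]
    refine Real.sqrt_le_iff.2 ⟨by positivity, ?_⟩
    simp only [Fin.sum_univ_two]
    nlinarith [norm_nonneg (s x 0), norm_nonneg (s x 1)]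
  refine ⟨lam.withDensity fun x => ‖s x‖ₑ, fun x => ‖s x‖⁻¹ • s x, ⟨?_⟩, ?_, ?_, ?_⟩
  · rw [withDensity_apply _ MeasurableSet.univ, Measure.restrict_univ]
    exact hsi.2
  · exact hsm.norm.inv.smul hsm
  · rw [ae_withDensity_iff hsm.enorm]
    refine ae_of_all _ fun x hx => ?_
    have : s x ≠ 0 := by simpa using hx
    rw [norm_smul, norm_inv, norm_norm, inv_mul_cancel₀ (norm_ne_zero_iff.2 this)]
  · intro φ hφ
    have hci : ∀ i : Fin 2, ContDiff ℝ 1 fun x => φ x i := fun i => by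
      have := hφ.1
      fun_prop
    have hcs : ∀ i : Fin 2, HasCompactSupport fun x => φ x i := fun i =>
      hφ.2.comp_left (g := fun v : Plane => v i) rfl
    have hrn : ∀ (m : Measure Plane) [IsFiniteMeasure m], m ≪ lam → ∀ f : Plane → ℝ,
        ∫ x, f x ∂m = ∫ x, (m.rnDeriv lam x).toReal * f x ∂lam := by
      intro m hmf hm f
      have := Measure.haveLebesgueDecomposition_of_sigmaFinite m lam
      exact (integral_rnDeriv_smul hm).symm
    have hintg : ∀ (m : Measure Plane) [IsFiniteMeasure m], ∀ i,
        Integrable (fun x => (m.rnDeriv lam x).toReal * φ x i) lam := fun m _ i => by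
      obtain ⟨c, hc⟩ := (hci i).continuous.bounded_above_of_compact_support (hcs i)
      exact Measure.integrable_toReal_rnDeriv.mul_bdd (hci i).continuous.aestronglyMeasurable
        (ae_of_all _ hc)
    rw [integral_withDensity_eq_integral_toReal_smul₀ hsm.enorm.aemeasurable (by simp)]
    have e1 : ∀ x, (‖s x‖ₑ).toReal • inner ℝ (φ x) (‖s x‖⁻¹ • s x) =
        ∑ i, (((m₁ i).rnDeriv lam x).toReal * φ x i - ((m₂ i).rnDeriv lam x).toReal * φ x i) := by
      intro x
      have : (‖s x‖ₑ).toReal • inner ℝ (φ x) (‖s x‖⁻¹ • s x) = inner ℝ (φ x) (s x) := by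
        rw [real_inner_smul_right, toReal_enorm, smul_eq_mul]
        rcases eq_or_ne (s x) 0 with h0 | h0
        · simp [h0]
        · rw [mul_inv_cancel_left₀ (norm_ne_zero_iff.2 h0)]
      rw [this, PiLp.inner_apply]
      refine Finset.sum_congr rfl fun i _ => ?_
      simp [hs]
      ring
    simp_rw [e1, divergence_eq_sum hφ.1]
    have hintg' : ∀ i, Integrable (fun x => ((m₁ i).rnDeriv lam x).toReal * φ x i -
        ((m₂ i).rnDeriv lam x).toReal * φ x i) lam := fun i =>
      (hintg (m₁ i) i).sub (hintg (m₂ i) i)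
    rw [integral_finsetSum _ fun i _ => hintg' i, integral_finsetSum]
    · refine Finset.sum_congr rfl fun i _ => ?_
      rw [hm i _ (hci i) (hcs i), integral_sub (hintg (m₁ i) i) (hintg (m₂ i) i),
        hrn _ (hac₁ i), hrn _ (hac₂ i)]
    · intro i _
      exact ((((hci i).continuous_fderiv one_ne_zero).clm_apply
        continuous_const).integrable_of_hasCompactSupport
          ((hcs i).fderiv_apply (𝕜 := ℝ) _)).restrict

/-- The perimeter is the total mass of the Gauss–Green measure. -/
theorem IsGaussGreenPair.perimeter_eq {Ω : Set Plane} {μ : Measure Plane} {σ : Plane → Plane}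
    (h : IsGaussGreenPair Ω μ σ) : perimeter Ω = μ Set.univ := by
  have hfin := h.finite
  have hnorm : ∫ x, ‖σ x‖ ∂μ = μ.real Set.univ := by
    rw [integral_congr_ae (g := fun _ => (1 : ℝ)) h.unit]
    simp
  refine le_antisymm (iSup₂_le fun φ hφ => ?_) ?_
  · rw [h.gauss_green φ hφ.1, ENNReal.ofReal_le_iff_le_toReal (measure_ne_top _ _)]
    change _ ≤ μ.real Set.univ
    rw [← hnorm]
    have hi : Integrable (fun x => inner ℝ (φ x) (σ x)) μ := by
      refine h.integrable.norm.mono' (hφ.1.1.continuous.aestronglyMeasurable.inner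
        h.integrable.1) (ae_of_all _ fun x => ?_)
      exact (norm_inner_le_norm _ _).trans (mul_le_of_le_one_left (norm_nonneg _) (hφ.2 x))
    refine integral_mono hi h.integrable.norm fun x => ?_
    exact (real_inner_le_norm _ _).trans (mul_le_of_le_one_left (norm_nonneg _) (hφ.2 x))
  · rw [← ENNReal.ofReal_toReal (measure_ne_top μ Set.univ)]
    refine ENNReal.le_of_forall_pos_le_add fun ε hε _ => ?_
    obtain ⟨φ, h1, h2, h3, h4⟩ := exists_testField_integral_inner_ge μ h.integrable
      (ε := ε) (by exact_mod_cast hε)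
    rw [hnorm, ← h.gauss_green φ ⟨h1, h2⟩] at h4
    have h5 : ENNReal.ofReal (∫ x in Ω, divergence φ x) ≤ perimeter Ω :=
      le_iSup₂ (f := fun (φ : Plane → Plane) (_ : IsTestField φ ∧ ∀ x, ‖φ x‖ ≤ 1) =>
        ENNReal.ofReal (∫ x in Ω, divergence φ x)) φ ⟨⟨h1, h2⟩, h3⟩
    calc ENNReal.ofReal (μ Set.univ).toReal
        ≤ ENNReal.ofReal ((∫ x in Ω, divergence φ x) + ε) := by
          refine ENNReal.ofReal_le_ofReal ?_
          change μ.real Set.univ ≤ _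
          linarith
      _ ≤ ENNReal.ofReal (∫ x in Ω, divergence φ x) + ENNReal.ofReal ε :=
          ENNReal.ofReal_add_le
      _ ≤ perimeter Ω + ε := by
          gcongr
          simp

end DipolarDrop
end

noncomputable section

namespace DipolarDrop

/-! ### Uniqueness of the Gauss–Green measure and the outer normal -/

namespace IsGaussGreenPair

variable {Ω : Set Plane} {μ μ' : Measure Plane} {σ σ' : Plane → Plane}

theorem integral_smul_eq (h : IsGaussGreenPair Ω μ σ) (h' : IsGaussGreenPair Ω μ' σ')
    {f : Plane → ℝ} (hf : ContDiff ℝ 1 f) (hs : HasCompactSupport f) :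
    ∫ x, f x • σ x ∂μ = ∫ x, f x • σ' x ∂μ' := by
  obtain ⟨c, hc⟩ := hf.continuous.bounded_above_of_compact_support hs
  have hi : Integrable (fun x => f x • σ x) μ :=
    h.integrable.bdd_smul c hf.continuous.aestronglyMeasurable (ae_of_all _ hc)
  have hi' : Integrable (fun x => f x • σ' x) μ' :=
    h'.integrable.bdd_smul c hf.continuous.aestronglyMeasurable (ae_of_all _ hc)
  refine ext_inner_left ℝ fun e => ?_
  rw [← integral_inner hi, ← integral_inner hi']
  simp only [real_inner_smul_right]
  rw [← h.setIntegral_fderiv hf hs, ← h'.setIntegral_fderiv hf hs]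

theorem unique (h : IsGaussGreenPair Ω μ σ) (h' : IsGaussGreenPair Ω μ' σ') :
    μ = μ' ∧ σ =ᵐ[μ] σ' := by
  have hf := h.finite
  have hf' := h'.finite
  set lam := μ + μ' with hlam
  have hac : μ ≪ lam := Measure.absolutelyContinuous_of_le (Measure.le_add_right le_rfl)
  have hac' : μ' ≪ lam := Measure.absolutelyContinuous_of_le (Measure.le_add_left le_rfl)
  have hd := Measure.haveLebesgueDecomposition_of_sigmaFinite μ lam
  have hd' := Measure.haveLebesgueDecomposition_of_sigmaFinite μ' lam
  have hw : lam.withDensity (μ.rnDeriv lam) = μ := Measure.withDensity_rnDeriv_eq _ _ hac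
  have hw' : lam.withDensity (μ'.rnDeriv lam) = μ' := Measure.withDensity_rnDeriv_eq _ _ hac'
  have hi : Integrable (fun x => (μ.rnDeriv lam x).toReal • σ x) lam :=
    (integrable_rnDeriv_smul_iff hac).2 h.integrable
  have hi' : Integrable (fun x => (μ'.rnDeriv lam x).toReal • σ' x) lam :=
    (integrable_rnDeriv_smul_iff hac').2 h'.integrable
  have hzero : ∀ᵐ x ∂lam, (μ.rnDeriv lam x).toReal • σ x - (μ'.rnDeriv lam x).toReal • σ' x = 0 := by
    refine ae_eq_zero_of_integral_contDiff_smul_eq_zero (hi.sub hi').locallyIntegrable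
      fun g hg hgs => ?_
    have hg1 : ContDiff ℝ 1 g := hg.of_le (by exact_mod_cast le_top)
    obtain ⟨c, hc⟩ := hg.continuous.bounded_above_of_compact_support hgs
    simp only [smul_sub]
    have i1 : Integrable (fun x => g x • (μ.rnDeriv lam x).toReal • σ x) lam :=
      hi.bdd_smul c hg.continuous.aestronglyMeasurable (ae_of_all _ hc)
    have i2 : Integrable (fun x => g x • (μ'.rnDeriv lam x).toReal • σ' x) lam :=
      hi'.bdd_smul c hg.continuous.aestronglyMeasurable (ae_of_all _ hc)
    rw [integral_sub i1 i2]
    simp_rw [smul_comm (g _)]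
    rw [integral_rnDeriv_smul hac, integral_rnDeriv_smul hac', h.integral_smul_eq h' hg1 hgs,
      sub_self]
  have hu : ∀ᵐ x ∂lam, μ.rnDeriv lam x ≠ 0 → ‖σ x‖ = 1 := by
    have := h.unit
    rwa [← hw, ae_withDensity_iff (Measure.measurable_rnDeriv _ _)] at this
  have hu' : ∀ᵐ x ∂lam, μ'.rnDeriv lam x ≠ 0 → ‖σ' x‖ = 1 := by
    have := h'.unit
    rwa [← hw', ae_withDensity_iff (Measure.measurable_rnDeriv _ _)] at this
  have hr : ∀ (m : Measure Plane) (s : Plane → Plane) (x : Plane),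
      (m.rnDeriv lam x ≠ 0 → ‖s x‖ = 1) →
      ‖(m.rnDeriv lam x).toReal • s x‖ = (m.rnDeriv lam x).toReal := fun m s x hx => by
    rw [norm_smul, Real.norm_of_nonneg ENNReal.toReal_nonneg]
    by_cases h0 : m.rnDeriv lam x = 0
    · simp [h0]
    · rw [hx h0, mul_one]
  have heq : μ.rnDeriv lam =ᵐ[lam] μ'.rnDeriv lam := by
    filter_upwards [hzero, hu, hu', Measure.rnDeriv_lt_top μ lam, Measure.rnDeriv_lt_top μ' lam]
      with x h0 h1 h1' h2 h2'
    have := congrArg norm (sub_eq_zero.1 h0)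
    rw [hr μ σ x h1, hr μ' σ' x h1'] at this
    exact (ENNReal.toReal_eq_toReal_iff' h2.ne h2'.ne).1 this
  have hμ : μ = μ' := by
    rw [← hw, ← hw']
    exact withDensity_congr_ae heq
  refine ⟨hμ, ?_⟩
  rw [Filter.EventuallyEq, ← hw, ae_withDensity_iff (Measure.measurable_rnDeriv _ _)]
  filter_upwards [hzero, heq, Measure.rnDeriv_lt_top μ lam] with x h0 h1 h2 h3
  rw [← h1, ← smul_sub, smul_eq_zero] at h0
  rcases h0 with h0 | h0
  · exact absurd h0 (ENNReal.toReal_ne_zero.2 ⟨h3, h2.ne⟩)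
  · exact sub_eq_zero.1 h0

end IsGaussGreenPair

/-- `y` is a point of the support of `μ` at which the averages of `σ` over balls tend to the unit
vector `ν`. -/
structure IsNormalAt (μ : Measure Plane) (σ : Plane → Plane) (y ν : Plane) : Prop where
  pos : ∀ r : ℝ, 0 < r → 0 < μ (Metric.ball y r)
  norm_eq : ‖ν‖ = 1
  tendsto : Tendsto (fun r : ℝ => ⨍ x in Metric.ball y r, σ x ∂μ) (𝓝[>] 0) (𝓝 ν)

theorem HasOuterNormal.isNormalAt {Ω : Set Plane} {μ : Measure Plane} {σ : Plane → Plane}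
    {y ν : Plane} (hn : HasOuterNormal Ω y ν) (h : IsGaussGreenPair Ω μ σ) :
    IsNormalAt μ σ y ν := by
  obtain ⟨μ', σ', h', h1, h2, h3⟩ := hn
  obtain ⟨rfl, hσ⟩ := h'.unique h
  refine ⟨h1, h2, h3.congr fun r => ?_⟩
  exact average_congr (ae_restrict_of_ae hσ)

theorem IsNormalAt.hasOuterNormal {Ω : Set Plane} {μ : Measure Plane} {σ : Plane → Plane}
    {y ν : Plane} (hn : IsNormalAt μ σ y ν) (h : IsGaussGreenPair Ω μ σ) :
    HasOuterNormal Ω y ν :=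
  ⟨μ, σ, h, hn.pos, hn.norm_eq, hn.tendsto⟩

theorem IsNormalAt.outerNormal_eq {Ω : Set Plane} {μ : Measure Plane} {σ : Plane → Plane}
    {y ν : Plane} (hn : IsNormalAt μ σ y ν) (h : IsGaussGreenPair Ω μ σ) :
    outerNormal Ω y = ν := by
  have hex : ∃ ν, HasOuterNormal Ω y ν := ⟨ν, hn.hasOuterNormal h⟩
  rw [outerNormal, dif_pos hex]
  exact tendsto_nhds_unique (hex.choose_spec.isNormalAt h).tendsto hn.tendsto

theorem ae_pos_ball (μ : Measure Plane) : ∀ᵐ y ∂μ, ∀ r : ℝ, 0 < r → 0 < μ (Metric.ball y r) := by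
  have := μ.support_mem_ae
  filter_upwards [this] with y hy r hr
  exact (Measure.mem_support_iff_forall y).1 hy _ (Metric.ball_mem_nhds y hr)

theorem tendsto_setIntegral_closedBall_left {F : Type*} [NormedAddCommGroup F] [NormedSpace ℝ F]
    {μ : Measure Plane} {f : Plane → F} (hf : Integrable f μ) (y : Plane) (r : ℝ) :
    Tendsto (fun s : ℝ => ∫ x in Metric.closedBall y s, f x ∂μ) (𝓝[<] r)
      (𝓝 (∫ x in Metric.ball y r, f x ∂μ)) := by
  simp_rw [← integral_indicator Metric.isClosed_closedBall.measurableSet,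
    ← integral_indicator Metric.isOpen_ball.measurableSet]
  refine tendsto_integral_filter_of_dominated_convergence (fun x => ‖f x‖)
    (Eventually.of_forall fun s => hf.1.indicator Metric.isClosed_closedBall.measurableSet)
    (Eventually.of_forall fun s => ae_of_all _ fun x => norm_indicator_le_norm_self _ _) hf.norm
    (ae_of_all _ fun x => tendsto_const_nhds.congr' ?_)
  by_cases hx : dist x y < r
  · filter_upwards [Ioo_mem_nhdsLT hx] with s hs
    rw [Set.indicator_of_mem (Metric.mem_ball.2 hx),
      Set.indicator_of_mem (Metric.mem_closedBall.2 hs.1.le)]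
  · filter_upwards [self_mem_nhdsWithin] with s hs
    rw [Set.indicator_of_notMem (fun h => hx (Metric.mem_ball.1 h)),
      Set.indicator_of_notMem fun h => hx ((Metric.mem_closedBall.1 h).trans_lt hs)]

theorem IsGaussGreenPair.ae_isNormalAt {Ω : Set Plane} {μ : Measure Plane} {σ : Plane → Plane}
    (h : IsGaussGreenPair Ω μ σ) : ∀ᵐ y ∂μ, IsNormalAt μ σ y (σ y) := by
  have hfin := h.finite
  filter_upwards [h.unit, ae_pos_ball μ,
    (Besicovitch.vitaliFamily μ).ae_tendsto_average h.integrable.locallyIntegrable] with y h1 h2 h3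
  refine ⟨h2, h1, ?_⟩
  have h4 := h3.comp (Besicovitch.tendsto_filterAt μ y)
  rw [Metric.tendsto_nhdsWithin_nhds] at h4 ⊢
  intro ε hε
  obtain ⟨d, hd, hd'⟩ := h4 (ε / 2) (half_pos hε)
  refine ⟨d, hd, fun r hr hrd => ?_⟩
  have hr0 : 0 < r := hr
  have hlim : Tendsto (fun s : ℝ => ⨍ x in Metric.closedBall y s, σ x ∂μ) (𝓝[<] r)
      (𝓝 (⨍ x in Metric.ball y r, σ x ∂μ)) := by
    simp only [setAverage_eq]
    have hone := tendsto_setIntegral_closedBall_left (μ := μ) (integrable_const (1 : ℝ)) y r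
    simp only [setIntegral_const, smul_eq_mul, mul_one] at hone
    refine (hone.inv₀ ?_).smul (tendsto_setIntegral_closedBall_left h.integrable y r)
    exact (ENNReal.toReal_pos (h2 r hr0).ne' (measure_ne_top _ _)).ne'
  have hmem : ∀ᶠ s in 𝓝[<] r, dist (⨍ x in Metric.closedBall y s, σ x ∂μ) (σ y) ≤ ε / 2 := by
    filter_upwards [Ioo_mem_nhdsLT hr0] with s hs
    refine (hd' hs.1 ?_).le
    rw [Real.dist_eq, sub_zero, abs_of_pos hs.1]
    rw [Real.dist_eq, sub_zero, abs_of_pos hr0] at hrd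
    exact hs.2.trans hrd
  have := le_of_tendsto (hlim.dist tendsto_const_nhds) hmem
  linarith

end DipolarDrop
end

noncomputable section

namespace DipolarDrop

/-! ### Estimates at points of the reduced boundary -/

variable {Ω : Set Plane} {μ : Measure Plane} {σ : Plane → Plane} {y ν : Plane}

/-- The excess of the Gauss–Green measure at a point of the reduced boundary is small. -/
theorem IsNormalAt.eventually_excess_le (hn : IsNormalAt μ σ y ν) (h : IsGaussGreenPair Ω μ σ)
    {ε : ℝ} (hε : 0 < ε) :
    ∀ᶠ r in 𝓝[>] (0 : ℝ),
      ∫ x in Metric.ball y r, ‖σ x - ν‖ ∂μ ≤ ε * μ.real (Metric.ball y r) := by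
  have hfin := h.finite
  have h1 := hn.tendsto.eventually (Metric.closedBall_mem_nhds ν (by positivity : 0 < ε ^ 2 / 2))
  filter_upwards [h1, self_mem_nhdsWithin] with r hr hr0
  set B := Metric.ball y r with hB
  have hpos : 0 < μ.real B := ENNReal.toReal_pos (hn.pos r hr0).ne' (measure_ne_top _ _)
  set v := ⨍ x in B, σ x ∂μ with hv
  have hv1 : 1 - ε ^ 2 / 2 ≤ inner ℝ ν v := by
    have h2 : ‖ν - v‖ ≤ ε ^ 2 / 2 := by
      rw [← dist_eq_norm, dist_comm]
      exact hr
    have h3 : inner ℝ ν (ν - v) ≤ ‖ν‖ * ‖ν - v‖ := real_inner_le_norm _ _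
    rw [inner_sub_right, real_inner_self_eq_norm_sq, hn.norm_eq] at h3
    linarith
  have hintg : ∫ x in B, inner ℝ ν (σ x) ∂μ = μ.real B * inner ℝ ν v := by
    rw [integral_inner h.integrable.restrict, hv, setAverage_eq, real_inner_smul_right]
    field_simp
  have hi2 : Integrable (fun x => ε / 2 + ε⁻¹ * (1 - inner ℝ ν (σ x))) (μ.restrict B) :=
    (integrable_const _).add (((integrable_const _).sub (h.integrable_inner ν).restrict).const_mul _)
  have hi3 : Integrable (fun x => inner ℝ ν (σ x)) (μ.restrict B) := (h.integrable_inner ν).restrict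
  calc ∫ x in B, ‖σ x - ν‖ ∂μ ≤ ∫ x in B, (ε / 2 + ε⁻¹ * (1 - inner ℝ ν (σ x))) ∂μ := by
        refine integral_mono_ae ((h.integrable.sub (integrable_const ν)).norm.restrict) hi2 ?_
        filter_upwards [ae_restrict_of_ae h.unit] with x hx
        have e1 : ‖σ x - ν‖ ^ 2 = 2 * (1 - inner ℝ ν (σ x)) := by
          rw [norm_sub_sq_real, hx, hn.norm_eq, real_inner_comm]
          ring
        have e2 : 1 - inner ℝ ν (σ x) = ‖σ x - ν‖ ^ 2 / 2 := by linarith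
        simp only [e2]
        have : 0 ≤ (ε - ‖σ x - ν‖) ^ 2 / (2 * ε) := by positivity
        have e3 : (ε - ‖σ x - ν‖) ^ 2 / (2 * ε) =
            ε / 2 + ε⁻¹ * (‖σ x - ν‖ ^ 2 / 2) - ‖σ x - ν‖ := by
          field_simp
          ring
        linarith
    _ = ε / 2 * μ.real B + ε⁻¹ * (μ.real B - ∫ x in B, inner ℝ ν (σ x) ∂μ) := by
        have hi4 : Integrable (fun x => ε⁻¹ * (1 - inner ℝ ν (σ x))) (μ.restrict B) :=
          ((integrable_const _).sub hi3).const_mul _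
        rw [integral_add (integrable_const _) hi4,
          integral_const_mul, integral_sub (integrable_const _) hi3]
        simp only [integral_const, measureReal_restrict_apply_univ, smul_eq_mul, mul_one]
        ring
    _ ≤ ε / 2 * μ.real B + ε⁻¹ * (μ.real B * (ε ^ 2 / 2)) := by
        rw [hintg]
        gcongr
        nlinarith
    _ = ε * μ.real B := by field_simp; ring

theorem integrable_indicator_ball [IsFiniteMeasure μ] {ψ : Plane → ℝ} (hψ : Integrable ψ μ)
    (y : Plane) (a b : ℝ) :
    Integrable (Function.uncurry fun x s => (Metric.ball y s).indicator ψ x)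
      (μ.prod (volume.restrict (Set.Ioc a b))) := by
  have hm : MeasurableSet {p : Plane × ℝ | dist p.1 y < p.2} :=
    measurableSet_lt (by fun_prop) (by fun_prop)
  have : Function.uncurry (fun x s => (Metric.ball y s).indicator ψ x) =
      {p : Plane × ℝ | dist p.1 y < p.2}.indicator fun p => ψ p.1 := by
    ext ⟨x, s⟩
    by_cases hx : dist x y < s <;> simp [Set.indicator, hx]
  rw [this]
  exact (hψ.comp_fst _).indicator hm

theorem integrableOn_setIntegral_ball [IsFiniteMeasure μ] {ψ : Plane → ℝ} (hψ : Integrable ψ μ)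
    (y : Plane) (a b : ℝ) :
    IntegrableOn (fun s : ℝ => ∫ x in Metric.ball y s, ψ x ∂μ) (Set.Ioc a b) := by
  have := (integrable_indicator_ball hψ y a b).integral_prod_right
  simp only [Function.uncurry_apply_pair, integral_indicator Metric.isOpen_ball.measurableSet]
    at this
  exact this

/-- A layer-cake formula for the distance to a point. -/
theorem integral_distCutoff_mul [IsFiniteMeasure μ] {ψ : Plane → ℝ} (hψ : Integrable ψ μ)
    (y : Plane) {a b : ℝ} (hab : a ≤ b) :
    ∫ x, max 0 (min (b - a) (b - dist x y)) * ψ x ∂μ =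
      ∫ s in a..b, ∫ x in Metric.ball y s, ψ x ∂μ := by
  have hlen : ∀ x, ∫ s in Set.Ioc a b, (Set.Ioi (dist x y)).indicator (fun _ => (1 : ℝ)) s =
      max 0 (min (b - a) (b - dist x y)) := fun x => by
    rw [setIntegral_indicator measurableSet_Ioi, Set.Ioc_inter_Ioi, setIntegral_const]
    simp only [Real.volume_real_Ioc, smul_eq_mul, mul_one]
    rw [max_comm]
    congr 1
    rcases le_total a (dist x y) with h | h
    · rw [max_eq_right h, min_eq_right (by linarith)]
    · rw [max_eq_left h, min_eq_left (by linarith)]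
  rw [intervalIntegral.integral_of_le hab]
  simp_rw [← hlen, ← integral_mul_const, ← integral_indicator Metric.isOpen_ball.measurableSet]
  have e : ∀ x s, (Set.Ioi (dist x y)).indicator (fun _ => (1 : ℝ)) s * ψ x =
      (Metric.ball y s).indicator ψ x := fun x s => by
    by_cases hx : dist x y < s <;> simp [Set.indicator, hx]
  simp_rw [e]
  exact integral_integral_swap (integrable_indicator_ball hψ y a b)

theorem volume_real_inter_ball_diff (hΩ : MeasurableSet Ω) (y : Plane) {a b : ℝ} (hab : a ≤ b) :
    volume.real (Ω ∩ (Metric.closedBall y b \ Metric.ball y a)) =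
      volume.real (Ω ∩ Metric.ball y b) - volume.real (Ω ∩ Metric.ball y a) := by
  have h1 : volume.real (Ω ∩ (Metric.closedBall y b \ Metric.ball y a)) =
      volume.real ((Ω ∩ Metric.ball y b) \ (Ω ∩ Metric.ball y a)) := by
    refine measureReal_congr ?_
    have hs : volume (Metric.sphere y b) = 0 := Measure.addHaar_sphere _ _ _
    filter_upwards [measure_eq_zero_iff_ae_notMem.1 hs] with x hx
    have hne : dist x y ≠ b := hx
    refine propext ⟨?_, ?_⟩
    · rintro ⟨hx1, hx2, hx3⟩
      exact ⟨⟨hx1, lt_of_le_of_ne hx2 hne⟩, fun h => hx3 h.2⟩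
    · rintro ⟨⟨hx1, hx2⟩, hx3⟩
      exact ⟨hx1, Metric.ball_subset_closedBall hx2, fun h => hx3 ⟨hx1, h⟩⟩
  rw [h1, measureReal_sdiff]
  · exact Set.inter_subset_inter_right _ (Metric.ball_subset_ball hab)
  · exact hΩ.inter Metric.isOpen_ball.measurableSet

/-- The Gauss–Green measure of a ball is controlled by the growth of the area of `Ω` in
concentric balls. -/
theorem IsGaussGreenPair.measure_ball_le_growth (h : IsGaussGreenPair Ω μ σ)
    (hΩ : MeasurableSet Ω) (hν : ‖ν‖ = 1) {a b ε : ℝ} (hab : a ≤ b) (hε : ε ≤ 1)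
    (hex : ∀ s ∈ Set.Icc a b,
      ∫ x in Metric.ball y s, ‖σ x - ν‖ ∂μ ≤ ε * μ.real (Metric.ball y s)) :
    (b - a) * ((1 - ε) * μ.real (Metric.ball y a)) ≤
      volume.real (Ω ∩ Metric.ball y b) - volume.real (Ω ∩ Metric.ball y a) := by
  have hfin := h.finite
  set η : Plane → ℝ := fun x => max 0 (min (b - a) (b - dist x y)) with hη
  have hlip : LipschitzWith 1 η := by
    have h1 : LipschitzWith 1 fun x : Plane => b - dist x y :=
      LipschitzWith.of_dist_le_mul fun x x' => by
        rw [NNReal.coe_one, one_mul, Real.dist_eq]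
        have := abs_dist_sub_le x x' y
        rw [abs_le] at this ⊢
        constructor <;> linarith [this.1, this.2]
    have h2 := (h1.const_min (b - a)).const_max 0
    simpa using h2
  have hcs : HasCompactSupport η := by
    refine HasCompactSupport.intro (isCompact_closedBall y b) fun x hx => ?_
    have : b < dist x y := by simpa using hx
    simp only [hη]
    exact max_eq_left ((min_le_right _ _).trans (by linarith))
  have hGG := h.setIntegral_lineDeriv hlip hcs ν hΩ
  have hzero : ∀ x, x ∉ Metric.closedBall y b \ Metric.ball y a → lineDeriv ℝ η x ν = 0 := by
    intro x hx
    have hloc : ∃ c : ℝ, η =ᶠ[𝓝 x] fun _ => c := by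
      by_cases hxb : b < dist x y
      · refine ⟨0, ?_⟩
        filter_upwards [(isOpen_lt continuous_const (by fun_prop :
          Continuous fun x' : Plane => dist x' y)).mem_nhds hxb] with x' hx'
        exact max_eq_left ((min_le_right _ _).trans (by linarith [show b < dist x' y from hx']))
      · have hxa : dist x y < a := by
          by_contra hxa
          exact hx ⟨not_lt.1 hxb, hxa⟩
        refine ⟨b - a, ?_⟩
        filter_upwards [Metric.isOpen_ball.mem_nhds (show x ∈ Metric.ball y a from hxa)] with x' hx'
        have : dist x' y < a := hx'
        simp only [hη]
        rw [min_eq_left (by linarith), max_eq_right (by linarith)]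
    obtain ⟨c, hc⟩ := hloc
    have h1 : HasFDerivAt η (0 : Plane →L[ℝ] ℝ) x :=
      (hasFDerivAt_const c x).congr_of_eventuallyEq hc
    simpa using (h1.hasLineDerivAt ν).lineDeriv
  have hUm : MeasurableSet (Metric.closedBall y b \ Metric.ball y a) :=
    Metric.isClosed_closedBall.measurableSet.diff Metric.isOpen_ball.measurableSet
  have hup : ∫ x in Ω, lineDeriv ℝ η x ν ≤
      volume.real (Ω ∩ (Metric.closedBall y b \ Metric.ball y a)) := by
    rw [setIntegral_eq_of_subset_of_forall_sdiff_eq_zero hΩ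
      (s := Ω ∩ (Metric.closedBall y b \ Metric.ball y a)) Set.inter_subset_left
      fun x hx => hzero x fun hx' => hx.2 ⟨hx.1, hx'⟩]
    have := norm_setIntegral_le_of_norm_le_const (μ := volume) (f := fun x => lineDeriv ℝ η x ν)
      (s := Ω ∩ (Metric.closedBall y b \ Metric.ball y a)) (C := 1)
      (measure_lt_top_of_subset (Set.inter_subset_right.trans Set.sdiff_subset)
        Metric.isBounded_closedBall.measure_lt_top.ne)
      fun x _ => by simpa [hν] using norm_lineDeriv_le_of_lipschitz ℝ hlip (x₀ := x) (v := ν)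
    rw [one_mul] at this
    exact (le_abs_self _).trans this
  rw [volume_real_inter_ball_diff hΩ y hab, hGG, integral_distCutoff_mul (h.integrable_inner ν) y
    hab] at hup
  refine le_trans ?_ hup
  have hconst : ∫ _ in a..b, (1 - ε) * μ.real (Metric.ball y a) =
      (b - a) * ((1 - ε) * μ.real (Metric.ball y a)) := by
    rw [intervalIntegral.integral_const, smul_eq_mul]
  rw [← hconst, intervalIntegral.integral_of_le hab, intervalIntegral.integral_of_le hab]
  refine setIntegral_mono_on (integrableOn_const (by simp))
    (integrableOn_setIntegral_ball (h.integrable_inner ν) y a b) measurableSet_Ioc fun s hs => ?_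
  have h1 := hex s ⟨hs.1.le, hs.2⟩
  have h2 : μ.real (Metric.ball y s) - ∫ x in Metric.ball y s, ‖σ x - ν‖ ∂μ ≤
      ∫ x in Metric.ball y s, inner ℝ ν (σ x) ∂μ := by
    have hi : Integrable (fun x => ‖σ x - ν‖) (μ.restrict (Metric.ball y s)) :=
      (h.integrable.sub (integrable_const ν)).norm.restrict
    have e : μ.real (Metric.ball y s) = ∫ x in Metric.ball y s, (1 : ℝ) ∂μ := by simp
    rw [e, ← integral_sub (integrable_const _) hi]
    refine integral_mono ((integrable_const _).sub hi) (h.integrable_inner ν).restrict fun x => ?_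
    have h3 : inner ℝ ν (ν - σ x) ≤ ‖ν‖ * ‖ν - σ x‖ := real_inner_le_norm _ _
    rw [inner_sub_right, real_inner_self_eq_norm_sq, hν, norm_sub_rev] at h3
    simp only
    linarith
  have h3 : μ.real (Metric.ball y a) ≤ μ.real (Metric.ball y s) :=
    measureReal_mono (Metric.ball_subset_ball hs.1.le)
  nlinarith

end DipolarDrop
end

noncomputable section

namespace DipolarDrop

variable {Ω : Set Plane} {μ : Measure Plane} {σ : Plane → Plane} {y ν : Plane}

/-- A local bound for the part of a ball which a translation moves into `Ω`. -/
theorem IsGaussGreenPair.measure_ball_translate_le (h : IsGaussGreenPair Ω μ σ)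
    (hΩ : MeasurableSet Ω) (y z : Plane) (ρ : ℝ) {ψ : Plane → ℝ} (hψ : Integrable ψ μ)
    (hψ0 : ∀ x, 0 ≤ ψ x) (hψz : ∀ᵐ x ∂μ, - inner ℝ z (σ x) ≤ ψ x) :
    volume.real ((Metric.ball y ρ \ Ω) ∩ {x | x + z ∈ Ω}) ≤
      ∫ x in Metric.ball y (ρ + ‖z‖), ψ x ∂μ := by
  have hfin := h.finite
  set B := Metric.ball y ρ with hB
  have hBm : MeasurableSet B := Metric.isOpen_ball.measurableSet
  have hTm : MeasurableSet {x : Plane | x + z ∈ Ω} := hΩ.preimage (by fun_prop)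
  set w : Plane → ℝ := B.indicator fun x => charFn Ω (x + z) - charFn Ω x with hw
  have hwi : Integrable w := by
    refine (integrable_indicator_iff hBm).2 ?_
    refine Measure.integrableOn_of_bounded (M := 1) Metric.isBounded_ball.measure_lt_top.ne
      (((measurable_charFn hΩ).comp (by fun_prop)).sub
        (measurable_charFn hΩ)).aestronglyMeasurable (ae_of_all _ fun x => ?_)
    rw [Real.norm_eq_abs, abs_le]
    constructor <;> linarith [charFn_nonneg Ω x, charFn_le_one Ω x, charFn_nonneg Ω (x + z),
      charFn_le_one Ω (x + z)]
  have hleft : volume.real ((B \ Ω) ∩ {x | x + z ∈ Ω}) = ∫ x in B, max (w x) 0 := by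
    rw [← integral_indicator hBm, ← integral_indicator_one ((hBm.diff hΩ).inter hTm)]
    refine integral_congr_ae (ae_of_all _ fun x => ?_)
    by_cases h1 : x ∈ B <;> by_cases h2 : x ∈ Ω <;> by_cases h3 : x + z ∈ Ω <;>
      simp [hw, Set.indicator, h1, h2, h3, charFn]
  rw [hleft]
  refine le_of_forall_pos_le_add fun ε hε => ?_
  obtain ⟨f, hf, hfs, hfU, hf0, hf1, hfw⟩ :=
    exists_continuous_integral_mul_ge hwi (Metric.isOpen_ball (x := y) (ε := ρ)) hε
  have hfz : ∀ x, x ∉ B → f x = 0 := fun x hx =>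
    image_eq_zero_of_notMem_tsupport fun h' => hx (hfU h')
  have e1 : ∫ x, f x * w x = ∫ x, f x * (charFn Ω (x + z) - charFn Ω x) := by
    refine integral_congr_ae (ae_of_all _ fun x => ?_)
    by_cases hx : x ∈ B
    · simp [hw, hx]
    · simp [hfz x hx]
  rw [e1, integral_mul_charFn_translate_sub hΩ hf hfs, h.setIntegral_sub_translate hf hfs,
    ← intervalIntegral.integral_neg] at hfw
  have hcont : Continuous fun t : ℝ => - ∫ x, f (x - t • z) * inner ℝ z (σ x) ∂μ :=
    ((h.continuous_integral_translate hf hfs z).comp (by fun_prop :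
      Continuous fun t : ℝ => t • z)).neg
  have hle : ∫ t in (0 : ℝ)..1, - ∫ x, f (x - t • z) * inner ℝ z (σ x) ∂μ ≤
      ∫ _ in (0 : ℝ)..1, ∫ x in Metric.ball y (ρ + ‖z‖), ψ x ∂μ := by
    refine intervalIntegral.integral_mono_on zero_le_one (hcont.intervalIntegrable _ _)
      intervalIntegrable_const fun t ht => ?_
    rw [← integral_neg, ← integral_indicator Metric.isOpen_ball.measurableSet]
    refine integral_mono_ae (h.integrable_mul_inner z (f := fun x => f (x - t • z))
      (hf.measurable.comp (by fun_prop)) (c := 1) fun x => ?_).neg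
      (hψ.indicator Metric.isOpen_ball.measurableSet) ?_
    · rw [abs_of_nonneg (hf0 _)]
      exact hf1 _
    filter_upwards [hψz] with x hx
    by_cases hxB : x ∈ Metric.ball y (ρ + ‖z‖)
    · rw [Set.indicator_of_mem hxB]
      calc -(f (x - t • z) * inner ℝ z (σ x)) = f (x - t • z) * (-inner ℝ z (σ x)) := by ring
        _ ≤ f (x - t • z) * ψ x := mul_le_mul_of_nonneg_left hx (hf0 _)
        _ ≤ ψ x := mul_le_of_le_one_left (hψ0 x) (hf1 _)
    · rw [Set.indicator_of_notMem hxB, hfz]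
      · simp
      · intro h'
        refine hxB ?_
        rw [Metric.mem_ball, dist_eq_norm] at h' ⊢
        calc ‖x - y‖ = ‖(x - t • z - y) + t • z‖ := by congr 1; abel
          _ ≤ ‖x - t • z - y‖ + ‖t • z‖ := norm_add_le _ _
          _ < ρ + ‖z‖ := by
            refine add_lt_add_of_lt_of_le h' ?_
            rw [norm_smul, Real.norm_of_nonneg ht.1]
            exact mul_le_of_le_one_left (norm_nonneg _) ht.2
  rw [intervalIntegral.integral_const, sub_zero, one_smul] at hle
  linarith

/-- Double counting of pairs of points of `A` and `S` whose sum lies in `T`. -/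
theorem volume_mul_le_of_translate {A S T : Set Plane} (hA : MeasurableSet A)
    (hS : MeasurableSet S) (hT : MeasurableSet T) (hAf : volume A ≠ ∞) (hSf : volume S ≠ ∞)
    {c d : ℝ} (hc : ∀ z ∈ S, volume.real (A ∩ {x | x + z ∈ T}) ≤ c)
    (hd : ∀ x ∈ A, d ≤ volume.real (S ∩ {z | x + z ∈ T})) :
    volume.real A * d ≤ volume.real S * c := by
  have hAf' : IsFiniteMeasure (volume.restrict A) := ⟨by simpa using hAf.lt_top⟩
  have hSf' : IsFiniteMeasure (volume.restrict S) := ⟨by simpa using hSf.lt_top⟩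
  have hTm : MeasurableSet {p : Plane × Plane | p.1 + p.2 ∈ T} := hT.preimage (by fun_prop)
  set F : Plane → Plane → ℝ := fun x z => T.indicator (fun _ => 1) (x + z) with hF
  have hi : Integrable (Function.uncurry F) ((volume.restrict A).prod (volume.restrict S)) := by
    have : Function.uncurry F = {p : Plane × Plane | p.1 + p.2 ∈ T}.indicator fun _ => (1 : ℝ) := by
      ext ⟨x, z⟩
      by_cases hx : x + z ∈ T <;> simp [hF, Set.indicator, hx]
    rw [this]
    exact (integrable_const _).indicator hTm
  have hswap := integral_integral_swap hi
  have e1 : ∀ x, ∫ z in S, F x z = volume.real (S ∩ {z | x + z ∈ T}) := fun x => by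
    have hm : MeasurableSet {z : Plane | x + z ∈ T} := hT.preimage (by fun_prop)
    have : F x = {z : Plane | x + z ∈ T}.indicator fun _ => (1 : ℝ) := by
      ext z
      by_cases hx : x + z ∈ T <;> simp [hF, Set.indicator, hx]
    rw [this, setIntegral_indicator hm]
    simp
  have e2 : ∀ z, ∫ x in A, F x z = volume.real (A ∩ {x | x + z ∈ T}) := fun z => by
    have hm : MeasurableSet {x : Plane | x + z ∈ T} := hT.preimage (by fun_prop)
    have : (fun x => F x z) = {x : Plane | x + z ∈ T}.indicator fun _ => (1 : ℝ) := by
      ext x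
      by_cases hx : x + z ∈ T <;> simp [hF, Set.indicator, hx]
    rw [this, setIntegral_indicator hm]
    simp
  have h1 : volume.real A * d ≤ ∫ x in A, ∫ z in S, F x z := by
    rw [← smul_eq_mul, ← setIntegral_const]
    refine setIntegral_mono_on (integrable_const _) hi.integral_prod_left hA fun x hx => ?_
    rw [e1]
    exact hd x hx
  have h2 : ∫ z in S, ∫ x in A, F x z ≤ volume.real S * c := by
    rw [← smul_eq_mul, ← setIntegral_const]
    refine setIntegral_mono_on hi.integral_prod_right (integrable_const _) hS fun z hz => ?_
    rw [e2]
    exact hc z hz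
  linarith

theorem volume_real_ball (y : Plane) {r : ℝ} (hr : 0 ≤ r) :
    volume.real (Metric.ball y r) = Real.pi * r ^ 2 := by
  rw [measureReal_def, EuclideanSpace.volume_ball_fin_two, ENNReal.toReal_mul, ENNReal.toReal_pow,
    ENNReal.toReal_ofReal hr]
  simp [mul_comm, Real.pi_pos.le]

theorem volume_real_preimage_add (x : Plane) (M : Set Plane) :
    volume.real {z | x + z ∈ M} = volume.real M := by
  rw [measureReal_def, measureReal_def]
  congr 1
  exact measure_preimage_add volume x M

theorem volume_ball_ne_top (y : Plane) (r : ℝ) : volume (Metric.ball y r) ≠ ∞ :=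
  Metric.isBounded_ball.measure_lt_top.ne

theorem volume_real_inter_ball_mono (Ω : Set Plane) (y : Plane) {a b : ℝ} (hab : a ≤ b) :
    volume.real (Ω ∩ Metric.ball y a) ≤ volume.real (Ω ∩ Metric.ball y b) :=
  measureReal_mono (Set.inter_subset_inter_right _ (Metric.ball_subset_ball hab))
    (measure_ne_top_of_subset Set.inter_subset_right (volume_ball_ne_top y b))

/-- A local isoperimetric inequality. -/
theorem IsGaussGreenPair.volume_inter_ball_le (h : IsGaussGreenPair Ω μ σ) (hΩ : MeasurableSet Ω)
    (y : Plane) {a ρ : ℝ} (hρ : 0 < ρ)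
    (hsmall : volume.real (Ω ∩ Metric.ball y (a + ρ)) ≤ Real.pi * ρ ^ 2 / 2) :
    volume.real (Ω ∩ Metric.ball y a) ≤ 2 * ρ * μ.real (Metric.ball y (a + ρ)) := by
  have hfin := h.finite
  have hpi := Real.pi_pos
  have key := volume_mul_le_of_translate (A := Ω ∩ Metric.ball y a) (S := Metric.ball 0 ρ) (T := Ωᶜ)
    (c := ρ * μ.real (Metric.ball y (a + ρ))) (d := Real.pi * ρ ^ 2 / 2)
    (hΩ.inter Metric.isOpen_ball.measurableSet) Metric.isOpen_ball.measurableSet hΩ.compl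
    (measure_ne_top_of_subset Set.inter_subset_right (volume_ball_ne_top y a))
    (volume_ball_ne_top 0 ρ) ?_ ?_
  · rw [volume_real_ball 0 hρ.le] at key
    have : Real.pi * ρ ^ 2 * (volume.real (Ω ∩ Metric.ball y a)) ≤
        Real.pi * ρ ^ 2 * (2 * ρ * μ.real (Metric.ball y (a + ρ))) := by linarith
    exact le_of_mul_le_mul_left this (by positivity)
  · intro z hz
    have hz' : ‖z‖ < ρ := by simpa using hz
    have h1 := (h.compl hΩ.nullMeasurableSet).measure_ball_translate_le hΩ.compl y z a
      (ψ := fun _ => ‖z‖) (integrable_const _) (fun _ => norm_nonneg _) (by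
        filter_upwards [h.norm_inner_le z] with x hx
        rw [inner_neg_right, neg_neg]
        exact (le_abs_self _).trans hx)
    rw [setIntegral_const, smul_eq_mul] at h1
    have e : (Ω ∩ Metric.ball y a) ∩ {x | x + z ∈ Ωᶜ} =
        (Metric.ball y a \ Ωᶜ) ∩ {x | x + z ∈ Ωᶜ} := by
      ext x; simp only [Set.mem_inter_iff, Set.mem_sdiff, Set.mem_compl_iff]; tauto
    rw [e]
    refine h1.trans ?_
    rw [mul_comm]
    refine mul_le_mul hz'.le (measureReal_mono (Metric.ball_subset_ball (by linarith)))
      measureReal_nonneg hρ.le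
  · intro x hx
    have hx2 : dist x y < a := hx.2
    have e : volume.real (Metric.ball 0 ρ ∩ {z | x + z ∈ Ωᶜ}) =
        volume.real (Metric.ball x ρ ∩ Ωᶜ) := by
      rw [← volume_real_preimage_add x (Metric.ball x ρ ∩ Ωᶜ)]
      congr 1
      ext z
      simp
    rw [e]
    have h1 : volume.real (Metric.ball x ρ) ≤
        volume.real (Metric.ball x ρ ∩ Ωᶜ) + volume.real (Ω ∩ Metric.ball y (a + ρ)) := by
      refine (measureReal_mono (s₂ := (Metric.ball x ρ ∩ Ωᶜ) ∪ (Ω ∩ Metric.ball y (a + ρ))) ?_ ?_).trans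
        (measureReal_union_le _ _)
      · intro w hw
        by_cases hwΩ : w ∈ Ω
        · refine Or.inr ⟨hwΩ, ?_⟩
          have : dist w x < ρ := hw
          rw [Metric.mem_ball]
          linarith [dist_triangle w x y]
        · exact Or.inl ⟨hw, hwΩ⟩
      · refine measure_ne_top_of_subset (s := Metric.ball x ρ ∪ Metric.ball y (a + ρ)) ?_ ?_
        · exact Set.union_subset_union Set.inter_subset_left Set.inter_subset_right
        · exact (Metric.isBounded_ball.union Metric.isBounded_ball).measure_lt_top.ne
    rw [volume_real_ball x hρ.le] at h1
    linarith

/-- The area density of `Ω` is bounded below at small scales. -/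
theorem IsGaussGreenPair.volume_inter_ball_ge (h : IsGaussGreenPair Ω μ σ) (hΩ : MeasurableSet Ω)
    (hν : ‖ν‖ = 1) (hpos : ∀ r : ℝ, 0 < r → 0 < μ (Metric.ball y r)) {r : ℝ} (hr : 0 < r)
    (hex : ∀ s ∈ Set.Ioc 0 r,
      ∫ x in Metric.ball y s, ‖σ x - ν‖ ∂μ ≤ 1 / 2 * μ.real (Metric.ball y s)) :
    r ^ 2 / 1600 ≤ volume.real (Ω ∩ Metric.ball y r) := by
  have hfin := h.finite
  by_contra! hlt
  set v : ℝ → ℝ := fun s => volume.real (Ω ∩ Metric.ball y s) with hv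
  have hmono : Monotone v := fun a b hab => volume_real_inter_ball_mono Ω y hab
  have hv0 : ∀ s, 0 ≤ v s := fun s => measureReal_nonneg
  have hgrow : ∀ a b, 0 < a → a ≤ b → b ≤ r →
      (b - a) * (1 / 2 * μ.real (Metric.ball y a)) ≤ v b - v a := fun a b ha hab hb => by
    have := h.measure_ball_le_growth (y := y) hΩ hν (ε := 1 / 2) hab (by norm_num)
      fun s hs => hex s ⟨ha.trans_le hs.1, hs.2.trans hb⟩
    norm_num at this ⊢
    exact this
  have hvhalf : 0 < v (r / 2) := by
    have h1 := hgrow (r / 4) (r / 2) (by positivity) (by linarith) (by linarith)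
    have h2 : 0 < μ.real (Metric.ball y (r / 4)) :=
      ENNReal.toReal_pos (hpos _ (by positivity)).ne' (measure_ne_top _ _)
    have h3 : 0 < (r / 2 - r / 4) * (1 / 2 * μ.real (Metric.ball y (r / 4))) := by
      have : 0 < r / 2 - r / 4 := by linarith
      positivity
    linarith [hv0 (r / 4)]
  have hV : 0 < v r := hvhalf.trans_le (hmono (by linarith))
  set q : ℝ := √(v r) with hq
  have hq0 : 0 < q := Real.sqrt_pos.2 hV
  have hqq : q ^ 2 = v r := Real.sq_sqrt hV.le
  have hqr : 40 * q < r := by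
    have : (40 * q) ^ 2 < r ^ 2 := by
      rw [mul_pow, hqq]
      linarith
    exact lt_of_pow_lt_pow_left₀ 2 hr.le this
  set b : ℕ → ℝ := fun k => r - 20 * q * (1 - (9 / 10 : ℝ) ^ k) with hb
  have hbr : ∀ k, b k ≤ r ∧ r / 2 < b k := fun k => by
    have h1 : (9 / 10 : ℝ) ^ k ≤ 1 := pow_le_one₀ (by norm_num) (by norm_num)
    have h2 : 0 < (9 / 10 : ℝ) ^ k := by positivity
    simp only [hb]
    constructor <;> nlinarith
  have hstep : ∀ k, v (b k) ≤ (q * (9 / 10 : ℝ) ^ k) ^ 2 := by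
    intro k
    induction k with
    | zero => simp [hb, hqq]
    | succ k ih =>
      set ρ : ℝ := q * (9 / 10 : ℝ) ^ k with hρ
      have hρ0 : 0 < ρ := by positivity
      have hbs : b (k + 1) + ρ + ρ = b k := by
        simp only [hb, hρ, pow_succ]
        ring
      have hbp : 0 < b (k + 1) := (half_pos hr).trans (hbr (k + 1)).2
      have h1 := h.volume_inter_ball_le hΩ y (a := b (k + 1)) hρ0 (by
        refine (hmono (by linarith : b (k + 1) + ρ ≤ b k)).trans (ih.trans ?_)
        nlinarith [Real.pi_gt_three, sq_nonneg ρ])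
      have h2 := hgrow (b (k + 1) + ρ) (b k) (by positivity) (by linarith) (hbr k).1
      have h3 : v (b (k + 1)) ≤ v (b (k + 1) + ρ) := hmono (by linarith)
      have h4 : b k - (b (k + 1) + ρ) = ρ := by linarith
      rw [h4] at h2
      have h5 : v (b (k + 1)) ≤ 2 * ρ * μ.real (Metric.ball y (b (k + 1) + ρ)) := h1
      have h6 : (q * (9 / 10 : ℝ) ^ (k + 1)) ^ 2 = 81 / 100 * ρ ^ 2 := by
        rw [hρ, pow_succ]; ring
      rw [h6]
      nlinarith [sq_nonneg ρ]
  have hlim : Tendsto (fun k : ℕ => (q * (9 / 10 : ℝ) ^ k) ^ 2) atTop (𝓝 0) := by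
    have := ((tendsto_pow_atTop_nhds_zero_of_lt_one (by norm_num : (0 : ℝ) ≤ 9 / 10)
      (by norm_num)).const_mul q).pow 2
    simpa using this
  have := ge_of_tendsto' hlim fun k => (hmono (hbr k).2.le).trans (hstep k)
  linarith

end DipolarDrop
end

noncomputable section

namespace DipolarDrop

variable {Ω : Set Plane} {μ : Measure Plane} {σ : Plane → Plane} {y ν : Plane}

theorem IsNormalAt.neg (hn : IsNormalAt μ σ y ν) : IsNormalAt μ (fun x => - σ x) y (-ν) :=
  ⟨hn.pos, by rw [norm_neg, hn.norm_eq], by simpa only [average_neg] using hn.tendsto.neg⟩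

theorem IsNormalAt.exists_excess_le (hn : IsNormalAt μ σ y ν) (h : IsGaussGreenPair Ω μ σ)
    {ε : ℝ} (hε : 0 < ε) :
    ∃ r₀ > 0, ∀ s ∈ Set.Ioo 0 r₀,
      ∫ x in Metric.ball y s, ‖σ x - ν‖ ∂μ ≤ ε * μ.real (Metric.ball y s) := by
  obtain ⟨r₀, hr₀, hsub⟩ := mem_nhdsGT_iff_exists_Ioo_subset.1 (hn.eventually_excess_le h hε)
  exact ⟨r₀, hr₀, fun s hs => hsub hs⟩

theorem IsNormalAt.exists_measure_ball_le (hn : IsNormalAt μ σ y ν) (h : IsGaussGreenPair Ω μ σ)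
    (hΩ : MeasurableSet Ω) :
    ∃ r₀ > 0, ∀ s ∈ Set.Ioo 0 r₀, μ.real (Metric.ball y s) ≤ 8 * Real.pi * s := by
  obtain ⟨r₀, hr₀, hex⟩ := hn.exists_excess_le h (ε := 1 / 2) (by norm_num)
  refine ⟨r₀ / 2, by positivity, fun s hs => ?_⟩
  have hs0 : 0 < s := hs.1
  have h1 := h.measure_ball_le_growth (y := y) hΩ hn.norm_eq (ε := 1 / 2) (a := s) (b := 2 * s)
    (by linarith) (by norm_num) fun t ht => hex t ⟨hs0.trans_le ht.1, by linarith [ht.2, hs.2]⟩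
  have h2 : volume.real (Ω ∩ Metric.ball y (2 * s)) ≤ Real.pi * (2 * s) ^ 2 := by
    rw [← volume_real_ball y (by linarith)]
    exact measureReal_mono Set.inter_subset_right (volume_ball_ne_top _ _)
  have h3 : 0 ≤ volume.real (Ω ∩ Metric.ball y s) := measureReal_nonneg
  have h4 : s * μ.real (Metric.ball y s) ≤ s * (8 * Real.pi * s) := by nlinarith
  exact le_of_mul_le_mul_left h4 hs0

/-- At a point of the reduced boundary, `Ω` has density zero in the outer half-plane. -/
theorem IsNormalAt.eventually_volume_halfPlane_le (hn : IsNormalAt μ σ y ν)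
    (h : IsGaussGreenPair Ω μ σ) (hΩ : MeasurableSet Ω) {κ ε : ℝ} (hκ : 0 < κ) (hκ1 : κ ≤ 1)
    (hε : 0 < ε) :
    ∀ᶠ r in 𝓝[>] (0 : ℝ),
      volume.real (Ω ∩ Metric.ball y r ∩ {x | κ * r ≤ inner ℝ (x - y) ν}) ≤ ε * r ^ 2 := by
  have hfin := h.finite
  set ε₀ : ℝ := min (1 / 2) (ε * κ ^ 2 / (192 * 16 * 1600)) with hε₀
  have hε₀0 : 0 < ε₀ := by positivity
  obtain ⟨r₁, hr₁, hex⟩ := hn.exists_excess_le h hε₀0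
  obtain ⟨r₂, hr₂, hup⟩ := hn.exists_measure_ball_le h hΩ
  have hr12 : 0 < min r₁ r₂ / 4 := by positivity
  filter_upwards [Ioo_mem_nhdsGT hr12] with r hr
  have hr0 : 0 < r := hr.1
  have hra : 4 * r < r₁ := by linarith [hr.2, min_le_left r₁ r₂]
  have hrb : 4 * r < r₂ := by linarith [hr.2, min_le_right r₁ r₂]
  have hdens : (κ * r) ^ 2 / 1600 ≤ volume.real (Ωᶜ ∩ Metric.ball y (κ * r)) := by
    refine (h.compl hΩ.nullMeasurableSet).volume_inter_ball_ge hΩ.compl (ν := -ν)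
      (by rw [norm_neg, hn.norm_eq]) hn.pos (by positivity) fun s hs => ?_
    have hs2 : s ≤ κ * r := hs.2
    have h1 := hex s ⟨hs.1, by nlinarith⟩
    have e : ∀ x, ‖-σ x - -ν‖ = ‖σ x - ν‖ := fun x => by
      rw [← norm_neg]; congr 1; abel
    simp only [e]
    refine h1.trans (mul_le_mul_of_nonneg_right (min_le_left _ _) measureReal_nonneg)
  set S : Set Plane := Metric.ball 0 (2 * r) ∩ {z | 0 ≤ inner ℝ z ν} with hS
  have hSm : MeasurableSet S := Metric.isOpen_ball.measurableSet.inter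
    (measurableSet_le measurable_const (by fun_prop))
  set D := Ω ∩ Metric.ball y r ∩ {x | κ * r ≤ inner ℝ (x - y) ν} with hD
  have key := volume_mul_le_of_translate (A := Ωᶜ ∩ Metric.ball y (κ * r)) (S := S) (T := Ω)
    (c := 2 * r * (ε₀ * (8 * Real.pi * (3 * r)))) (d := volume.real D)
    (hΩ.compl.inter Metric.isOpen_ball.measurableSet) hSm hΩ
    (measure_ne_top_of_subset Set.inter_subset_right (volume_ball_ne_top y _))
    (measure_ne_top_of_subset Set.inter_subset_left (volume_ball_ne_top 0 _)) ?_ ?_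
  · have h1 : volume.real S ≤ Real.pi * (2 * r) ^ 2 := by
      rw [← volume_real_ball 0 (by linarith)]
      exact measureReal_mono Set.inter_subset_left (volume_ball_ne_top _ _)
    have h2 : (κ * r) ^ 2 / 1600 * volume.real D ≤
        Real.pi * (2 * r) ^ 2 * (2 * r * (ε₀ * (8 * Real.pi * (3 * r)))) := by
      have := Real.pi_pos
      refine (mul_le_mul_of_nonneg_right hdens measureReal_nonneg).trans (key.trans ?_)
      exact mul_le_mul_of_nonneg_right h1 (by positivity)
    have hpi : Real.pi ^ 2 ≤ 16 := by nlinarith [Real.pi_le_four, Real.pi_pos]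
    have hε₁ : ε₀ * (192 * 16 * 1600) ≤ ε * κ ^ 2 := by
      have := min_le_right (1 / 2) (ε * κ ^ 2 / (192 * 16 * 1600))
      rwa [le_div_iff₀ (by norm_num)] at this
    have h3 : κ ^ 2 * r ^ 2 * volume.real D ≤ κ ^ 2 * r ^ 2 * (ε * r ^ 2) := by
      calc κ ^ 2 * r ^ 2 * volume.real D = 1600 * ((κ * r) ^ 2 / 1600 * volume.real D) := by ring
        _ ≤ 1600 * (Real.pi * (2 * r) ^ 2 * (2 * r * (ε₀ * (8 * Real.pi * (3 * r))))) := by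
            linarith
        _ = (Real.pi ^ 2 * ε₀) * (192 * 1600) * r ^ 4 := by ring
        _ ≤ (16 * ε₀) * (192 * 1600) * r ^ 4 := by gcongr
        _ ≤ (ε * κ ^ 2) * r ^ 4 := by
            refine mul_le_mul_of_nonneg_right ?_ (by positivity)
            linarith
        _ = _ := by ring
    exact le_of_mul_le_mul_left h3 (by positivity)
  · intro z hz
    have hz1 : ‖z‖ < 2 * r := by simpa using hz.1
    have hz2 : 0 ≤ inner ℝ z ν := hz.2
    have hi : Integrable (fun x => ‖σ x - ν‖) μ := (h.integrable.sub (integrable_const ν)).norm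
    have h1 := h.measure_ball_translate_le hΩ y z (κ * r)
      (ψ := fun x => ‖z‖ * ‖σ x - ν‖) (hi.const_mul _)
      (fun _ => by positivity) (ae_of_all _ fun x => by
        have : inner ℝ z (ν - σ x) ≤ ‖z‖ * ‖ν - σ x‖ := real_inner_le_norm _ _
        rw [inner_sub_right, norm_sub_rev] at this
        linarith)
    have e : (Ωᶜ ∩ Metric.ball y (κ * r)) ∩ {x | x + z ∈ Ω} =
        (Metric.ball y (κ * r) \ Ω) ∩ {x | x + z ∈ Ω} := by
      ext x; simp only [Set.mem_inter_iff, Set.mem_sdiff, Set.mem_compl_iff]; tauto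
    rw [e]
    refine h1.trans ?_
    rw [integral_const_mul]
    have hsub : Metric.ball y (κ * r + ‖z‖) ⊆ Metric.ball y (3 * r) :=
      Metric.ball_subset_ball (by nlinarith)
    have h2 : ∫ x in Metric.ball y (κ * r + ‖z‖), ‖σ x - ν‖ ∂μ ≤
        ∫ x in Metric.ball y (3 * r), ‖σ x - ν‖ ∂μ :=
      setIntegral_mono_set hi.integrableOn (ae_of_all _ fun x => norm_nonneg _)
        hsub.eventuallyLE
    have h3 := hex (3 * r) ⟨by linarith, by linarith⟩
    have h4 := hup (3 * r) ⟨by linarith, by linarith⟩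
    have h5 : ∫ x in Metric.ball y (κ * r + ‖z‖), ‖σ x - ν‖ ∂μ ≤ ε₀ * (8 * Real.pi * (3 * r)) :=
      h2.trans (h3.trans (mul_le_mul_of_nonneg_left h4 hε₀0.le))
    exact mul_le_mul hz1.le h5 (integral_nonneg fun x => norm_nonneg _) (by linarith)
  · intro x hx
    have hx2 : ‖x - y‖ < κ * r := by simpa [dist_eq_norm] using hx.2
    rw [← volume_real_preimage_add x D]
    refine measureReal_mono ?_
      (measure_ne_top_of_subset (Set.inter_subset_left.trans Set.inter_subset_left)
        (volume_ball_ne_top 0 (2 * r)))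
    rintro z ⟨⟨hz1, hz2⟩, hz3⟩
    have hz2' : ‖x + z - y‖ < r := by simpa [dist_eq_norm] using hz2
    have hz3' : κ * r ≤ inner ℝ (x + z - y) ν := hz3
    refine ⟨⟨?_, ?_⟩, hz1⟩
    · rw [mem_ball_zero_iff]
      calc ‖z‖ = ‖(x + z - y) - (x - y)‖ := by congr 1; abel
        _ ≤ ‖x + z - y‖ + ‖x - y‖ := norm_sub_le _ _
        _ < 2 * r := by nlinarith
    · have e : inner ℝ z ν = inner ℝ (x + z - y) ν - inner ℝ (x - y) ν := by
        rw [← inner_sub_left]; congr 1; abel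
      have h1 : inner ℝ (x - y) ν ≤ ‖x - y‖ * ‖ν‖ := real_inner_le_norm _ _
      rw [hn.norm_eq, mul_one] at h1
      change 0 ≤ inner ℝ z ν
      rw [e]
      linarith

/-! ### Rectangles -/

/-- The rotation of a vector by a right angle. -/
def perp (ν : Plane) : Plane := !₂[-ν 1, ν 0]

theorem norm_perp (ν : Plane) : ‖perp ν‖ = ‖ν‖ := by
  simp [EuclideanSpace.norm_eq, perp, Fin.sum_univ_two, add_comm]

theorem inner_perp_self (ν : Plane) : inner ℝ (perp ν) ν = 0 := by
  simp [PiLp.inner_apply, perp, Fin.sum_univ_two]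
  ring

theorem inner_sq_add_inner_sq (hν : ‖ν‖ = 1) (x : Plane) :
    inner ℝ x (perp ν) ^ 2 + inner ℝ x ν ^ 2 = ‖x‖ ^ 2 := by
  have h1 : ν 0 ^ 2 + ν 1 ^ 2 = 1 := by
    have := EuclideanSpace.norm_sq_eq ν
    rw [hν] at this
    simpa [Fin.sum_univ_two] using this.symm
  simp only [PiLp.inner_apply, perp, Fin.sum_univ_two, EuclideanSpace.norm_sq_eq]
  simp
  linear_combination (x 0 ^ 2 + x 1 ^ 2) * h1

theorem measurePreserving_coords (hν : ‖ν‖ = 1) :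
    MeasurePreserving (fun x : Plane => ((inner ℝ x (perp ν), inner ℝ x ν) : ℝ × ℝ)) := by
  have hon : Orthonormal ℝ ![perp ν, ν] := by
    rw [orthonormal_iff_ite]
    intro i j
    have h1 : inner ℝ ν (perp ν) = 0 := by rw [real_inner_comm]; exact inner_perp_self ν
    fin_cases i <;> fin_cases j <;>
      simp [hν, norm_perp, inner_perp_self, h1]
  let b := (basisOfOrthonormalOfCardEqFinrank hon (by simp)).toOrthonormalBasis
    (by simpa using hon)
  have hb : ⇑b = ![perp ν, ν] := by simp [b]
  have h1 := b.measurePreserving_repr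
  have h2 := PiLp.volume_preserving_ofLp (Fin 2)
  have h3 := volume_preserving_finTwoArrow ℝ
  have h4 := h3.comp (h2.comp h1)
  have e : (fun x : Plane => ((inner ℝ x (perp ν), inner ℝ x ν) : ℝ × ℝ)) =
      (MeasurableEquiv.finTwoArrow ∘ (WithLp.ofLp ∘ b.repr) : Plane → ℝ × ℝ) := by
    funext x
    have hi : ∀ i, b.repr x i = inner ℝ (b i) x := fun i => b.repr_apply_apply x i
    refine Prod.ext ?_ ?_
    · change _ = b.repr x 0
      rw [hi, hb, real_inner_comm]
      rfl
    · change inner ℝ x ν = b.repr x 1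
      rw [hi, hb, real_inner_comm]
      rfl
  rw [e]
  exact h4

/-- The open rectangle around `y` with sides `(α, β)` along `perp ν` and `(γ, δ)` along `ν`. -/
def openRect (y ν : Plane) (α β γ δ : ℝ) : Set Plane :=
  {x | inner ℝ (x - y) (perp ν) ∈ Set.Ioo α β ∧ inner ℝ (x - y) ν ∈ Set.Ioo γ δ}

theorem isOpen_openRect (y ν : Plane) (α β γ δ : ℝ) : IsOpen (openRect y ν α β γ δ) :=
  (isOpen_Ioo.preimage (by fun_prop : Continuous fun x : Plane => inner ℝ (x - y) (perp ν))).inter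
    (isOpen_Ioo.preimage (by fun_prop : Continuous fun x : Plane => inner ℝ (x - y) ν))

theorem volume_openRect (hν : ‖ν‖ = 1) (y : Plane) (α β γ δ : ℝ) :
    volume (openRect y ν α β γ δ) = ENNReal.ofReal (β - α) * ENNReal.ofReal (δ - γ) := by
  have h1 := (measurePreserving_coords hν).comp (measurePreserving_sub_right volume y)
  have h2 := h1.measure_preimage (s := Set.Ioo α β ×ˢ Set.Ioo γ δ)
    (measurableSet_Ioo.prod measurableSet_Ioo).nullMeasurableSet
  rw [Measure.volume_eq_prod, Measure.prod_prod, Real.volume_Ioo, Real.volume_Ioo] at h2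
  exact h2

theorem volume_openRect_ne_top (hν : ‖ν‖ = 1) (y : Plane) (α β γ δ : ℝ) :
    volume (openRect y ν α β γ δ) ≠ ∞ := by
  rw [volume_openRect hν]
  finiteness

theorem volume_real_openRect (hν : ‖ν‖ = 1) (y : Plane) {α β γ δ : ℝ} (hαβ : α ≤ β)
    (hγδ : γ ≤ δ) : volume.real (openRect y ν α β γ δ) = (β - α) * (δ - γ) := by
  rw [measureReal_def, volume_openRect hν, ENNReal.toReal_mul,
    ENNReal.toReal_ofReal (by linarith), ENNReal.toReal_ofReal (by linarith)]

theorem mem_ball_of_inner (hν : ‖ν‖ = 1) {x y : Plane} {a b r : ℝ} (hr : 0 < r)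
    (ha : |inner ℝ (x - y) (perp ν)| ≤ a) (hb : |inner ℝ (x - y) ν| ≤ b)
    (hab : a ^ 2 + b ^ 2 < r ^ 2) : x ∈ Metric.ball y r := by
  rw [Metric.mem_ball, dist_eq_norm]
  refine lt_of_pow_lt_pow_left₀ 2 hr.le ?_
  rw [← inner_sq_add_inner_sq hν]
  have h1 := sq_le_sq' (by linarith [neg_abs_le (inner ℝ (x - y) (perp ν))])
    ((le_abs_self _).trans ha)
  have h2 := sq_le_sq' (by linarith [neg_abs_le (inner ℝ (x - y) ν)]) ((le_abs_self _).trans hb)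
  linarith

/-! ### The translation formula for open sets -/

theorem IsGaussGreenPair.setIntegral_sub_translate_swap (h : IsGaussGreenPair Ω μ σ)
    {f : Plane → ℝ} (hf : Continuous f) (hs : HasCompactSupport f) (z : Plane) :
    (∫ x in Ω, f x) - ∫ x in Ω, f (x - z) =
      ∫ x, (∫ t in (0 : ℝ)..1, f (x - t • z)) * inner ℝ z (σ x) ∂μ := by
  have hfin := h.finite
  have hfi : Integrable f := hf.integrable_of_hasCompactSupport hs
  obtain ⟨c, hc⟩ := hf.bounded_above_of_compact_support hs
  rw [← integral_sub hfi.restrict (hfi.comp_sub_right z).restrict,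
    h.setIntegral_sub_translate hf hs]
  simp_rw [intervalIntegral.integral_of_le zero_le_one, ← integral_mul_const]
  refine integral_integral_swap (f := fun t x => f (x - t • z) * inner ℝ z (σ x)) ?_
  have h1 : Integrable (fun p : ℝ × Plane => inner ℝ z (σ p.2))
      ((volume.restrict (Set.Ioc (0 : ℝ) 1)).prod μ) := (h.integrable_inner z).comp_snd _
  exact h1.bdd_mul (f := fun p : ℝ × Plane => f (p.2 - p.1 • z)) (c := c)
    (hf.comp (by fun_prop)).aestronglyMeasurable (ae_of_all _ fun p => hc _)

theorem IsGaussGreenPair.volume_sub_volume_translate (h : IsGaussGreenPair Ω μ σ)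
    {R : Set Plane} (hR : IsOpen R) (hRb : Bornology.IsBounded R) (z : Plane) :
    volume.real (Ω ∩ R) - volume.real (Ω ∩ {x | x - z ∈ R}) =
      ∫ x, (∫ t in (0 : ℝ)..1, R.indicator (fun _ => (1 : ℝ)) (x - t • z)) *
        inner ℝ z (σ x) ∂μ := by
  have hfin := h.finite
  have hRne : (Rᶜ : Set Plane).Nonempty := by
    by_contra hne
    rw [Set.not_nonempty_iff_eq_empty, Set.compl_empty_iff] at hne
    rw [hne] at hRb
    exact NormedSpace.unbounded_univ ℝ Plane hRb
  set f : ℕ → Plane → ℝ := fun n x => min 1 (n * Metric.infDist x Rᶜ) with hfdef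
  have hfc : ∀ n, Continuous (f n) := fun n => by
    have := Metric.continuous_infDist_pt (Rᶜ : Set Plane)
    fun_prop
  have hf0 : ∀ n x, 0 ≤ f n x := fun n x =>
    le_min zero_le_one (mul_nonneg n.cast_nonneg Metric.infDist_nonneg)
  have hf1 : ∀ n x, f n x ≤ 1 := fun n x => min_le_left _ _
  have hfz : ∀ n x, x ∉ R → f n x = 0 := fun n x hx => by
    simp [hfdef, Metric.infDist_zero_of_mem (show x ∈ Rᶜ from hx)]
  have hfs : ∀ n, HasCompactSupport (f n) := fun n =>
    HasCompactSupport.intro hRb.isCompact_closure fun x hx => hfz n x fun h' => hx (subset_closure h')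
  have hlim : ∀ x, Tendsto (fun n => f n x) atTop (𝓝 (R.indicator (fun _ => (1 : ℝ)) x)) := by
    intro x
    by_cases hx : x ∈ R
    · rw [Set.indicator_of_mem hx]
      have hpos : 0 < Metric.infDist x Rᶜ :=
        (hR.isClosed_compl.notMem_iff_infDist_pos hRne).1 (by simpa using hx)
      have h1 : Tendsto (fun n : ℕ => (n : ℝ) * Metric.infDist x Rᶜ) atTop atTop :=
        tendsto_natCast_atTop_atTop.atTop_mul_const hpos
      refine tendsto_const_nhds.congr' ?_
      filter_upwards [h1.eventually_ge_atTop 1] with n hn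
      exact (min_eq_left hn).symm
    · rw [Set.indicator_of_notMem hx]
      exact tendsto_const_nhds.congr fun n => (hfz n x hx).symm
  have hRm := hR.measurableSet
  have hRf : volume R ≠ ∞ := hRb.measure_lt_top.ne
  have hfR : ∀ n x, ‖f n x‖ ≤ R.indicator (fun _ => (1 : ℝ)) x := fun n x => by
    rw [Real.norm_of_nonneg (hf0 n x)]
    by_cases hx : x ∈ R
    · simpa [hx] using hf1 n x
    · simp [hx, hfz n x hx]
  have hIR : Integrable (R.indicator fun _ => (1 : ℝ)) :=
    (integrable_indicator_iff hRm).2 (integrableOn_const hRf)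
  have L1 : Tendsto (fun n => ∫ x in Ω, f n x) atTop (𝓝 (volume.real (Ω ∩ R))) := by
    have e : volume.real (Ω ∩ R) = ∫ x in Ω, R.indicator (fun _ => (1 : ℝ)) x := by
      rw [setIntegral_indicator hRm]; simp
    rw [e]
    exact tendsto_integral_of_dominated_convergence _
      (fun n => (hfc n).aestronglyMeasurable) hIR.restrict
      (fun n => ae_of_all _ (hfR n)) (ae_of_all _ hlim)
  have L2 : Tendsto (fun n => ∫ x in Ω, f n (x - z)) atTop
      (𝓝 (volume.real (Ω ∩ {x | x - z ∈ R}))) := by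
    have hm : MeasurableSet {x : Plane | x - z ∈ R} := hRm.preimage (by fun_prop)
    have e : volume.real (Ω ∩ {x | x - z ∈ R}) =
        ∫ x in Ω, R.indicator (fun _ => (1 : ℝ)) (x - z) := by
      have : (fun x => R.indicator (fun _ => (1 : ℝ)) (x - z)) =
          {x : Plane | x - z ∈ R}.indicator fun _ => 1 := by
        ext x
        by_cases hx : x - z ∈ R <;> simp [Set.indicator, hx]
      rw [this, setIntegral_indicator hm]; simp
    rw [e]
    exact tendsto_integral_of_dominated_convergence _
      (fun n => ((hfc n).comp (by fun_prop)).aestronglyMeasurable) (hIR.comp_sub_right z).restrict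
      (fun n => ae_of_all _ fun x => hfR n (x - z)) (ae_of_all _ fun x => hlim (x - z))
  have L3 : Tendsto (fun n => ∫ x, (∫ t in (0 : ℝ)..1, f n (x - t • z)) * inner ℝ z (σ x) ∂μ)
      atTop (𝓝 (∫ x, (∫ t in (0 : ℝ)..1, R.indicator (fun _ => (1 : ℝ)) (x - t • z)) *
        inner ℝ z (σ x) ∂μ)) := by
    refine tendsto_integral_of_dominated_convergence (fun x => |inner ℝ z (σ x)|)
      (fun n => ?_) (h.integrable_inner z).abs (fun n => ae_of_all _ fun x => ?_)
      (ae_of_all _ fun x => ?_)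
    · refine AEStronglyMeasurable.mul (Continuous.aestronglyMeasurable ?_) (h.integrable_inner z).1
      have := hfc n
      exact intervalIntegral.continuous_parametric_intervalIntegral_of_continuous' (by fun_prop) _ _
    · rw [norm_mul, Real.norm_eq_abs (inner ℝ z (σ x))]
      refine mul_le_of_le_one_left (abs_nonneg _) ?_
      have := intervalIntegral.norm_integral_le_of_norm_le_const (a := 0) (b := 1) (C := 1)
        (f := fun t : ℝ => f n (x - t • z)) fun t _ => by
          rw [Real.norm_of_nonneg (hf0 n _)]; exact hf1 n _
      simpa using this
    · refine Tendsto.mul_const _ ?_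
      refine intervalIntegral.tendsto_integral_filter_of_dominated_convergence (fun _ => 1)
        (Eventually.of_forall fun n => ?_) (Eventually.of_forall fun n => ae_of_all _ fun t _ => ?_)
        intervalIntegrable_const (ae_of_all _ fun t _ => hlim _)
      · exact ((hfc n).comp (by fun_prop)).aestronglyMeasurable
      · rw [Real.norm_of_nonneg (hf0 n _)]; exact hf1 n _
  refine tendsto_nhds_unique (L1.sub L2) (L3.congr fun n => ?_)
  exact (h.setIntegral_sub_translate_swap (hfc n) (hfs n) z).symm

end DipolarDrop
end

noncomputable section

namespace DipolarDrop

variable {Ω : Set Plane} {μ : Measure Plane} {σ : Plane → Plane} {y ν : Plane}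

/-! ### De Giorgi's structure theorem -/

theorem isBounded_openRect (hν : ‖ν‖ = 1) (y : Plane) (α β γ δ : ℝ) :
    Bornology.IsBounded (openRect y ν α β γ δ) := by
  set a := max |α| |β|
  set b := max |γ| |δ|
  refine (Metric.isBounded_ball (x := y) (r := √(a ^ 2 + b ^ 2 + 1))).subset fun x hx => ?_
  refine mem_ball_of_inner hν (a := a) (b := b) (by positivity)
    (abs_le_max_abs_abs hx.1.1.le hx.1.2.le) (abs_le_max_abs_abs hx.2.1.le hx.2.2.le) ?_
  rw [Real.sq_sqrt (by positivity)]
  linarith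

theorem indicator_one_mem_Icc (R : Set Plane) (x : Plane) :
    R.indicator (fun _ => (1 : ℝ)) x ∈ Set.Icc (0 : ℝ) 1 := by
  by_cases hx : x ∈ R <;> simp [hx]

/-- The fraction of the segment from `x` to `x - z` which lies in `R`. -/
def segmentFraction (R : Set Plane) (z x : Plane) : ℝ :=
  ∫ t in (0 : ℝ)..1, R.indicator (fun _ => (1 : ℝ)) (x - t • z)

theorem intervalIntegrable_indicator_segment {R : Set Plane} (hR : MeasurableSet R)
    (z x : Plane) :
    IntervalIntegrable (fun t : ℝ => R.indicator (fun _ => (1 : ℝ)) (x - t • z)) volume 0 1 := by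
  have hm : Measurable fun t : ℝ => R.indicator (fun _ => (1 : ℝ)) (x - t • z) :=
    (measurable_const.indicator hR).comp (by fun_prop)
  refine (intervalIntegrable_const (c := (1 : ℝ))).mono_fun hm.aestronglyMeasurable
    (ae_of_all _ fun t => ?_)
  have := indicator_one_mem_Icc R (x - t • z)
  beta_reduce
  rw [Real.norm_of_nonneg this.1, norm_one]
  exact this.2

theorem segmentFraction_nonneg (R : Set Plane) (z x : Plane) : 0 ≤ segmentFraction R z x :=
  intervalIntegral.integral_nonneg zero_le_one fun _ _ => (indicator_one_mem_Icc R _).1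

theorem segmentFraction_le_one {R : Set Plane} (hR : MeasurableSet R) (z x : Plane) :
    segmentFraction R z x ≤ 1 := by
  have := intervalIntegral.integral_mono_on zero_le_one
    (intervalIntegrable_indicator_segment hR z x) (intervalIntegrable_const (c := (1 : ℝ)))
    fun t _ => (indicator_one_mem_Icc R _).2
  rw [segmentFraction]
  simpa using this

theorem segmentFraction_eq_zero {R : Set Plane} {z x : Plane}
    (h : ∀ t ∈ Set.Icc (0 : ℝ) 1, x - t • z ∉ R) : segmentFraction R z x = 0 := by
  rw [segmentFraction, intervalIntegral.integral_congr (g := fun _ => 0)]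
  · simp
  · intro t ht
    rw [Set.uIcc_of_le zero_le_one] at ht
    simp [h t ht]

theorem segmentFraction_eq_one {R : Set Plane} {z x : Plane}
    (h : ∀ t ∈ Set.Icc (0 : ℝ) 1, x - t • z ∈ R) : segmentFraction R z x = 1 := by
  rw [segmentFraction, intervalIntegral.integral_congr (g := fun _ => 1)]
  · simp
  · intro t ht
    rw [Set.uIcc_of_le zero_le_one] at ht
    simp [h t ht]

theorem measurable_segmentFraction {R : Set Plane} (hR : MeasurableSet R) (z : Plane) :
    Measurable (segmentFraction R z) := by
  unfold segmentFraction
  simp_rw [intervalIntegral.integral_of_le zero_le_one]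
  refine (StronglyMeasurable.integral_prod_right' (f := fun p : Plane × ℝ =>
    R.indicator (fun _ => (1 : ℝ)) (p.1 - p.2 • z)) ?_).measurable
  exact ((measurable_const.indicator hR).comp (by fun_prop)).stronglyMeasurable

theorem inner_sub_smul_perp (x y : Plane) (t : ℝ) :
    inner ℝ (x - t • ν - y) (perp ν) = inner ℝ (x - y) (perp ν) := by
  have e : x - t • ν - y = (x - y) - t • ν := by abel
  have h0 : inner ℝ ν (perp ν) = 0 := by rw [real_inner_comm, inner_perp_self]
  rw [e, inner_sub_left, real_inner_smul_left, h0]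
  simp

theorem inner_sub_smul_self (hν : ‖ν‖ = 1) (x y : Plane) (t : ℝ) :
    inner ℝ (x - t • ν - y) ν = inner ℝ (x - y) ν - t := by
  have e : x - t • ν - y = (x - y) - t • ν := by abel
  rw [e, inner_sub_left, real_inner_smul_left, real_inner_self_eq_norm_sq, hν]
  simp

/-- Upper density: small sets through a point of the reduced boundary have measure at most
about their diameter. -/
theorem IsNormalAt.exists_measure_le_diam (hn : IsNormalAt μ σ y ν) (h : IsGaussGreenPair Ω μ σ)
    (hΩ : MeasurableSet Ω) {κ : ℝ} (hκ : 0 < κ) (hκ1 : κ ≤ 1) :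
    ∃ d₀ > 0, ∀ d ∈ Set.Ioo 0 d₀, ∀ E : Set Plane, y ∈ E →
      (∀ x ∈ E, ∀ x' ∈ E, dist x x' ≤ d) → μ E ≤ ENNReal.ofReal ((1 + 3 * κ) * d) := by
  have hfin := h.finite
  have hν := hn.norm_eq
  set ε : ℝ := κ / 256 with hε
  have hε0 : 0 < ε := by positivity
  obtain ⟨r₁, hr₁, hex⟩ := hn.exists_excess_le h hε0
  obtain ⟨r₂, hr₂, hup⟩ := hn.exists_measure_ball_le h hΩ
  refine ⟨min r₁ r₂ / 8, by positivity, fun d hd E hyE hE => ?_⟩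
  have hd0 : 0 < d := hd.1
  have hda : 8 * d < r₁ := by linarith [hd.2, min_le_left r₁ r₂]
  have hdb : 8 * d < r₂ := by linarith [hd.2, min_le_right r₁ r₂]
  set T : Set ℝ := (fun x => inner ℝ (x - y) (perp ν)) '' E with hT
  have hTne : T.Nonempty := ⟨_, y, hyE, rfl⟩
  have hTd : ∀ x ∈ E, ∀ x' ∈ E, |inner ℝ (x - y) (perp ν) - inner ℝ (x' - y) (perp ν)| ≤ d := by
    intro x hx x' hx'
    have e : inner ℝ (x - y) (perp ν) - inner ℝ (x' - y) (perp ν) =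
        inner ℝ (x - x') (perp ν) := by rw [← inner_sub_left]; congr 1; abel
    rw [e]
    refine (abs_real_inner_le_norm _ _).trans ?_
    rw [norm_perp, hν, mul_one, ← dist_eq_norm]
    exact hE x hx x' hx'
  have hTab : ∀ x ∈ E, |inner ℝ (x - y) (perp ν)| ≤ d := fun x hx => by
    simpa using hTd x hx y hyE
  have hTbd : BddBelow T := ⟨-d, by rintro _ ⟨x, hx, rfl⟩; exact (abs_le.1 (hTab x hx)).1⟩
  set a := sInf T with ha
  have haE : ∀ x ∈ E, a ≤ inner ℝ (x - y) (perp ν) ∧ inner ℝ (x - y) (perp ν) ≤ a + d := by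
    intro x hx
    refine ⟨csInf_le hTbd ⟨x, hx, rfl⟩, ?_⟩
    have : inner ℝ (x - y) (perp ν) - d ≤ a := by
      refine le_csInf hTne ?_
      rintro _ ⟨x', hx', rfl⟩
      linarith [(abs_le.1 (hTd x hx x' hx')).2]
    linarith
  have ha1 : -d ≤ a ∧ a ≤ 0 := by
    refine ⟨le_csInf hTne ?_, ?_⟩
    · rintro _ ⟨x, hx, rfl⟩; exact (abs_le.1 (hTab x hx)).1
    · simpa using (haE y hyE).1
  set θ := κ * d / 4 with hθ
  have hθ0 : 0 < θ := by positivity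
  have hθd : θ ≤ d / 4 := by rw [hθ]; nlinarith
  set R := openRect y ν (a - θ) (a + d + θ) (-2 * d - θ) (d + θ) with hR
  set F : Set Plane := {x | inner ℝ (x - y) (perp ν) ∈ Set.Icc a (a + d) ∧
    inner ℝ (x - y) ν ∈ Set.Icc (-d) d} with hF
  have hFm : MeasurableSet F :=
    (measurableSet_Icc.preimage (by fun_prop : Measurable fun x : Plane =>
      inner ℝ (x - y) (perp ν))).inter
    (measurableSet_Icc.preimage (by fun_prop : Measurable fun x : Plane => inner ℝ (x - y) ν))
  have hEF : E ⊆ F := fun x hx => by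
    refine ⟨haE x hx, abs_le.1 ((abs_real_inner_le_norm _ _).trans ?_)⟩
    rw [hν, mul_one, ← dist_eq_norm]
    exact hE x hx y hyE
  have hRo : IsOpen R := isOpen_openRect _ _ _ _ _ _
  have hRm := hRo.measurableSet
  have key := h.volume_sub_volume_translate hRo (isBounded_openRect hν _ _ _ _ _) (d • ν)
  set lam : Plane → ℝ := segmentFraction R (d • ν) with hlam
  have hsm : ∀ (x : Plane) (t : ℝ), x - t • d • ν = x - (t * d) • ν := fun x t => by
    rw [smul_smul]
  have hlamF : ∀ x ∈ F, lam x = 1 := fun x hx => by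
    refine segmentFraction_eq_one fun t ht => ?_
    rw [hsm]
    have h1 : t * d ≤ d := mul_le_of_le_one_left hd0.le ht.2
    have h2 : 0 ≤ t * d := mul_nonneg ht.1 hd0.le
    refine ⟨?_, ?_⟩
    · rw [inner_sub_smul_perp]
      exact ⟨by linarith [hx.1.1], by linarith [hx.1.2]⟩
    · rw [inner_sub_smul_self hν]
      exact ⟨by linarith [hx.2.1], by linarith [hx.2.2]⟩
  have hlam0 : ∀ x, x ∉ Metric.ball y (6 * d) → lam x = 0 := fun x hx => by
    refine segmentFraction_eq_zero fun t ht hxR => hx ?_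
    rw [hsm] at hxR
    have h1 : t * d ≤ d := mul_le_of_le_one_left hd0.le ht.2
    have h2 : 0 ≤ t * d := mul_nonneg ht.1 hd0.le
    obtain ⟨hx1, hx2⟩ := hxR
    rw [inner_sub_smul_perp] at hx1
    rw [inner_sub_smul_self hν] at hx2
    refine mem_ball_of_inner hν (a := 2 * d) (b := 4 * d) (by positivity)
      (abs_le.2 ⟨by linarith [hx1.1], by linarith [hx1.2]⟩)
      (abs_le.2 ⟨by linarith [hx2.1], by linarith [hx2.2]⟩) ?_
    nlinarith
  have hup1 : volume.real (Ω ∩ R) - volume.real (Ω ∩ {x | x - d • ν ∈ R}) ≤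
      (d + 2 * θ) * (d + 2 * θ) := by
    have h1 : volume.real (Ω ∩ R) ≤ volume.real (Ω ∩ {x | x - d • ν ∈ R}) +
        volume.real (openRect y ν (a - θ) (a + d + θ) (-2 * d - 2 * θ) (-d)) := by
      refine (measureReal_mono (s₂ := (Ω ∩ {x | x - d • ν ∈ R}) ∪
        openRect y ν (a - θ) (a + d + θ) (-2 * d - 2 * θ) (-d)) ?_ ?_).trans
        (measureReal_union_le _ _)
      · rintro x ⟨hxΩ, hx1, hx2⟩
        by_cases hxs : inner ℝ (x - y) ν < -d
        · exact Or.inr ⟨hx1, by linarith [hx2.1], hxs⟩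
        · refine Or.inl ⟨hxΩ, ?_, ?_⟩
          · rw [inner_sub_smul_perp]; exact hx1
          · rw [inner_sub_smul_self hν]
            exact ⟨by linarith, by linarith [hx2.2]⟩
      · refine ((measure_union_le _ _).trans_lt (ENNReal.add_lt_top.2
          ⟨?_, (volume_openRect_ne_top hν _ _ _ _ _).lt_top⟩)).ne
        refine (measure_mono Set.inter_subset_right).trans_lt ?_
        have : volume {x : Plane | x - d • ν ∈ R} = volume R :=
          (measurePreserving_sub_right volume (d • ν)).measure_preimage
            hRm.nullMeasurableSet
        rw [this]
        exact (volume_openRect_ne_top hν _ _ _ _ _).lt_top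
    rw [volume_real_openRect hν y (by linarith) (by linarith)] at h1
    nlinarith
  have hi : Integrable (fun x => ‖σ x - ν‖) μ := (h.integrable.sub (integrable_const ν)).norm
  have hlow : d * (μ.real F - ∫ x in Metric.ball y (6 * d), ‖σ x - ν‖ ∂μ) ≤
      ∫ x, lam x * inner ℝ (d • ν) (σ x) ∂μ := by
    have e1 : ∫ x, lam x * inner ℝ (d • ν) (σ x) ∂μ =
        d * ∫ x, lam x * inner ℝ ν (σ x) ∂μ := by
      rw [← integral_const_mul]
      refine integral_congr_ae (ae_of_all _ fun x => ?_)
      simp only [real_inner_smul_left]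
      ring
    rw [e1]
    refine mul_le_mul_of_nonneg_left ?_ hd0.le
    have hF1 : Integrable (F.indicator (1 : Plane → ℝ)) μ := (integrable_const (1 : ℝ)).indicator hFm
    rw [← integral_indicator_one hFm, ← integral_indicator Metric.isOpen_ball.measurableSet,
      ← integral_sub hF1 (hi.indicator Metric.isOpen_ball.measurableSet)]
    refine integral_mono (hF1.sub
        (hi.indicator Metric.isOpen_ball.measurableSet))
      (h.integrable_mul_inner ν (measurable_segmentFraction hRm _) (c := 1) fun x => ?_) fun x => ?_
    · rw [abs_of_nonneg (segmentFraction_nonneg _ _ _)]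
      exact segmentFraction_le_one hRm _ _
    · have h3 : inner ℝ ν (ν - σ x) ≤ ‖ν‖ * ‖ν - σ x‖ := real_inner_le_norm _ _
      rw [inner_sub_right, real_inner_self_eq_norm_sq, hν, norm_sub_rev] at h3
      have h4 : 0 ≤ lam x := segmentFraction_nonneg _ _ _
      have h5 : lam x ≤ 1 := segmentFraction_le_one hRm _ _
      have h6 : F.indicator (1 : Plane → ℝ) x ≤ lam x := by
        by_cases hx : x ∈ F
        · simp [hx, hlamF x hx]
        · simpa [hx] using h4
      simp only
      by_cases hx : x ∈ Metric.ball y (6 * d)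
      · rw [Set.indicator_of_mem hx]
        nlinarith [norm_nonneg (σ x - ν)]
      · rw [Set.indicator_of_notMem hx]
        have := hlam0 x hx
        rw [this] at h6 ⊢
        linarith
  have h3 := hex (6 * d) ⟨by linarith, by linarith⟩
  have h4 := hup (6 * d) ⟨by linarith, by linarith⟩
  have h5 : d * μ.real F ≤ d * ((1 + 3 * κ) * d) := by
    have hk : ∫ x, lam x * inner ℝ (d • ν) (σ x) ∂μ ≤ (d + 2 * θ) * (d + 2 * θ) := by
      refine le_trans (le_of_eq ?_) hup1
      exact key.symm
    have h6 : ∫ x in Metric.ball y (6 * d), ‖σ x - ν‖ ∂μ ≤ κ * d := by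
      refine h3.trans ((mul_le_mul_of_nonneg_left h4 hε0.le).trans ?_)
      rw [hε]
      have := Real.pi_le_four
      have h7 : κ / 256 * (8 * Real.pi * (6 * d)) = κ * d * (48 * Real.pi / 256) := by ring
      rw [h7]
      refine mul_le_of_le_one_right (by positivity) ?_
      linarith
    have h8 : (d + 2 * θ) * (d + 2 * θ) = d * (d * (1 + κ / 2) ^ 2) := by rw [hθ]; ring
    rw [h8] at hk
    have h9 := hlow.trans hk
    have h10 := le_of_mul_le_mul_left h9 hd0
    refine mul_le_mul_of_nonneg_left ?_ hd0.le
    nlinarith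
  refine (measure_mono hEF).trans ?_
  rw [← ENNReal.ofReal_toReal (measure_ne_top μ F)]
  exact ENNReal.ofReal_le_ofReal (le_of_mul_le_mul_left h5 hd0)

/-- Lower density: small balls around a point of the reduced boundary have measure at least about
their diameter. -/
theorem IsNormalAt.eventually_measure_ball_ge (hn : IsNormalAt μ σ y ν)
    (h : IsGaussGreenPair Ω μ σ) (hΩ : MeasurableSet Ω) {κ : ℝ} (hκ : 0 < κ) (hκ1 : κ < 1) :
    ∀ᶠ r in 𝓝[>] (0 : ℝ), (1 - 2 * κ) * (2 * r) ≤ μ.real (Metric.ball y r) := by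
  have hfin := h.finite
  have hν := hn.norm_eq
  set p : ℝ := κ / 4 with hp
  have hp0 : 0 < p := by positivity
  have E1 := hn.eventually_volume_halfPlane_le h hΩ hp0 (by linarith) (ε := p * κ) (by positivity)
  have E2 := hn.neg.eventually_volume_halfPlane_le (h.compl hΩ.nullMeasurableSet) hΩ.compl hp0
    (by linarith) (ε := p * κ) (by positivity)
  filter_upwards [E1, E2, self_mem_nhdsWithin] with r h1 h2 hr0
  have hr0 : 0 < r := hr0
  set k : ℝ := p * r with hk
  have hk0 : 0 < k := by positivity
  set w : ℝ := (1 - κ) * r with hw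
  have hw0 : 0 < w := mul_pos (by linarith) hr0
  set R := openRect y ν (-w) w (-2 * k) (-k) with hR
  have hRo : IsOpen R := isOpen_openRect _ _ _ _ _ _
  have hRm := hRo.measurableSet
  have key := h.volume_sub_volume_translate hRo (isBounded_openRect hν _ _ _ _ _) ((3 * k) • ν)
  set lam : Plane → ℝ := segmentFraction R ((3 * k) • ν) with hlam
  have hsm : ∀ (x : Plane) (t : ℝ), x - t • (3 * k) • ν = x - (t * (3 * k)) • ν := fun x t => by
    rw [smul_smul]
  have hball : ∀ x, |inner ℝ (x - y) (perp ν)| ≤ w → |inner ℝ (x - y) ν| ≤ 2 * k →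
      x ∈ Metric.ball y r := fun x hx1 hx2 => by
    refine mem_ball_of_inner hν hr0 hx1 hx2 ?_
    have : w ^ 2 + (2 * k) ^ 2 = ((1 - κ) ^ 2 + κ ^ 2 / 4) * r ^ 2 := by rw [hw, hk, hp]; ring
    rw [this]
    have h3 : (1 - κ) ^ 2 + κ ^ 2 / 4 < 1 := by nlinarith
    have h4 : 0 < r ^ 2 := by positivity
    nlinarith
  have hlam0 : ∀ x, x ∉ Metric.ball y r → lam x = 0 := fun x hx => by
    refine segmentFraction_eq_zero fun t ht hxR => hx ?_
    rw [hsm] at hxR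
    have h3 : t * (3 * k) ≤ 3 * k := mul_le_of_le_one_left (by positivity) ht.2
    have h4 : 0 ≤ t * (3 * k) := mul_nonneg ht.1 (by positivity)
    obtain ⟨hx1, hx2⟩ := hxR
    rw [inner_sub_smul_perp] at hx1
    rw [inner_sub_smul_self hν] at hx2
    exact hball x (abs_le.2 ⟨hx1.1.le, hx1.2.le⟩)
      (abs_le.2 ⟨by linarith [hx2.1], by linarith [hx2.2]⟩)
  have hlam3 : ∀ x, lam x ≤ 1 / 3 := fun x => by
    set s := inner ℝ (x - y) ν with hs
    have hle : lam x ≤ ∫ t in Set.Ioc (0 : ℝ) 1,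
        (Set.Ioo ((s + k) / (3 * k)) ((s + 2 * k) / (3 * k))).indicator (fun _ => (1 : ℝ)) t := by
      rw [hlam, segmentFraction, intervalIntegral.integral_of_le zero_le_one]
      refine setIntegral_mono
        ((intervalIntegrable_iff_integrableOn_Ioc_of_le zero_le_one).1
          (intervalIntegrable_indicator_segment hRm _ x))
        ((integrable_const _).indicator measurableSet_Ioo) fun t => ?_
      by_cases hxR : x - t • (3 * k) • ν ∈ R
      · have hxR' := hxR.2
        rw [hsm, inner_sub_smul_self hν] at hxR'
        have ht : t ∈ Set.Ioo ((s + k) / (3 * k)) ((s + 2 * k) / (3 * k)) := by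
          rw [Set.mem_Ioo, div_lt_iff₀ (by positivity), lt_div_iff₀ (by positivity)]
          exact ⟨by linarith [hxR'.2], by linarith [hxR'.1]⟩
        simp [hxR, ht]
      · rw [Set.indicator_of_notMem hxR]
        exact Set.indicator_nonneg (fun _ _ => zero_le_one) _
    refine hle.trans ((setIntegral_le_integral
      ((integrable_indicator_iff measurableSet_Ioo).2 (integrableOn_const (by simp)))
      (ae_of_all _ fun t => Set.indicator_nonneg (fun _ _ => zero_le_one) _)).trans ?_)
    rw [integral_indicator measurableSet_Ioo, setIntegral_const, smul_eq_mul, mul_one,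
      Real.volume_real_Ioo, max_le_iff]
    refine ⟨le_of_eq ?_, by norm_num⟩
    field_simp
    ring
  have hR1 : volume.real R = 2 * w * k := by
    rw [hR, volume_real_openRect hν y (by linarith) (by linarith)]
    ring
  have hlow1 : 2 * w * k - p * κ * r ^ 2 ≤ volume.real (Ω ∩ R) := by
    have h3 : volume.real R ≤ volume.real (Ω ∩ R) +
        volume.real (Ωᶜ ∩ Metric.ball y r ∩ {x | p * r ≤ inner ℝ (x - y) (-ν)}) := by
      refine (measureReal_mono (s₂ := (Ω ∩ R) ∪
        (Ωᶜ ∩ Metric.ball y r ∩ {x | p * r ≤ inner ℝ (x - y) (-ν)})) ?_ ?_).trans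
        (measureReal_union_le _ _)
      · intro x hx
        by_cases hxΩ : x ∈ Ω
        · exact Or.inl ⟨hxΩ, hx⟩
        · refine Or.inr ⟨⟨hxΩ, hball x (abs_le.2 ⟨hx.1.1.le, hx.1.2.le⟩)
            (abs_le.2 ⟨by linarith [hx.2.1], by linarith [hx.2.2]⟩)⟩, ?_⟩
          change p * r ≤ inner ℝ (x - y) (-ν)
          rw [inner_neg_right]
          linarith [hx.2.2]
      · refine measure_ne_top_of_subset (s := R ∪ Metric.ball y r) ?_ ?_
        · exact Set.union_subset_union Set.inter_subset_right
            (Set.inter_subset_left.trans Set.inter_subset_right)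
        · exact ((isBounded_openRect hν _ _ _ _ _).union Metric.isBounded_ball).measure_lt_top.ne
    rw [hR1] at h3
    linarith
  have hup1 : volume.real (Ω ∩ {x | x - (3 * k) • ν ∈ R}) ≤ p * κ * r ^ 2 := by
    refine (measureReal_mono ?_ ?_).trans h1
    · rintro x ⟨hxΩ, hx1, hx2⟩
      rw [inner_sub_smul_perp] at hx1
      rw [inner_sub_smul_self hν] at hx2
      refine ⟨⟨hxΩ, hball x (abs_le.2 ⟨hx1.1.le, hx1.2.le⟩)
        (abs_le.2 ⟨by linarith [hx2.1], by linarith [hx2.2]⟩)⟩, ?_⟩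
      change p * r ≤ inner ℝ (x - y) ν
      linarith [hx2.1]
    · exact measure_ne_top_of_subset (Set.inter_subset_left.trans Set.inter_subset_right)
        (volume_ball_ne_top y r)
  have hintg : ∫ x, lam x * inner ℝ ((3 * k) • ν) (σ x) ∂μ ≤ k * μ.real (Metric.ball y r) := by
    have e : k * μ.real (Metric.ball y r) = ∫ x, (Metric.ball y r).indicator (fun _ => k) x ∂μ := by
      rw [integral_indicator Metric.isOpen_ball.measurableSet, setIntegral_const, smul_eq_mul,
        mul_comm]
    rw [e]
    refine integral_mono_ae (h.integrable_mul_inner _ (measurable_segmentFraction hRm _) (c := 1)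
      fun x => ?_) ((integrable_const _).indicator Metric.isOpen_ball.measurableSet) ?_
    · rw [abs_of_nonneg (segmentFraction_nonneg _ _ _)]
      exact segmentFraction_le_one hRm _ _
    filter_upwards [h.norm_inner_le ν] with x hx
    rw [hν] at hx
    by_cases hxB : x ∈ Metric.ball y r
    · rw [Set.indicator_of_mem hxB, real_inner_smul_left]
      have h4 : 0 ≤ lam x := segmentFraction_nonneg _ _ _
      have h5 := hlam3 x
      have h6 : inner ℝ ν (σ x) ≤ 1 := (le_abs_self _).trans hx
      calc lam x * (3 * k * inner ℝ ν (σ x)) = (3 * k * lam x) * inner ℝ ν (σ x) := by ring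
        _ ≤ (3 * k * lam x) * 1 := mul_le_mul_of_nonneg_left h6 (by positivity)
        _ ≤ k := by nlinarith
    · rw [Set.indicator_of_notMem hxB, hlam0 x hxB, zero_mul]
  have hfinal : k * ((1 - 2 * κ) * (2 * r)) ≤ k * μ.real (Metric.ball y r) := by
    refine le_trans ?_ hintg
    refine le_trans ?_ (le_of_eq key)
    have : k * ((1 - 2 * κ) * (2 * r)) = 2 * w * k - p * κ * r ^ 2 - p * κ * r ^ 2 := by
      rw [hw, hk]; ring
    linarith
  exact le_of_mul_le_mul_left hfinal hk0

end DipolarDrop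
end

noncomputable section

namespace DipolarDrop

variable {Ω : Set Plane} {μ : Measure Plane} {σ : Plane → Plane} {y ν : Plane}

theorem inv_mul_measure_le_hausdorffMeasure {A : Set Plane} {C d₀ : ℝ} (hC : 0 < C) (hd₀ : 0 < d₀)
    (hA : ∀ y ∈ A, ∀ d ∈ Set.Ioo 0 d₀, ∀ E : Set Plane, y ∈ E →
      (∀ x ∈ E, ∀ x' ∈ E, dist x x' ≤ d) → μ E ≤ ENNReal.ofReal (C * d)) :
    (ENNReal.ofReal C)⁻¹ * μ A ≤ Measure.hausdorffMeasure 1 A := by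
  rw [Measure.hausdorffMeasure_apply]
  refine le_iSup₂_of_le (ENNReal.ofReal (d₀ / 2)) (by positivity) ?_
  refine le_iInf fun t => le_iInf fun hAt => le_iInf fun htr => ?_
  have h1 : μ A ≤ ∑' n, μ (A ∩ t n) := by
    refine (measure_mono ?_).trans (measure_iUnion_le _)
    rw [← Set.inter_iUnion]
    exact Set.subset_inter le_rfl hAt
  refine (mul_le_mul_right h1 _).trans ?_
  rw [← ENNReal.tsum_mul_left]
  refine ENNReal.tsum_le_tsum fun n => ?_
  rcases (A ∩ t n).eq_empty_or_nonempty with he | ⟨y, hyA, hyt⟩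
  · simp [he]
  · refine le_iSup_of_le ⟨y, hyt⟩ ?_
    rw [ENNReal.rpow_one]
    have hDt : Metric.ediam (t n) ≠ ∞ := ((htr n).trans_lt ENNReal.ofReal_lt_top).ne
    set D : ℝ := (Metric.ediam (t n)).toReal with hD
    have hDd : D ≤ d₀ / 2 := ENNReal.toReal_le_of_le_ofReal (by positivity) (htr n)
    have hD0 : 0 ≤ D := ENNReal.toReal_nonneg
    have hb : ∀ᶠ d in 𝓝[>] D, μ (A ∩ t n) ≤ ENNReal.ofReal (C * d) := by
      filter_upwards [Ioo_mem_nhdsGT (show D < d₀ by linarith)] with d hd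
      refine hA y hyA d ⟨hD0.trans_lt hd.1, hd.2⟩ _ ⟨hyA, hyt⟩ fun x hx x' hx' => ?_
      have h2 := Metric.edist_le_ediam_of_mem hx.2 hx'.2
      rw [edist_dist] at h2
      have h3 := (ENNReal.ofReal_le_iff_le_toReal hDt).1 h2
      exact h3.trans hd.1.le
    have hlim : Tendsto (fun d : ℝ => ENNReal.ofReal (C * d)) (𝓝[>] D)
        (𝓝 (ENNReal.ofReal (C * D))) :=
      ((ENNReal.continuous_ofReal.comp (continuous_const.mul continuous_id)).tendsto D).mono_left
        nhdsWithin_le_nhds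
    have h4 := ge_of_tendsto hlim hb
    rw [ENNReal.ofReal_mul hC.le, hD, ENNReal.ofReal_toReal hDt] at h4
    refine (mul_le_mul_right h4 _).trans ?_
    rw [← mul_assoc, ENNReal.inv_mul_cancel (by positivity) ENNReal.ofReal_ne_top, one_mul]

theorem IsGaussGreenPair.measure_le_hausdorffMeasure (h : IsGaussGreenPair Ω μ σ)
    (hΩ : MeasurableSet Ω) {A : Set Plane} (hA : ∀ y ∈ A, ∃ ν, IsNormalAt μ σ y ν) :
    μ A ≤ Measure.hausdorffMeasure 1 A := by
  have key : ∀ κ ∈ Set.Ioo (0 : ℝ) 1,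
      (ENNReal.ofReal (1 + 3 * κ))⁻¹ * μ A ≤ Measure.hausdorffMeasure 1 A := by
    intro κ hκ
    set B : ℕ → Set Plane := fun n => {y | y ∈ A ∧ ∀ d ∈ Set.Ioo 0 (1 / ((n : ℝ) + 1)),
      ∀ E : Set Plane, y ∈ E → (∀ x ∈ E, ∀ x' ∈ E, dist x x' ≤ d) →
        μ E ≤ ENNReal.ofReal ((1 + 3 * κ) * d)} with hB
    have hmono : Monotone B := by
      intro n k hnk y hy
      refine ⟨hy.1, fun d hd => hy.2 d ⟨hd.1, hd.2.trans_le ?_⟩⟩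
      exact Nat.one_div_le_one_div hnk
    have hU : A ⊆ ⋃ n, B n := by
      intro y hy
      obtain ⟨ν, hν⟩ := hA y hy
      obtain ⟨d₀, hd₀, hd⟩ := hν.exists_measure_le_diam h hΩ hκ.1 hκ.2.le
      obtain ⟨n, hn⟩ := exists_nat_one_div_lt hd₀
      exact Set.mem_iUnion.2 ⟨n, hy, fun d hd' => hd d ⟨hd'.1, hd'.2.trans hn⟩⟩
    refine (mul_le_mul_right (measure_mono hU) _).trans ?_
    rw [hmono.measure_iUnion, ENNReal.mul_iSup]
    refine iSup_le fun n => ?_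
    refine (inv_mul_measure_le_hausdorffMeasure (by linarith [hκ.1]) (Nat.one_div_pos_of_nat (n := n))
      fun y hy => hy.2).trans (measure_mono fun y hy => hy.1)
  have hlim : Tendsto (fun κ : ℝ => (ENNReal.ofReal (1 + 3 * κ))⁻¹ * μ A) (𝓝[>] 0)
      (𝓝 ((ENNReal.ofReal (1 + 3 * 0))⁻¹ * μ A)) := by
    refine ENNReal.Tendsto.mul_const ?_ (Or.inl (by simp))
    refine tendsto_inv_iff.2 ?_
    exact ((ENNReal.continuous_ofReal.comp (by fun_prop : Continuous fun κ : ℝ =>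
      1 + 3 * κ)).tendsto 0).mono_left nhdsWithin_le_nhds
  have := le_of_tendsto hlim (by
    filter_upwards [Ioo_mem_nhdsGT (zero_lt_one' ℝ)] with κ hκ using key κ hκ)
  simpa using this

theorem IsGaussGreenPair.hausdorffMeasure_le_measure (h : IsGaussGreenPair Ω μ σ)
    (hΩ : MeasurableSet Ω) {A : Set Plane} (hA : ∀ y ∈ A, ∃ ν, IsNormalAt μ σ y ν) :
    Measure.hausdorffMeasure 1 A ≤ μ A := by
  have hfin := h.finite
  have key : ∀ κ ∈ Set.Ioo (0 : ℝ) (1 / 2),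
      Measure.hausdorffMeasure 1 A ≤ ENNReal.ofReal (1 - 2 * κ)⁻¹ * μ A := by
    intro κ hκ
    have hκ0 : 0 < 1 - 2 * κ := by linarith [hκ.2]
    have hcov : ∀ n : ℕ, ∃ (t : Set Plane) (r : Plane → ℝ), t.Countable ∧ t ⊆ A ∧
        (∀ x ∈ t, r x ∈ {r : ℝ | (1 - 2 * κ) * (2 * r) ≤ μ.real (Metric.ball x r) ∧
          r ∈ Set.Ioo 0 (1 / ((n : ℝ) + 1))}) ∧
        (A ⊆ ⋃ x ∈ t, Metric.closedBall x (r x)) ∧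
        (∑' x : t, μ (Metric.closedBall (x : Plane) (r x))) ≤ μ A + ENNReal.ofReal (1 / ((n : ℝ) + 1)) := by
      intro n
      have hn := Nat.one_div_pos_of_nat (α := ℝ) (n := n)
      refine Besicovitch.exists_closedBall_covering_tsum_measure_le μ (by positivity)
        (fun x => {r : ℝ | (1 - 2 * κ) * (2 * r) ≤ μ.real (Metric.ball x r) ∧
          r ∈ Set.Ioo 0 (1 / ((n : ℝ) + 1))}) A fun x hx δ hδ => ?_
      obtain ⟨ν, hν⟩ := hA x hx
      obtain ⟨r, hr1, hr2, hr3⟩ := ((hν.eventually_measure_ball_ge h hΩ hκ.1 (by linarith [hκ.2])).and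
        (inter_mem (Ioo_mem_nhdsGT hn) (Ioo_mem_nhdsGT hδ))).exists
      exact ⟨r, ⟨hr1, hr2⟩, hr3⟩
    choose t r htc htA hr hcover hsum using hcov
    have : ∀ n, Countable (t n) := fun n => (htc n).to_subtype
    have hz : Tendsto (fun n : ℕ => ENNReal.ofReal (1 / ((n : ℝ) + 1))) atTop (𝓝 0) := by
      have := (ENNReal.continuous_ofReal.tendsto 0).comp
        (tendsto_one_div_add_atTop_nhds_zero_nat (𝕜 := ℝ))
      simpa [Function.comp_def] using this
    have hediam : ∀ n (x : t n), Metric.ediam (Metric.closedBall (x : Plane) (r n x)) ≤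
        ENNReal.ofReal (2 * r n x) := by
      intro n x
      refine Metric.ediam_le_of_forall_dist_le fun a ha b hb => ?_
      have h1 := Metric.mem_closedBall.1 ha
      have h2 := Metric.mem_closedBall'.1 hb
      linarith [dist_triangle a x b]
    have hle := Measure.hausdorffMeasure_le_liminf_tsum (ι := fun n => t n) 1 A
      (l := atTop) (fun n : ℕ => 2 * ENNReal.ofReal (1 / ((n : ℝ) + 1)))
      (by simpa using ENNReal.Tendsto.const_mul hz (Or.inr (by simp)))
      (fun n (x : t n) => Metric.closedBall (x : Plane) (r n x))
      (Eventually.of_forall fun n x => (hediam n x).trans (by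
        rw [ENNReal.ofReal_mul (by norm_num)]
        simp only [ENNReal.ofReal_ofNat]
        gcongr
        exact (hr n x x.2).2.2.le))
      (Eventually.of_forall fun n => by
        have := hcover n
        rwa [Set.biUnion_eq_iUnion] at this)
    refine hle.trans ?_
    have hlim : Tendsto (fun n : ℕ => ENNReal.ofReal (1 - 2 * κ)⁻¹ *
        (μ A + ENNReal.ofReal (1 / ((n : ℝ) + 1)))) atTop
        (𝓝 (ENNReal.ofReal (1 - 2 * κ)⁻¹ * (μ A + 0))) :=
      ENNReal.Tendsto.const_mul (tendsto_const_nhds.add hz) (Or.inr ENNReal.ofReal_ne_top)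
    rw [add_zero] at hlim
    rw [← hlim.liminf_eq]
    refine liminf_le_liminf (Eventually.of_forall fun n => ?_)
    refine le_trans ?_ (mul_le_mul_right (hsum n) _)
    rw [← ENNReal.tsum_mul_left]
    refine ENNReal.tsum_le_tsum fun x => ?_
    rw [ENNReal.rpow_one]
    refine (hediam n x).trans ?_
    have h1 := (hr n x x.2).1
    have h2 : μ.real (Metric.ball (x : Plane) (r n x)) ≤
        μ.real (Metric.closedBall (x : Plane) (r n x)) :=
      measureReal_mono Metric.ball_subset_closedBall
    rw [← ofReal_measureReal, ← ENNReal.ofReal_mul (by positivity)]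
    refine ENNReal.ofReal_le_ofReal ?_
    rw [inv_mul_eq_div, le_div_iff₀ hκ0]
    linarith
  have hlim : Tendsto (fun κ : ℝ => ENNReal.ofReal (1 - 2 * κ)⁻¹ * μ A) (𝓝[>] 0)
      (𝓝 (ENNReal.ofReal (1 - 2 * 0)⁻¹ * μ A)) := by
    refine ENNReal.Tendsto.mul_const ?_ (Or.inr (measure_ne_top _ _))
    refine (ENNReal.continuous_ofReal.tendsto _).comp (Tendsto.mono_left ?_ nhdsWithin_le_nhds)
    refine Tendsto.inv₀ ?_ (by norm_num)
    exact (by fun_prop : Continuous fun κ : ℝ => 1 - 2 * κ).tendsto 0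
  have := ge_of_tendsto hlim (by
    filter_upwards [Ioo_mem_nhdsGT (one_half_pos (α := ℝ))] with κ hκ using key κ hκ)
  simpa using this

theorem IsGaussGreenPair.mem_reducedBoundary_iff (h : IsGaussGreenPair Ω μ σ) :
    y ∈ reducedBoundary Ω ↔ ∃ ν, IsNormalAt μ σ y ν :=
  ⟨fun ⟨ν, hν⟩ => ⟨ν, hν.isNormalAt h⟩, fun ⟨ν, hν⟩ => ⟨ν, hν.hasOuterNormal h⟩⟩

theorem IsGaussGreenPair.hausdorffMeasure_restrict_reducedBoundary (h : IsGaussGreenPair Ω μ σ)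
    (hΩ : MeasurableSet Ω) :
    (Measure.hausdorffMeasure 1).restrict (reducedBoundary Ω) = μ := by
  ext t ht
  have hA : ∀ y ∈ t ∩ reducedBoundary Ω, ∃ ν, IsNormalAt μ σ y ν :=
    fun y hy => h.mem_reducedBoundary_iff.1 hy.2
  rw [Measure.restrict_apply ht, le_antisymm (h.hausdorffMeasure_le_measure hΩ hA)
    (h.measure_le_hausdorffMeasure hΩ hA)]
  refine measure_congr ?_
  filter_upwards [h.ae_isNormalAt] with y hy
  exact propext ⟨fun hh => hh.1, fun hh => ⟨hh, h.mem_reducedBoundary_iff.2 ⟨_, hy⟩⟩⟩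

theorem IsGaussGreenPair.outerNormal_ae_eq (h : IsGaussGreenPair Ω μ σ) :
    ∀ᵐ y ∂μ, outerNormal Ω y = σ y := by
  filter_upwards [h.ae_isNormalAt] with y hy using hy.outerNormal_eq h

end DipolarDrop

end

noncomputable section

namespace DipolarDrop

variable {Ω : Set Plane} {μ : Measure Plane} {σ : Plane → Plane} {y ν : Plane}

/-- The `L¹`-distance `∫ |χ_Ω(x + z) - χ_Ω(x)| dx` between `Ω` and its translate by `-z`. -/
def translationDefect (Ω : Set Plane) (z : Plane) : ℝ := ∫ x, |charFn Ω (x + z) - charFn Ω x|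

/-- The directional variation `∫ |z · σ| dμ`. -/
def directionalVariation (μ : Measure Plane) (σ : Plane → Plane) (z : Plane) : ℝ :=
  ∫ y, |inner ℝ z (σ y)| ∂μ

theorem translationDefect_nonneg (Ω : Set Plane) (z : Plane) : 0 ≤ translationDefect Ω z :=
  integral_nonneg fun _ => abs_nonneg _

theorem measurable_translationDefect (hΩ : MeasurableSet Ω) : Measurable (translationDefect Ω) := by
  have hm := measurable_charFn hΩ
  refine (StronglyMeasurable.integral_prod_right' (f := fun p : Plane × Plane =>
    |charFn Ω (p.2 + p.1) - charFn Ω p.2|) ?_).measurable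
  exact Measurable.stronglyMeasurable (by fun_prop)

theorem integral_charFn (hΩ : MeasurableSet Ω) : ∫ x, charFn Ω x = volume.real Ω := by
  have := integral_indicator_one (μ := volume) hΩ
  exact this

theorem integral_charFn_mul_translate (hΩ : MeasurableSet Ω) (hv : volume Ω ≠ ∞) (z : Plane) :
    ∫ x, charFn Ω x * charFn Ω (x + z) = volume.real Ω - translationDefect Ω z / 2 := by
  have hi := integrable_charFn hΩ hv
  have hi2 := hi.comp_add_right z
  have hi3 := (integrable_charFn_sub hΩ hv z).abs
  have e : (fun x => charFn Ω x * charFn Ω (x + z)) = fun x =>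
      2⁻¹ * (charFn Ω x + charFn Ω (x + z) - |charFn Ω (x + z) - charFn Ω x|) := by
    ext x
    by_cases h1 : x ∈ Ω <;> by_cases h2 : x + z ∈ Ω <;>
      (simp [charFn, h1, h2]; try norm_num)
  have hi4 : Integrable fun x => charFn Ω x + charFn Ω (x + z) := hi.add hi2
  rw [e, integral_const_mul, integral_sub hi4 hi3, integral_add hi hi2,
    integral_add_right_eq_self (charFn Ω) z, integral_charFn hΩ, translationDefect]
  ring

theorem translationDefect_le (hΩ : MeasurableSet Ω) (hv : volume Ω ≠ ∞) (z : Plane) :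
    translationDefect Ω z ≤ 2 * volume.real Ω := by
  have h1 := integral_charFn_mul_translate hΩ hv z
  have h2 : 0 ≤ ∫ x, charFn Ω x * charFn Ω (x + z) :=
    integral_nonneg fun x => mul_nonneg (charFn_nonneg _ _) (charFn_nonneg _ _)
  linarith

theorem directionalVariation_nonneg (μ : Measure Plane) (σ : Plane → Plane) (z : Plane) :
    0 ≤ directionalVariation μ σ z :=
  integral_nonneg fun _ => abs_nonneg _

theorem directionalVariation_smul (μ : Measure Plane) (σ : Plane → Plane) (t : ℝ) (z : Plane) :
    directionalVariation μ σ (t • z) = |t| * directionalVariation μ σ z := by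
  simp_rw [directionalVariation, real_inner_smul_left, abs_mul, integral_const_mul]

namespace IsGaussGreenPair

theorem measurable_directionalVariation (h : IsGaussGreenPair Ω μ σ) :
    Measurable (directionalVariation μ σ) := by
  have := h.finite
  have hm := h.measurable
  refine (StronglyMeasurable.integral_prod_right' (f := fun p : Plane × Plane =>
    |inner ℝ p.1 (σ p.2)|) ?_).measurable
  exact Measurable.stronglyMeasurable (by fun_prop)

theorem directionalVariation_le (h : IsGaussGreenPair Ω μ σ) (z : Plane) :
    directionalVariation μ σ z ≤ ‖z‖ * μ.real Set.univ := by
  have := h.finite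
  have h1 := integral_mono_ae (h.integrable_inner z).abs (integrable_const ‖z‖) (h.norm_inner_le z)
  rw [integral_const, smul_eq_mul, mul_comm] at h1
  exact h1

theorem translationDefect_le_directionalVariation (h : IsGaussGreenPair Ω μ σ)
    (hΩ : MeasurableSet Ω) (hv : volume Ω ≠ ∞) (z : Plane) :
    translationDefect Ω z ≤ directionalVariation μ σ z := by
  refine le_of_forall_pos_le_add fun ε hε => ?_
  obtain ⟨φ, h1, h2, h3, h4⟩ := exists_testField_integral_inner_ge volume
    (integrable_charFn_sub hΩ hv z) hε
  have e1 : ∫ x, inner ℝ (φ x) (charFn Ω (x + z) - charFn Ω x) =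
      - ∫ t in (0 : ℝ)..1, ∫ y, φ (y - t • z) * inner ℝ z (σ y) ∂μ := by
    rw [← h.setIntegral_sub_translate h1.continuous h2,
      ← integral_mul_charFn_translate_sub hΩ h1.continuous h2 z]
    refine integral_congr_ae (ae_of_all _ fun x => ?_)
    simp [mul_comm]
  have h5 : -(∫ t in (0 : ℝ)..1, ∫ y, φ (y - t • z) * inner ℝ z (σ y) ∂μ) ≤
      directionalVariation μ σ z := by
    have h6 : ‖∫ t in (0 : ℝ)..1, ∫ y, φ (y - t • z) * inner ℝ z (σ y) ∂μ‖ ≤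
        directionalVariation μ σ z * |1 - 0| := by
      refine intervalIntegral.norm_integral_le_of_norm_le_const fun t _ => ?_
      refine norm_integral_le_of_norm_le (h.integrable_inner z).abs (ae_of_all _ fun y => ?_)
      rw [norm_mul]
      exact mul_le_of_le_one_left (norm_nonneg _) (h3 _)
    rw [sub_zero, abs_one, mul_one, Real.norm_eq_abs] at h6
    exact (neg_le_abs _).trans h6
  simp only [Real.norm_eq_abs] at h4
  rw [translationDefect]
  linarith

theorem tendsto_translationDefect_smul (h : IsGaussGreenPair Ω μ σ)
    (hΩ : MeasurableSet Ω) (hv : volume Ω ≠ ∞) (z : Plane) :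
    Tendsto (fun t : ℝ => t⁻¹ * translationDefect Ω (t • z)) (𝓝[>] 0)
      (𝓝 (directionalVariation μ σ z)) := by
  refine tendsto_order.2 ⟨fun a ha => ?_, fun a ha => ?_⟩
  · set ε : ℝ := (directionalVariation μ σ z - a) / 3 with hε
    have hε0 : 0 < ε := by rw [hε]; linarith
    obtain ⟨φ, h1, h2, h3, h4⟩ := exists_testField_integral_inner_ge μ (h.integrable_inner z) hε0
    have hc := h.continuous_integral_translate h1.continuous h2 z
    have hc0 : Tendsto (fun s : ℝ => ∫ y, φ (y - s • z) * inner ℝ z (σ y) ∂μ) (𝓝 0)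
        (𝓝 (∫ y, φ (y - (0 : ℝ) • z) * inner ℝ z (σ y) ∂μ)) :=
      (hc.comp (by fun_prop : Continuous fun s : ℝ => s • z)).tendsto 0
    have h5 : directionalVariation μ σ z - ε ≤ ∫ y, φ (y - (0 : ℝ) • z) * inner ℝ z (σ y) ∂μ := by
      refine (h4.trans (le_of_eq ?_))
      refine integral_congr_ae (ae_of_all _ fun x => ?_)
      simp [mul_comm]
    obtain ⟨r, hr, hr'⟩ := Metric.eventually_nhds_iff.1
      (hc0.eventually (lt_mem_nhds (show directionalVariation μ σ z - 2 * ε < _ by linarith)))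
    filter_upwards [Ioo_mem_nhdsGT hr] with t ht
    have ht0 : 0 < t := ht.1
    have h6 : ∫ x, φ x * (charFn Ω (x + t • z) - charFn Ω x) = -(t * ∫ s in (0 : ℝ)..1,
        ∫ y, φ (y - (s * t) • z) * inner ℝ z (σ y) ∂μ) := by
      rw [integral_mul_charFn_translate_sub hΩ h1.continuous h2,
        h.setIntegral_sub_translate h1.continuous h2, ← intervalIntegral.integral_const_mul]
      congr 1
      refine intervalIntegral.integral_congr fun s _ => ?_
      rw [← integral_const_mul]
      refine integral_congr_ae (ae_of_all _ fun x => ?_)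
      simp only [smul_smul, real_inner_smul_left]
      ring
    have h7 : directionalVariation μ σ z - 2 * ε ≤ ∫ s in (0 : ℝ)..1,
        ∫ y, φ (y - (s * t) • z) * inner ℝ z (σ y) ∂μ := by
      have := intervalIntegral.integral_mono_on (zero_le_one' ℝ)
        (intervalIntegrable_const (c := directionalVariation μ σ z - 2 * ε) (μ := volume))
        ((hc.comp (by fun_prop : Continuous fun s : ℝ => (s * t) • z)).intervalIntegrable 0 1)
        fun s hs => (hr' (y := s * t) (by
          rw [dist_zero_right, Real.norm_of_nonneg (mul_nonneg hs.1 ht0.le)]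
          exact (mul_le_of_le_one_left ht0.le hs.2).trans_lt ht.2)).le
      simpa using this
    have h8 : -∫ x, φ x * (charFn Ω (x + t • z) - charFn Ω x) ≤ translationDefect Ω (t • z) := by
      refine (neg_le_abs _).trans ?_
      rw [translationDefect, ← Real.norm_eq_abs]
      refine norm_integral_le_of_norm_le (integrable_charFn_sub hΩ hv (t • z)).abs
        (ae_of_all _ fun y => ?_)
      rw [norm_mul]
      exact mul_le_of_le_one_left (norm_nonneg _) (h3 _)
    rw [h6, neg_neg] at h8
    rw [← div_eq_inv_mul, lt_div_iff₀ ht0]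
    nlinarith
  · filter_upwards [self_mem_nhdsWithin] with t ht
    have ht0 : 0 < t := ht
    refine lt_of_le_of_lt ?_ ha
    rw [← div_eq_inv_mul, div_le_iff₀ ht0, mul_comm]
    have := h.translationDefect_le_directionalVariation hΩ hv (t • z)
    rwa [directionalVariation_smul, abs_of_pos ht0] at this

end IsGaussGreenPair

theorem integral_abs_sin : ∫ θ in (-Real.pi)..Real.pi, |Real.sin θ| = 4 := by
  have hi : ∀ a b : ℝ, IntervalIntegrable (fun θ => |Real.sin θ|) volume a b := fun a b =>
    (Real.continuous_sin.abs).intervalIntegrable a b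
  have h1 : ∫ θ in (-Real.pi)..0, |Real.sin θ| = 2 := by
    rw [intervalIntegral.integral_congr (g := fun θ => - Real.sin θ)]
    · simp
      norm_num
    · intro θ hθ
      rw [Set.uIcc_of_le (by linarith [Real.pi_pos])] at hθ
      exact abs_of_nonpos (Real.sin_nonpos_of_nonpos_of_neg_pi_le hθ.2 hθ.1)
  have h2 : ∫ θ in (0)..Real.pi, |Real.sin θ| = 2 := by
    rw [intervalIntegral.integral_congr (g := fun θ => Real.sin θ)]
    · simp
      norm_num
    · intro θ hθ
      rw [Set.uIcc_of_le Real.pi_pos.le] at hθ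
      exact abs_of_nonneg (Real.sin_nonneg_of_nonneg_of_le_pi hθ.1 hθ.2)
  rw [← intervalIntegral.integral_add_adjacent_intervals (hi _ 0) (hi 0 _), h1, h2]
  norm_num

/-- Integration in polar coordinates of `|z · ν|` against a radial function. -/
theorem integral_abs_inner_mul_radial (hν : ‖ν‖ = 1) {q : ℝ → ℝ}
    (hq : Measurable q) :
    ∫ z : Plane, |inner ℝ z ν| * q ‖z‖ = 4 * ∫ r in Set.Ioi 0, r ^ 2 * q r := by
  have e1 : ∀ z : Plane, ‖z‖ = √((inner ℝ z (perp ν)) ^ 2 + (inner ℝ z ν) ^ 2) := fun z => by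
    rw [inner_sq_add_inner_sq hν, Real.sqrt_sq (norm_nonneg z)]
  have e2 : ∫ z : Plane, |inner ℝ z ν| * q ‖z‖ =
      ∫ p : ℝ × ℝ, |p.2| * q √(p.1 ^ 2 + p.2 ^ 2) := by
    simp_rw [e1]
    have hp := measurePreserving_coords hν
    rw [← hp.map_eq, integral_map hp.measurable.aemeasurable]
    exact Measurable.aestronglyMeasurable (by fun_prop)
  rw [e2, ← integral_comp_polarCoord_symm]
  have e3 : ∀ p ∈ polarCoord.target, p.1 • (|(polarCoord.symm p).2| *
      q √((polarCoord.symm p).1 ^ 2 + (polarCoord.symm p).2 ^ 2)) =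
      (p.1 ^ 2 * q p.1) * |Real.sin p.2| := by
    intro p hp
    have hp0 : 0 < p.1 := hp.1
    simp only [polarCoord_symm_apply, smul_eq_mul]
    rw [show (p.1 * Real.cos p.2) ^ 2 + (p.1 * Real.sin p.2) ^ 2 = p.1 ^ 2 by
      rw [mul_pow, mul_pow, ← mul_add, Real.cos_sq_add_sin_sq, mul_one], Real.sqrt_sq hp0.le,
      abs_mul, abs_of_pos hp0]
    ring
  rw [setIntegral_congr_fun polarCoord.open_target.measurableSet e3, polarCoord_target,
    Measure.volume_eq_prod, setIntegral_prod_mul (fun r : ℝ => r ^ 2 * q r) fun θ => |Real.sin θ|,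
    ← integral_Ioc_eq_integral_Ioo, ← intervalIntegral.integral_of_le (by linarith [Real.pi_pos]),
    integral_abs_sin]
  ring

end DipolarDrop

end

noncomputable section

namespace DipolarDrop

variable {Ω : Set Plane} {μ : Measure Plane} {σ : Plane → Plane} {y ν : Plane}

theorem tendsto_lintegral_of_le_of_tendsto {α ι : Type*} [MeasurableSpace α] {m : Measure α}
    {l : Filter ι} [l.IsCountablyGenerated] {F : ι → α → ℝ≥0∞} {f : α → ℝ≥0∞}
    (hF : ∀ i, Measurable (F i)) (hle : ∀ i, ∀ᵐ x ∂m, F i x ≤ f x)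
    (hlim : ∀ᵐ x ∂m, Tendsto (fun i => F i x) l (𝓝 (f x))) :
    Tendsto (fun i => ∫⁻ x, F i x ∂m) l (𝓝 (∫⁻ x, f x ∂m)) := by
  refine tendsto_of_seq_tendsto fun u hu => ?_
  refine tendsto_of_le_liminf_of_limsup_le ?_ ?_
  · refine le_trans (le_of_eq ?_) (lintegral_liminf_le fun n => hF (u n))
    refine lintegral_congr_ae ?_
    filter_upwards [hlim] with x hx
    exact ((hx.comp hu).liminf_eq).symm
  · refine limsup_le_of_le (by isBoundedDefault) (Eventually.of_forall fun n => ?_)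
    exact lintegral_mono_ae (hle (u n))

/-- The kernel `χ_{|z| > δ} / |z|³`. -/
def truncatedKernel (δ : ℝ) (z : Plane) : ℝ := cutoff (‖z‖ / δ) / ‖z‖ ^ 3

theorem truncatedKernel_of_lt {δ : ℝ} (hδ : 0 < δ) {z : Plane} (hz : δ < ‖z‖) :
    truncatedKernel δ z = 1 / ‖z‖ ^ 3 := by
  have : ‖z‖ / δ ∈ Set.Ioi (1 : ℝ) := (one_lt_div hδ).2 hz
  rw [truncatedKernel, cutoff, Set.indicator_of_mem this]

theorem truncatedKernel_of_le {δ : ℝ} (hδ : 0 < δ) {z : Plane} (hz : ‖z‖ ≤ δ) :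
    truncatedKernel δ z = 0 := by
  have : ‖z‖ / δ ∉ Set.Ioi (1 : ℝ) := not_lt.2 ((div_le_one hδ).2 hz)
  rw [truncatedKernel, cutoff, Set.indicator_of_notMem this, zero_div]

theorem truncatedKernel_nonneg (δ : ℝ) (z : Plane) : 0 ≤ truncatedKernel δ z :=
  div_nonneg (Set.indicator_nonneg (fun _ _ => zero_le_one) _) (by positivity)

theorem measurable_truncatedKernel (δ : ℝ) : Measurable (truncatedKernel δ) := by
  have : Measurable cutoff := measurable_const.indicator measurableSet_Ioi
  unfold truncatedKernel
  fun_prop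

theorem integrable_truncatedKernel {δ : ℝ} (hδ : 0 < δ) : Integrable (truncatedKernel δ) := by
  have h1 : Integrable (fun z : Plane => (1 + δ⁻¹) ^ 3 * (1 + ‖z‖) ^ (-(3 : ℝ))) :=
    (integrable_one_add_norm (by simp; norm_num)).const_mul _
  refine h1.mono' (measurable_truncatedKernel δ).aestronglyMeasurable (ae_of_all _ fun z => ?_)
  rw [Real.norm_of_nonneg (truncatedKernel_nonneg _ _)]
  rcases le_or_gt ‖z‖ δ with hz | hz
  · rw [truncatedKernel_of_le hδ hz]
    positivity
  · have hz0 : 0 < ‖z‖ := hδ.trans hz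
    rw [truncatedKernel_of_lt hδ hz, Real.rpow_neg (by positivity), ← div_eq_mul_inv,
      div_le_div_iff₀ (by positivity) (by positivity)]
    have e : (1 + ‖z‖) ^ (3 : ℝ) = (1 + ‖z‖) ^ 3 := by
      rw [← Real.rpow_natCast]; norm_num
    rw [e, one_mul, ← mul_pow]
    refine pow_le_pow_left₀ (by positivity) ?_ 3
    have : 1 ≤ δ⁻¹ * ‖z‖ := by rw [inv_mul_eq_div, one_le_div hδ]; exact hz.le
    linarith

theorem integrable_translationDefect_mul_truncatedKernel (hΩ : MeasurableSet Ω)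
    (hv : volume Ω ≠ ∞) {δ : ℝ} (hδ : 0 < δ) :
    Integrable fun z => translationDefect Ω z * truncatedKernel δ z :=
  (integrable_truncatedKernel hδ).bdd_mul (measurable_translationDefect hΩ).aestronglyMeasurable
    (ae_of_all _ fun z => by
      rw [Real.norm_of_nonneg (translationDefect_nonneg _ _)]
      exact translationDefect_le hΩ hv z)

theorem integral_integral_charFn_sq (hΩ : MeasurableSet Ω) (hv : volume Ω ≠ ∞) {δ : ℝ}
    (hδ : 0 < δ) :
    ∫ x : Plane, ∫ z : Plane,
      |charFn Ω (x + z) - charFn Ω x| ^ 2 * (cutoff (‖z‖ / δ) / ‖z‖ ^ 3) =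
    ∫ z, translationDefect Ω z * truncatedKernel δ z := by
  have hm := measurable_charFn hΩ
  have hk := measurable_truncatedKernel δ
  have e : ∀ x z : Plane, |charFn Ω (x + z) - charFn Ω x| ^ 2 * (cutoff (‖z‖ / δ) / ‖z‖ ^ 3) =
      |charFn Ω (x + z) - charFn Ω x| * truncatedKernel δ z := by
    intro x z
    rw [truncatedKernel]
    congr 1
    by_cases h1 : x ∈ Ω <;> by_cases h2 : x + z ∈ Ω <;> simp [charFn, h1, h2]
  simp_rw [e]
  rw [integral_integral_swap]
  · refine integral_congr_ae (ae_of_all _ fun z => ?_)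
    simp only [translationDefect, integral_mul_const]
  · refine (integrable_prod_iff' (Measurable.aestronglyMeasurable (by fun_prop))).2 ⟨?_, ?_⟩
    · exact ae_of_all _ fun z =>
        (integrable_charFn_sub hΩ hv z).abs.mul_const (truncatedKernel δ z)
    · refine (integrable_translationDefect_mul_truncatedKernel hΩ hv hδ).congr
        (ae_of_all _ fun z => ?_)
      simp only [Function.uncurry, norm_mul, Real.norm_eq_abs, abs_abs, integral_mul_const,
        translationDefect, abs_of_nonneg (truncatedKernel_nonneg δ z)]

theorem scaledEnergy_eq (hΩ : MeasurableSet Ω) (hv : volume Ω ≠ ∞) {δ : ℝ}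
    (hδ : δ ∈ Set.Ioo (0 : ℝ) 1) :
    scaledEnergy δ Ω = |Real.log δ| * (perimeter Ω).toReal -
      4⁻¹ * ∫ z, translationDefect Ω z * truncatedKernel δ z := by
  have hl : |Real.log δ| ≠ 0 := abs_ne_zero.2 (Real.log_neg hδ.1 hδ.2).ne
  rw [scaledEnergy, energy, integral_integral_charFn_sq hΩ hv hδ.1]
  field_simp

theorem IsGaussGreenPair.integral_directionalVariation_mul_radial (h : IsGaussGreenPair Ω μ σ)
    {q : ℝ → ℝ} (hq : Measurable q) (hi : Integrable fun z : Plane => ‖z‖ * q ‖z‖) :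
    ∫ z, directionalVariation μ σ z * q ‖z‖ =
      4 * μ.real Set.univ * ∫ r in Set.Ioi 0, r ^ 2 * q r := by
  have hfin := h.finite
  have hm := h.measurable
  have e : ∀ z, directionalVariation μ σ z * q ‖z‖ = ∫ y, |inner ℝ z (σ y)| * q ‖z‖ ∂μ :=
    fun z => by rw [directionalVariation, integral_mul_const]
  simp_rw [e]
  rw [integral_integral_swap]
  · rw [integral_congr_ae (g := fun _ => 4 * ∫ r in Set.Ioi 0, r ^ 2 * q r)]
    · rw [integral_const, smul_eq_mul]
      ring
    · filter_upwards [h.unit] with y hy using integral_abs_inner_mul_radial hy hq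
  · refine (hi.mul_prod (integrable_const (1 : ℝ) (μ := μ))).mono
      (Measurable.aestronglyMeasurable (by fun_prop)) ?_
    have hu : ∀ᵐ p ∂(volume : Measure Plane).prod μ, ‖σ p.2‖ = 1 :=
      Measure.quasiMeasurePreserving_snd.ae h.unit
    filter_upwards [hu] with p hp
    simp only [Function.uncurry, mul_one, Real.norm_eq_abs]
    rw [abs_mul, abs_mul, abs_abs, abs_norm]
    refine mul_le_mul_of_nonneg_right ?_ (abs_nonneg _)
    simpa [hp] using abs_real_inner_le_norm p.1 (σ p.2)

/-- The density `(V(z) - g(z)) / (4 |z|³)` measuring how much the translation defect `g` falls short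
of the directional variation `V`. -/
def defectDensity (Ω : Set Plane) (μ : Measure Plane) (σ : Plane → Plane) (z : Plane) : ℝ :=
  (directionalVariation μ σ z - translationDefect Ω z) / (4 * ‖z‖ ^ 3)

/-- The contribution `¼ ∫_{|z| ≥ 1} g(z) / |z|³ dz` of long translations. -/
def farDefect (Ω : Set Plane) : ℝ :=
  ∫ z in (Metric.ball (0 : Plane) 1)ᶜ, translationDefect Ω z / (4 * ‖z‖ ^ 3)

/-- The annulus `δ < |z| < 1`. -/
def annulus (δ : ℝ) : Set Plane := {z | δ < ‖z‖ ∧ ‖z‖ < 1}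

theorem measurableSet_annulus (δ : ℝ) : MeasurableSet (annulus δ) :=
  (measurableSet_lt measurable_const measurable_norm).inter
    (measurableSet_lt measurable_norm measurable_const)

theorem annulus_subset_ball (δ : ℝ) : annulus δ ⊆ Metric.ball 0 1 := fun z hz => by
  simpa using hz.2

namespace IsGaussGreenPair

theorem defectDensity_nonneg (h : IsGaussGreenPair Ω μ σ) (hΩ : MeasurableSet Ω)
    (hv : volume Ω ≠ ∞) (z : Plane) : 0 ≤ defectDensity Ω μ σ z :=
  div_nonneg (sub_nonneg.2 (h.translationDefect_le_directionalVariation hΩ hv z)) (by positivity)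

theorem measurable_defectDensity (h : IsGaussGreenPair Ω μ σ) (hΩ : MeasurableSet Ω) :
    Measurable (defectDensity Ω μ σ) := by
  have h1 := h.measurable_directionalVariation
  have h2 := measurable_translationDefect hΩ
  unfold defectDensity
  fun_prop

theorem integrableOn_directionalVariation_annulus (h : IsGaussGreenPair Ω μ σ) {δ : ℝ}
    (hδ : 0 < δ) :
    IntegrableOn (fun z => directionalVariation μ σ z / (4 * ‖z‖ ^ 3)) (annulus δ) := by
  have h1 := h.measurable_directionalVariation
  refine Measure.integrableOn_of_bounded (M := μ.real Set.univ / (4 * δ ^ 3))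
    (measure_ne_top_of_subset (annulus_subset_ball δ) (volume_ball_ne_top _ _))
    (Measurable.aestronglyMeasurable (by fun_prop)) ?_
  refine (ae_restrict_iff' (measurableSet_annulus δ)).2 (ae_of_all _ fun z hz => ?_)
  rw [Real.norm_of_nonneg (div_nonneg (directionalVariation_nonneg _ _ _) (by positivity))]
  refine div_le_div₀ measureReal_nonneg ?_ (by positivity) ?_
  · exact (h.directionalVariation_le z).trans (mul_le_of_le_one_left measureReal_nonneg hz.2.le)
  · gcongr
    exact hz.1.le

theorem setIntegral_directionalVariation_annulus (h : IsGaussGreenPair Ω μ σ) {δ : ℝ}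
    (hδ : δ ∈ Set.Ioo (0 : ℝ) 1) :
    ∫ z in annulus δ, directionalVariation μ σ z / (4 * ‖z‖ ^ 3) =
      |Real.log δ| * μ.real Set.univ := by
  set q : ℝ → ℝ := (Set.Ioo δ 1).indicator fun r => (4 * r ^ 3)⁻¹ with hq
  have hqm : Measurable q := Measurable.indicator (by fun_prop) measurableSet_Ioo
  have e : ∀ z : Plane, (annulus δ).indicator
      (fun z => directionalVariation μ σ z / (4 * ‖z‖ ^ 3)) z =
      directionalVariation μ σ z * q ‖z‖ := by
    intro z
    by_cases hz : z ∈ annulus δ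
    · have : ‖z‖ ∈ Set.Ioo δ 1 := hz
      rw [Set.indicator_of_mem hz, hq, Set.indicator_of_mem this, div_eq_mul_inv]
    · have : ‖z‖ ∉ Set.Ioo δ 1 := hz
      rw [Set.indicator_of_notMem hz, hq, Set.indicator_of_notMem this, mul_zero]
  have hi : Integrable fun z : Plane => ‖z‖ * q ‖z‖ := by
    have h0 : Integrable ((annulus δ).indicator fun _ : Plane => (4 * δ ^ 3)⁻¹) :=
      (integrable_indicator_iff (measurableSet_annulus δ)).2 (integrableOn_const
        (measure_ne_top_of_subset (annulus_subset_ball δ) (volume_ball_ne_top _ _)))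
    refine h0.mono' (Measurable.aestronglyMeasurable (by fun_prop)) (ae_of_all _ fun z => ?_)
    by_cases hz : z ∈ annulus δ
    · have hz' : ‖z‖ ∈ Set.Ioo δ 1 := hz
      have hz0 : 0 < ‖z‖ := hδ.1.trans hz.1
      rw [Set.indicator_of_mem hz, hq, Set.indicator_of_mem hz',
        Real.norm_of_nonneg (by positivity)]
      have hδ0 := hδ.1
      refine (mul_le_of_le_one_left (by positivity) hz.2.le).trans ?_
      gcongr
      exact hz.1.le
    · have hz' : ‖z‖ ∉ Set.Ioo δ 1 := hz
      rw [Set.indicator_of_notMem hz, hq, Set.indicator_of_notMem hz']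
      simp
  rw [← integral_indicator (measurableSet_annulus δ)]
  simp_rw [e]
  rw [h.integral_directionalVariation_mul_radial hqm hi]
  have e2 : ∀ r : ℝ, r ^ 2 * q r = (Set.Ioo δ 1).indicator (fun r => 4⁻¹ * r⁻¹) r := by
    intro r
    by_cases hr : r ∈ Set.Ioo δ 1
    · have hr0 : r ≠ 0 := (hδ.1.trans hr.1).ne'
      rw [hq, Set.indicator_of_mem hr, Set.indicator_of_mem hr]
      field_simp
    · rw [hq, Set.indicator_of_notMem hr, Set.indicator_of_notMem hr, mul_zero]
  simp_rw [e2]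
  rw [setIntegral_indicator measurableSet_Ioo,
    Set.inter_eq_self_of_subset_right (s := Set.Ioi 0) (t := Set.Ioo δ 1)
      (fun r hr => hδ.1.trans hr.1), ← integral_Ioc_eq_integral_Ioo,
    ← intervalIntegral.integral_of_le hδ.2.le, intervalIntegral.integral_const_mul,
    integral_inv_of_pos hδ.1 one_pos, abs_of_neg (Real.log_neg hδ.1 hδ.2), one_div, Real.log_inv]
  ring

theorem integrableOn_translationDefect_annulus (h : IsGaussGreenPair Ω μ σ) (hΩ : MeasurableSet Ω)
    (hv : volume Ω ≠ ∞) {δ : ℝ} (hδ : 0 < δ) :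
    IntegrableOn (fun z => translationDefect Ω z / (4 * ‖z‖ ^ 3)) (annulus δ) := by
  have h2 := measurable_translationDefect hΩ
  refine Integrable.mono (h.integrableOn_directionalVariation_annulus hδ)
    (Measurable.aestronglyMeasurable (by fun_prop)) (ae_of_all _ fun z => ?_)
  rw [Real.norm_of_nonneg (div_nonneg (translationDefect_nonneg _ _) (by positivity)),
    Real.norm_of_nonneg (div_nonneg (directionalVariation_nonneg _ _ _) (by positivity))]
  gcongr
  exact h.translationDefect_le_directionalVariation hΩ hv z

theorem integrableOn_defectDensity_annulus (h : IsGaussGreenPair Ω μ σ) (hΩ : MeasurableSet Ω)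
    (hv : volume Ω ≠ ∞) {δ : ℝ} (hδ : 0 < δ) :
    IntegrableOn (defectDensity Ω μ σ) (annulus δ) := by
  have := (h.integrableOn_directionalVariation_annulus hδ).sub
    (h.integrableOn_translationDefect_annulus hΩ hv hδ)
  refine this.congr (ae_of_all _ fun z => ?_)
  simp [defectDensity, sub_div]

theorem scaledEnergy_eq (h : IsGaussGreenPair Ω μ σ) (hΩ : MeasurableSet Ω)
    (hv : volume Ω ≠ ∞) {δ : ℝ} (hδ : δ ∈ Set.Ioo (0 : ℝ) 1) :
    scaledEnergy δ Ω = (∫ z in annulus δ, defectDensity Ω μ σ z) - farDefect Ω := by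
  have hfin := h.finite
  have hiK := integrable_translationDefect_mul_truncatedKernel hΩ hv hδ.1
  have hb : MeasurableSet (Metric.ball (0 : Plane) 1) := Metric.isOpen_ball.measurableSet
  have e1 : ∫ z in (Metric.ball (0 : Plane) 1)ᶜ, translationDefect Ω z * truncatedKernel δ z =
      4 * farDefect Ω := by
    rw [farDefect, ← integral_const_mul]
    refine setIntegral_congr_fun hb.compl fun z hz => ?_
    have hz1 : 1 ≤ ‖z‖ := by simpa using hz
    rw [truncatedKernel_of_lt hδ.1 (hδ.2.trans_le hz1)]
    field_simp
  have e2 : ∫ z in Metric.ball (0 : Plane) 1, translationDefect Ω z * truncatedKernel δ z =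
      4 * ∫ z in annulus δ, translationDefect Ω z / (4 * ‖z‖ ^ 3) := by
    rw [setIntegral_eq_of_subset_of_forall_sdiff_eq_zero hb (annulus_subset_ball δ),
      ← integral_const_mul]
    · refine setIntegral_congr_fun (measurableSet_annulus δ) fun z hz => ?_
      rw [truncatedKernel_of_lt hδ.1 hz.1]
      have : ‖z‖ ≠ 0 := (hδ.1.trans hz.1).ne'
      field_simp
    · intro z hz
      rw [truncatedKernel_of_le hδ.1, mul_zero]
      by_contra hlt
      exact hz.2 ⟨not_le.1 hlt, by simpa using hz.1⟩
  have e3 : ∫ z in annulus δ, defectDensity Ω μ σ z = |Real.log δ| * μ.real Set.univ -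
      ∫ z in annulus δ, translationDefect Ω z / (4 * ‖z‖ ^ 3) := by
    rw [← h.setIntegral_directionalVariation_annulus hδ,
      ← integral_sub (h.integrableOn_directionalVariation_annulus hδ.1)
        (h.integrableOn_translationDefect_annulus hΩ hv hδ.1)]
    simp only [defectDensity, sub_div]
  rw [DipolarDrop.scaledEnergy_eq hΩ hv hδ, ← integral_add_compl hb hiK, e1, e2, e3,
    h.perimeter_eq]
  simp only [measureReal_def]
  ring

theorem antitoneOn_scaledEnergy (h : IsGaussGreenPair Ω μ σ) (hΩ : MeasurableSet Ω)
    (hv : volume Ω ≠ ∞) : AntitoneOn (fun δ => scaledEnergy δ Ω) (Set.Ioo 0 1) := by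
  intro a ha b hb hab
  beta_reduce
  rw [h.scaledEnergy_eq hΩ hv ha, h.scaledEnergy_eq hΩ hv hb]
  refine sub_le_sub_right (setIntegral_mono_set (h.integrableOn_defectDensity_annulus hΩ hv ha.1)
    (ae_of_all _ fun z => h.defectDensity_nonneg hΩ hv z) ?_) _
  exact Eventually.of_forall fun z (hz : z ∈ annulus b) => ⟨hab.trans_lt hz.1, hz.2⟩

theorem tendsto_scaledEnergy (h : IsGaussGreenPair Ω μ σ) (hΩ : MeasurableSet Ω)
    (hv : volume Ω ≠ ∞) :
    Tendsto (fun δ => ((scaledEnergy δ Ω : ℝ) : EReal)) (𝓝[>] 0)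
      (𝓝 (((∫⁻ z in Metric.ball (0 : Plane) 1, ENNReal.ofReal (defectDensity Ω μ σ z) : ℝ≥0∞) : EReal) +
        ((-farDefect Ω : ℝ) : EReal))) := by
  have hmd : Measurable fun z => ENNReal.ofReal (defectDensity Ω μ σ z) :=
    (h.measurable_defectDensity hΩ).ennreal_ofReal
  have h1 : Tendsto (fun δ => ∫⁻ z in annulus δ, ENNReal.ofReal (defectDensity Ω μ σ z)) (𝓝[>] 0)
      (𝓝 (∫⁻ z in Metric.ball (0 : Plane) 1, ENNReal.ofReal (defectDensity Ω μ σ z))) := by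
    simp_rw [← lintegral_indicator (measurableSet_annulus _)]
    rw [← lintegral_indicator Metric.isOpen_ball.measurableSet]
    refine tendsto_lintegral_of_le_of_tendsto
      (fun δ => hmd.indicator (measurableSet_annulus δ)) (fun δ => ae_of_all _ fun z => ?_)
      (ae_of_all _ fun z => ?_)
    · exact Set.indicator_le_indicator_of_subset (annulus_subset_ball δ) (fun _ => zero_le) z
    · rcases eq_or_ne z 0 with rfl | hz
      · have : ∀ s : Set Plane, s.indicator (fun z => ENNReal.ofReal (defectDensity Ω μ σ z)) 0 = 0 :=
          fun s => by
            rw [Set.indicator_apply_eq_zero]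
            intro _
            simp [defectDensity]
        simp only [this]
        exact tendsto_const_nhds
      · refine tendsto_const_nhds.congr' ?_
        filter_upwards [Ioo_mem_nhdsGT (norm_pos_iff.2 hz)] with δ hδ
        by_cases hz1 : ‖z‖ < 1
        · rw [Set.indicator_of_mem (show z ∈ annulus δ from ⟨hδ.2, hz1⟩),
            Set.indicator_of_mem (by simpa using hz1)]
        · rw [Set.indicator_of_notMem (show z ∉ annulus δ from fun h => hz1 h.2),
            Set.indicator_of_notMem (by simpa using hz1)]
  have h2 := (EReal.continuousAt_add (p := (((∫⁻ z in Metric.ball (0 : Plane) 1,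
    ENNReal.ofReal (defectDensity Ω μ σ z) : ℝ≥0∞) : EReal), ((-farDefect Ω : ℝ) : EReal)))
    (Or.inr (EReal.coe_ne_bot _)) (Or.inr (EReal.coe_ne_top _))).tendsto.comp
    (((continuous_coe_ennreal_ereal.tendsto _).comp h1).prodMk_nhds
      (tendsto_const_nhds (x := ((-farDefect Ω : ℝ) : EReal))))
  refine h2.congr' ?_
  filter_upwards [Ioo_mem_nhdsGT (zero_lt_one' ℝ)] with δ hδ
  have h3 := ofReal_integral_eq_lintegral_ofReal
    (h.integrableOn_defectDensity_annulus hΩ hv hδ.1)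
    (ae_of_all _ fun z => h.defectDensity_nonneg hΩ hv z)
  simp only [Function.comp_apply]
  rw [h.scaledEnergy_eq hΩ hv hδ, ← h3, EReal.coe_ennreal_ofReal, max_eq_left
    (integral_nonneg fun z => h.defectDensity_nonneg hΩ hv z), ← EReal.coe_add, sub_eq_add_neg]

end IsGaussGreenPair

end DipolarDrop

end

noncomputable section

namespace DipolarDrop

variable {Ω : Set Plane} {μ : Measure Plane} {σ : Plane → Plane} {y ν : Plane} {p : Plane → ℝ}

theorem divergence_smul_self (hp : Differentiable ℝ p) (z : Plane) :
    divergence (fun z => p z • z) z = 2 * p z + fderiv ℝ p z z := by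
  have h := ((hp z).hasFDerivAt.smul (hasFDerivAt_id z)).fderiv
  have hz : z = ∑ i, z i • EuclideanSpace.single i (1 : ℝ) := by
    ext j
    simp [Fin.sum_univ_two]
    fin_cases j <;> simp
  have h2 : fderiv ℝ p z z = ∑ i, z i * fderiv ℝ p z (EuclideanSpace.single i 1) := by
    conv_lhs => rw [hz]
    rw [map_sum, ← hz]
    simp
  have h3 : fderiv ℝ (fun z => p z • z) z = _ := h
  rw [divergence, h3, h2]
  simp [Fin.sum_univ_two]
  ring

theorem divergence_comp_const_sub {φ : Plane → Plane} (hφ : Differentiable ℝ φ) (x y : Plane) :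
    divergence (fun y => φ (x - y)) y = - divergence φ (x - y) := by
  have h := ((hφ (x - y)).hasFDerivAt.comp y ((hasFDerivAt_id y).const_sub x)).fderiv
  have h2 : fderiv ℝ (fun y => φ (x - y)) y = _ := h
  rw [divergence, h2, divergence]
  simp

theorem isTestField_smul_self (hp : ContDiff ℝ 1 p) (hs : HasCompactSupport p) :
    IsTestField fun z => p z • z :=
  ⟨hp.smul contDiff_id, hs.smul_right⟩

theorem divergence_smul_self_neg (hp : ContDiff ℝ 1 p) (he : ∀ z, p (-z) = p z) (z : Plane) :
    divergence (fun z => p z • z) (-z) = divergence (fun z => p z • z) z := by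
  have hd := hp.differentiable one_ne_zero
  rw [divergence_smul_self hd, divergence_smul_self hd, he]
  have h1 := ((hd (-z)).hasFDerivAt.comp z (hasFDerivAt_id z).neg).fderiv
  have h2 : (p ∘ fun z => -z) = p := funext he
  have h3 : fderiv ℝ (p ∘ fun z => -z) z = _ := h1
  rw [h2] at h3
  rw [h3]
  simp

theorem IsGaussGreenPair.integral_setIntegral_inner_smul (h : IsGaussGreenPair Ω μ σ)
    (hΩ : MeasurableSet Ω) (hv : volume Ω ≠ ∞) (hp : ContDiff ℝ 1 p) (hs : HasCompactSupport p)
    (he : ∀ z, p (-z) = p z) :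
    ∫ y, (∫ x in Ω, inner ℝ (σ y) (x - y) * p (x - y)) ∂μ =
      2⁻¹ * ∫ z, translationDefect Ω z * divergence (fun z => p z • z) z := by
  have hfin := h.finite
  have hm := h.measurable
  have hpc := hp.continuous
  have hχ := measurable_charFn hΩ
  have hvf : IsFiniteMeasure (volume.restrict Ω) := ⟨by simpa using hv.lt_top⟩
  have hW := isTestField_smul_self hp hs
  set f : Plane → ℝ := divergence fun z => p z • z with hf
  have hfc : Continuous f := continuous_divergence hW.1
  have hfs : HasCompactSupport f := hasCompactSupport_divergence hW.2
  have hfi : Integrable f := hfc.integrable_of_hasCompactSupport hfs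
  have hf0 : ∫ z, f z = 0 := integral_divergence_eq_zero hW
  have hfe : ∀ z, f (-z) = f z := divergence_smul_self_neg hp he
  obtain ⟨c, hc⟩ := hW.1.continuous.bounded_above_of_compact_support hW.2
  rw [integral_integral_swap]
  · have e1 : ∀ x, ∫ y, inner ℝ (σ y) (x - y) * p (x - y) ∂μ =
        - ∫ z, charFn Ω (x + z) * f z := by
      intro x
      have ht : IsTestField fun y => p (x - y) • (x - y) :=
        ⟨hW.1.comp (contDiff_const.sub contDiff_id), hW.2.comp_homeomorph (Homeomorph.subLeft x)⟩
      have h1 := h.gauss_green _ ht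
      have h2 : ∀ y, divergence (fun y => p (x - y) • (x - y)) y = - f (y - x) := fun y => by
        rw [divergence_comp_const_sub (φ := fun z => p z • z) (hW.1.differentiable one_ne_zero),
          ← hf, ← neg_sub y x, hfe]
      simp_rw [h2] at h1
      rw [integral_neg, ← integral_mul_charFn hΩ] at h1
      have h3 := integral_add_right_eq_self (μ := volume) (fun y => f (y - x) * charFn Ω y) x
      simp only [add_sub_cancel_right] at h3
      have h4 : ∫ z, charFn Ω (x + z) * f z = ∫ z, f z * charFn Ω (z + x) :=
        integral_congr_ae (ae_of_all _ fun z => by simp only [mul_comm, add_comm])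
      rw [h4, h3, h1]
      refine integral_congr_ae (ae_of_all _ fun y => ?_)
      simp only
      rw [real_inner_smul_left, real_inner_comm (σ y), mul_comm]
    simp_rw [e1]
    rw [integral_neg, ← integral_mul_charFn hΩ]
    have e2 : ∀ x, (∫ z, charFn Ω (x + z) * f z) * charFn Ω x =
        ∫ z, (charFn Ω x * charFn Ω (x + z)) * f z := fun x => by
      rw [← integral_mul_const]
      refine integral_congr_ae (ae_of_all _ fun z => ?_)
      simp only
      ring
    simp_rw [e2]
    rw [integral_integral_swap]
    · have e3 : ∀ z, ∫ x, charFn Ω x * charFn Ω (x + z) * f z =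
          volume.real Ω * f z - 2⁻¹ * (translationDefect Ω z * f z) := fun z => by
        rw [integral_mul_const, integral_charFn_mul_translate hΩ hv]
        ring
      simp_rw [e3]
      have hgi : Integrable fun z => translationDefect Ω z * f z :=
        hfi.bdd_mul (measurable_translationDefect hΩ).aestronglyMeasurable
          (ae_of_all _ fun z => by
            rw [Real.norm_of_nonneg (translationDefect_nonneg _ _)]
            exact translationDefect_le hΩ hv z)
      rw [integral_sub (hfi.const_mul _) (hgi.const_mul _), integral_const_mul, integral_const_mul,
        hf0]
      ring
    · refine ((integrable_charFn hΩ hv).mul_prod hfi).mono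
        (Measurable.aestronglyMeasurable (by fun_prop)) (ae_of_all _ fun q => ?_)
      simp only [Function.uncurry, norm_mul]
      rw [mul_assoc]
      refine mul_le_mul_of_nonneg_left ?_ (norm_nonneg _)
      refine mul_le_of_le_one_left (norm_nonneg _) ?_
      rw [Real.norm_of_nonneg (charFn_nonneg _ _)]
      exact charFn_le_one _ _
  · refine (integrable_const c).mono' (Measurable.aestronglyMeasurable (by fun_prop)) ?_
    have hu : ∀ᵐ q ∂μ.prod (volume.restrict Ω), ‖σ q.1‖ = 1 :=
      Measure.quasiMeasurePreserving_fst.ae h.unit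
    filter_upwards [hu] with q hq
    have h1 := abs_real_inner_le_norm (σ q.1) (p (q.2 - q.1) • (q.2 - q.1))
    rw [real_inner_smul_right, hq, one_mul, mul_comm] at h1
    exact h1.trans (hc _)

/-- The part of the unit disk about `y` where `Ω` and the half-plane with outer normal `σ y`
differ. -/
def nearSet (Ω : Set Plane) (σ : Plane → Plane) (y : Plane) : Set Plane :=
  symmDiff Ω {x | inner ℝ (x - y) (σ y) < 0} ∩ Metric.ball y 1

theorem measurableSet_nearSet (hΩ : MeasurableSet Ω) (σ : Plane → Plane) (y : Plane) :
    MeasurableSet (nearSet Ω σ y) :=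
  (hΩ.symmDiff (measurableSet_lt (by fun_prop) measurable_const)).inter
    Metric.isOpen_ball.measurableSet

theorem measurableSet_nearSet_prod (hΩ : MeasurableSet Ω) (hσ : Measurable σ) :
    MeasurableSet {q : Plane × Plane | q.2 ∈ nearSet Ω σ q.1} := by
  have h1 : MeasurableSet {q : Plane × Plane | q.2 ∈ Ω} := measurable_snd hΩ
  have h2 : MeasurableSet {q : Plane × Plane | inner ℝ (q.2 - q.1) (σ q.1) < 0} :=
    measurableSet_lt (by fun_prop) measurable_const
  have h3 : MeasurableSet {q : Plane × Plane | dist q.2 q.1 < 1} :=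
    measurableSet_lt (by fun_prop) measurable_const
  exact (h1.symmDiff h2).inter h3

theorem setIntegral_nearSet_add (hΩ : MeasurableSet Ω) (hpc : Continuous p)
    (hs : HasCompactSupport p) (he : ∀ z, p (-z) = p z) (h0 : ∀ z, 0 ≤ p z) (σ : Plane → Plane)
    (y : Plane) :
    (∫ x in nearSet Ω σ y, |inner ℝ (σ y) (x - y)| * p (x - y)) +
      (∫ x in Ω \ Metric.ball y 1, inner ℝ (σ y) (x - y) * p (x - y)) =
    (∫ x in Ω, inner ℝ (σ y) (x - y) * p (x - y)) +
      2⁻¹ * ∫ z in Metric.ball (0 : Plane) 1, |inner ℝ z (σ y)| * p z := by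
  have hb : MeasurableSet (Metric.ball y 1) := Metric.isOpen_ball.measurableSet
  set k : Plane → ℝ := fun x => inner ℝ (σ y) (x - y) * p (x - y) with hk
  have hki : Integrable k := by
    have hc : Continuous fun z : Plane => inner ℝ (σ y) z * p z := by fun_prop
    exact (hc.integrable_of_hasCompactSupport hs.mul_left).comp_sub_right y
  have hkabs : ∀ x, |inner ℝ (σ y) (x - y)| * p (x - y) = |k x| := fun x => by
    rw [hk, abs_mul, abs_of_nonneg (h0 _)]
  simp_rw [hkabs]
  have e1 : ∫ x in nearSet Ω σ y, |k x| =
      (∫ x in Ω ∩ Metric.ball y 1, k x) + ∫ x in Metric.ball y 1, (|k x| - k x) / 2 := by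
    have hki2 : Integrable fun x => (|k x| - k x) / 2 := (hki.abs.sub hki).div_const 2
    rw [← integral_indicator (measurableSet_nearSet hΩ σ y), ← integral_indicator (hΩ.inter hb),
      ← integral_indicator hb, ← integral_add (hki.indicator (hΩ.inter hb)) (hki2.indicator hb)]
    refine integral_congr_ae (ae_of_all _ fun x => ?_)
    by_cases hxb : x ∈ Metric.ball y 1
    · by_cases hxΩ : x ∈ Ω <;> by_cases hxH : inner ℝ (x - y) (σ y) < 0
      · have h1 : x ∉ nearSet Ω σ y := fun hx => by
          rcases hx.1 with h2 | h2
          · exact h2.2 hxH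
          · exact h2.2 hxΩ
        have h2 : k x ≤ 0 := by
          rw [real_inner_comm] at hxH
          exact mul_nonpos_of_nonpos_of_nonneg hxH.le (h0 _)
        simp only [Set.indicator_of_notMem h1, Set.indicator_of_mem (Set.mem_inter hxΩ hxb),
          Set.indicator_of_mem hxb, abs_of_nonpos h2]
        ring
      · have h1 : x ∈ nearSet Ω σ y := ⟨Or.inl ⟨hxΩ, hxH⟩, hxb⟩
        have h2 : 0 ≤ k x := by
          rw [real_inner_comm] at hxH
          exact mul_nonneg (not_lt.1 hxH) (h0 _)
        simp only [Set.indicator_of_mem h1, Set.indicator_of_mem (Set.mem_inter hxΩ hxb),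
          Set.indicator_of_mem hxb, abs_of_nonneg h2]
        ring
      · have h1 : x ∈ nearSet Ω σ y := ⟨Or.inr ⟨hxH, hxΩ⟩, hxb⟩
        have h2 : k x ≤ 0 := by
          rw [real_inner_comm] at hxH
          exact mul_nonpos_of_nonpos_of_nonneg hxH.le (h0 _)
        have h3 : x ∉ Ω ∩ Metric.ball y 1 := fun hx => hxΩ hx.1
        simp only [Set.indicator_of_mem h1, Set.indicator_of_notMem h3,
          Set.indicator_of_mem hxb, abs_of_nonpos h2]
        ring
      · have h1 : x ∉ nearSet Ω σ y := fun hx => by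
          rcases hx.1 with h2 | h2
          · exact hxΩ h2.1
          · exact hxH h2.1
        have h2 : 0 ≤ k x := by
          rw [real_inner_comm] at hxH
          exact mul_nonneg (not_lt.1 hxH) (h0 _)
        have h3 : x ∉ Ω ∩ Metric.ball y 1 := fun hx => hxΩ hx.1
        simp only [Set.indicator_of_notMem h1, Set.indicator_of_notMem h3,
          Set.indicator_of_mem hxb, abs_of_nonneg h2]
        ring
    · have h1 : x ∉ nearSet Ω σ y := fun hx => hxb hx.2
      have h3 : x ∉ Ω ∩ Metric.ball y 1 := fun hx => hxb hx.2
      simp [Set.indicator_of_notMem h1, Set.indicator_of_notMem h3, Set.indicator_of_notMem hxb]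
  have e2 : ∀ F : Plane → ℝ, ∫ x in Metric.ball y 1, F (x - y) =
      ∫ z in Metric.ball (0 : Plane) 1, F z := fun F => by
    rw [← integral_indicator hb, ← integral_indicator Metric.isOpen_ball.measurableSet,
      ← integral_sub_right_eq_self ((Metric.ball (0 : Plane) 1).indicator F) y]
    refine integral_congr_ae (ae_of_all _ fun x => ?_)
    by_cases hx : x ∈ Metric.ball y 1
    · have : x - y ∈ Metric.ball (0 : Plane) 1 := by
        rwa [mem_ball_zero_iff, ← dist_eq_norm]
      simp only [Set.indicator_of_mem hx, Set.indicator_of_mem this]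
    · have : x - y ∉ Metric.ball (0 : Plane) 1 := by
        rwa [mem_ball_zero_iff, ← dist_eq_norm]
      simp only [Set.indicator_of_notMem hx, Set.indicator_of_notMem this]
  have e3 : ∫ x in Metric.ball y 1, k x = 0 := by
    rw [e2 fun z => inner ℝ (σ y) z * p z, ← integral_indicator Metric.isOpen_ball.measurableSet]
    set F := (Metric.ball (0 : Plane) 1).indicator fun z => inner ℝ (σ y) z * p z with hF
    have h1 : ∀ z, F (-z) = - F z := fun z => by
      by_cases hz : z ∈ Metric.ball (0 : Plane) 1
      · have hz' : -z ∈ Metric.ball (0 : Plane) 1 := by simpa using hz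
        rw [hF, Set.indicator_of_mem hz, Set.indicator_of_mem hz', he, inner_neg_right, neg_mul]
      · have hz' : -z ∉ Metric.ball (0 : Plane) 1 := by simpa using hz
        rw [hF, Set.indicator_of_notMem hz, Set.indicator_of_notMem hz', neg_zero]
    have h2 := integral_neg_eq_self F volume
    simp_rw [h1] at h2
    rw [integral_neg] at h2
    linarith
  have e4 : ∫ x in Metric.ball y 1, (|k x| - k x) / 2 =
      2⁻¹ * ∫ z in Metric.ball (0 : Plane) 1, |inner ℝ z (σ y)| * p z := by
    rw [integral_div, integral_sub hki.abs.integrableOn hki.integrableOn, e3,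
      ← e2 fun z => |inner ℝ z (σ y)| * p z]
    simp_rw [real_inner_comm (σ y), hkabs]
    ring
  rw [e1, e4, ← integral_inter_add_sdiff hb (hki.integrableOn (s := Ω))]
  ring

end DipolarDrop

end

noncomputable section

namespace DipolarDrop

variable {Ω : Set Plane} {μ : Measure Plane} {σ : Plane → Plane} {y ν : Plane} {p : Plane → ℝ}

theorem integrable_comp_sub_prod (μ : Measure Plane) [IsFiniteMeasure μ] {b : Plane → ℝ}
    (hbm : Measurable b) (hb : Integrable b) :
    Integrable (fun q : Plane × Plane => b (q.2 - q.1)) (μ.prod volume) := by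
  refine (integrable_prod_iff (Measurable.aestronglyMeasurable (by fun_prop))).2 ⟨?_, ?_⟩
  · exact ae_of_all _ fun y => hb.comp_sub_right y
  · have : ∀ y : Plane, ∫ x, ‖b (x - y)‖ = ∫ x, ‖b x‖ := fun y =>
      integral_sub_right_eq_self (fun x => ‖b x‖) y
    simp only [this]
    exact integrable_const _

theorem IsGaussGreenPair.integrable_setIntegral_section (h : IsGaussGreenPair Ω μ σ)
    (hpc : Continuous p) (hs : HasCompactSupport p) {S : Set (Plane × Plane)} (hS : MeasurableSet S)
    {F : Plane × Plane → ℝ} (hF : Measurable F)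
    (hFb : ∀ q, ‖σ q.1‖ = 1 → |F q| ≤ ‖q.2 - q.1‖ * |p (q.2 - q.1)|) :
    Integrable (fun y => ∫ x in {x | (y, x) ∈ S}, F (y, x)) μ := by
  have hfin := h.finite
  have hbc : Continuous fun z : Plane => ‖z‖ * |p z| := by fun_prop
  have hbi : Integrable fun z : Plane => ‖z‖ * |p z| :=
    hbc.integrable_of_hasCompactSupport hs.abs.mul_left
  have h1 : Integrable (S.indicator F) (μ.prod volume) := by
    refine (integrable_comp_sub_prod μ hbc.measurable hbi).mono'
      (hF.indicator hS).aestronglyMeasurable ?_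
    have hu : ∀ᵐ q ∂μ.prod (volume : Measure Plane), ‖σ q.1‖ = 1 :=
      Measure.quasiMeasurePreserving_fst.ae h.unit
    filter_upwards [hu] with q hq
    exact (norm_indicator_le_norm_self _ _).trans (hFb q hq)
  refine h1.integral_prod_left.congr (ae_of_all _ fun y => ?_)
  have hSy : MeasurableSet {x | (y, x) ∈ S} := measurable_prodMk_left hS
  simp only
  rw [← integral_indicator hSy]
  rfl

theorem IsGaussGreenPair.integrable_near (h : IsGaussGreenPair Ω μ σ) (hΩ : MeasurableSet Ω)
    (hpc : Continuous p) (hs : HasCompactSupport p) :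
    Integrable (fun y => ∫ x in nearSet Ω σ y, |inner ℝ (σ y) (x - y)| * p (x - y)) μ := by
  have hm := h.measurable
  refine h.integrable_setIntegral_section hpc hs (measurableSet_nearSet_prod hΩ hm)
    (F := fun q => |inner ℝ (σ q.1) (q.2 - q.1)| * p (q.2 - q.1)) (by fun_prop) fun q hq => ?_
  rw [abs_mul, abs_abs]
  refine mul_le_mul_of_nonneg_right ?_ (abs_nonneg _)
  simpa [hq] using abs_real_inner_le_norm (σ q.1) (q.2 - q.1)

theorem IsGaussGreenPair.integrable_inner_section (h : IsGaussGreenPair Ω μ σ)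
    (hpc : Continuous p) (hs : HasCompactSupport p) {S : Set (Plane × Plane)}
    (hS : MeasurableSet S) :
    Integrable (fun y => ∫ x in {x | (y, x) ∈ S}, inner ℝ (σ y) (x - y) * p (x - y)) μ := by
  have hm := h.measurable
  refine h.integrable_setIntegral_section hpc hs hS
    (F := fun q => inner ℝ (σ q.1) (q.2 - q.1) * p (q.2 - q.1)) (by fun_prop) fun q hq => ?_
  rw [abs_mul]
  refine mul_le_mul_of_nonneg_right ?_ (abs_nonneg _)
  simpa [hq] using abs_real_inner_le_norm (σ q.1) (q.2 - q.1)

theorem measurableSet_diff_ball_prod (hΩ : MeasurableSet Ω) :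
    MeasurableSet {q : Plane × Plane | q.2 ∈ Ω \ Metric.ball q.1 1} := by
  have h1 : MeasurableSet {q : Plane × Plane | q.2 ∈ Ω} := measurable_snd hΩ
  have h3 : MeasurableSet {q : Plane × Plane | dist q.2 q.1 < 1} :=
    measurableSet_lt (by fun_prop) measurable_const
  exact h1.diff h3

theorem IsGaussGreenPair.integral_near_add_integral_far (h : IsGaussGreenPair Ω μ σ)
    (hΩ : MeasurableSet Ω) (hv : volume Ω ≠ ∞) (hp : ContDiff ℝ 1 p) (hs : HasCompactSupport p)
    (he : ∀ z, p (-z) = p z) (h0 : ∀ z, 0 ≤ p z) :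
    (∫ y, (∫ x in nearSet Ω σ y, |inner ℝ (σ y) (x - y)| * p (x - y)) ∂μ) +
      (∫ y, (∫ x in Ω \ Metric.ball y 1, inner ℝ (σ y) (x - y) * p (x - y)) ∂μ) =
    2⁻¹ * (∫ z, translationDefect Ω z * divergence (fun z => p z • z) z) +
      2⁻¹ * ∫ z in Metric.ball (0 : Plane) 1, directionalVariation μ σ z * p z := by
  have hfin := h.finite
  have hm := h.measurable
  have hpc := hp.continuous
  have hb : MeasurableSet (Metric.ball (0 : Plane) 1) := Metric.isOpen_ball.measurableSet
  have hN := h.integrable_near hΩ hpc hs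
  have hFa : Integrable (fun y => ∫ x in Ω \ Metric.ball y 1, inner ℝ (σ y) (x - y) * p (x - y)) μ :=
    h.integrable_inner_section hpc hs (measurableSet_diff_ball_prod hΩ)
  have hA : Integrable (fun y => ∫ x in Ω, inner ℝ (σ y) (x - y) * p (x - y)) μ :=
    h.integrable_inner_section hpc hs (measurable_snd hΩ)
  have hprod : Integrable (fun q : Plane × Plane => |inner ℝ q.2 (σ q.1)| * p q.2)
      (μ.prod (volume.restrict (Metric.ball (0 : Plane) 1))) := by
    have hbc : Continuous fun z : Plane => ‖z‖ * |p z| := by fun_prop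
    have hbi : Integrable fun z : Plane => ‖z‖ * |p z| :=
      hbc.integrable_of_hasCompactSupport hs.abs.mul_left
    refine ((integrable_const (1 : ℝ) (μ := μ)).mul_prod (hbi.integrableOn
      (s := Metric.ball (0 : Plane) 1))).mono'
      (Measurable.aestronglyMeasurable (by fun_prop)) ?_
    have hu : ∀ᵐ q ∂μ.prod (volume.restrict (Metric.ball (0 : Plane) 1)), ‖σ q.1‖ = 1 :=
      Measure.quasiMeasurePreserving_fst.ae h.unit
    filter_upwards [hu] with q hq
    rw [norm_mul, Real.norm_eq_abs, Real.norm_eq_abs, abs_abs, one_mul]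
    refine mul_le_mul_of_nonneg_right ?_ (abs_nonneg _)
    simpa [hq] using abs_real_inner_le_norm q.2 (σ q.1)
  have hB : Integrable (fun y => 2⁻¹ * ∫ z in Metric.ball (0 : Plane) 1,
      |inner ℝ z (σ y)| * p z) μ := hprod.integral_prod_left.const_mul _
  rw [← integral_add hN hFa]
  simp_rw [setIntegral_nearSet_add hΩ hpc hs he h0 σ]
  rw [integral_add hA hB, h.integral_setIntegral_inner_smul hΩ hv hp hs he, integral_const_mul,
    integral_integral_swap hprod]
  simp_rw [integral_mul_const]
  rfl

theorem IsGaussGreenPair.nearTerm_eq (h : IsGaussGreenPair Ω μ σ) (hΩ : MeasurableSet Ω) :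
    nearTerm Ω = ∫⁻ y, (∫⁻ x in nearSet Ω σ y,
      ENNReal.ofReal (|inner ℝ (σ y) (x - y)| / ‖x - y‖ ^ 3)) ∂μ := by
  rw [nearTerm, h.hausdorffMeasure_restrict_reducedBoundary hΩ]
  refine lintegral_congr_ae ?_
  filter_upwards [h.outerNormal_ae_eq] with y hy
  simp only [boundaryKernel, halfPlane, hy, abs_div, abs_pow, abs_norm]
  rfl

theorem IsGaussGreenPair.farTerm_eq (h : IsGaussGreenPair Ω μ σ) (hΩ : MeasurableSet Ω) :
    farTerm Ω = ∫ y, (∫ x in Ω \ Metric.ball y 1, inner ℝ (σ y) (x - y) / ‖x - y‖ ^ 3) ∂μ := by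
  rw [farTerm, h.hausdorffMeasure_restrict_reducedBoundary hΩ]
  refine integral_congr_ae ?_
  filter_upwards [h.outerNormal_ae_eq] with y hy
  simp only [boundaryKernel, hy]

end DipolarDrop

end

noncomputable section

namespace DipolarDrop

variable {Ω : Set Plane} {μ : Measure Plane} {σ : Plane → Plane} {y ν : Plane} {p : Plane → ℝ}

/-- A smooth step from `0` on `(-∞, 1]` to `1` on `[2, ∞)`. -/
def smoothStep (t : ℝ) : ℝ := Real.smoothTransition (t - 1)

theorem contDiff_smoothStep : ContDiff ℝ 2 smoothStep :=
  (Real.smoothTransition.contDiff (n := 2)).comp (contDiff_id.sub contDiff_const)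

theorem monotone_smoothStep : Monotone smoothStep := fun _ _ h =>
  Real.smoothTransition.monotone (sub_le_sub_right h 1)

theorem smoothStep_nonneg (t : ℝ) : 0 ≤ smoothStep t := Real.smoothTransition.nonneg _

theorem smoothStep_le_one (t : ℝ) : smoothStep t ≤ 1 := Real.smoothTransition.le_one _

theorem smoothStep_of_le_one {t : ℝ} (h : t ≤ 1) : smoothStep t = 0 :=
  Real.smoothTransition.zero_of_nonpos (by linarith)

theorem smoothStep_of_two_le {t : ℝ} (h : 2 ≤ t) : smoothStep t = 1 :=
  Real.smoothTransition.one_of_one_le (by linarith)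

theorem hasDerivAt_smoothStep (t : ℝ) : HasDerivAt smoothStep (deriv smoothStep t) t :=
  (contDiff_smoothStep.differentiable two_ne_zero t).hasDerivAt

theorem continuous_deriv_smoothStep : Continuous (deriv smoothStep) :=
  contDiff_smoothStep.continuous_deriv (by norm_num)

theorem deriv_smoothStep_of_lt_one {t : ℝ} (h : t < 1) : deriv smoothStep t = 0 := by
  have : smoothStep =ᶠ[𝓝 t] fun _ => 0 := by
    filter_upwards [Iio_mem_nhds h] with s hs using smoothStep_of_le_one (le_of_lt hs)
  rw [this.deriv_eq, deriv_const]

theorem deriv_smoothStep_of_two_lt {t : ℝ} (h : 2 < t) : deriv smoothStep t = 0 := by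
  have : smoothStep =ᶠ[𝓝 t] fun _ => 1 := by
    filter_upwards [Ioi_mem_nhds h] with s hs using smoothStep_of_two_le (le_of_lt hs)
  rw [this.deriv_eq, deriv_const]

/-- The weight `2 H'(|w|²) / |w|` concentrated on the ring `1 ≤ |w|² ≤ 2`. -/
def ringWeight (w : Plane) : ℝ := 2 * deriv smoothStep (‖w‖ ^ 2) / ‖w‖

theorem measurable_ringWeight : Measurable ringWeight := by
  have := continuous_deriv_smoothStep
  unfold ringWeight
  fun_prop

theorem norm_mul_ringWeight (w : Plane) : ‖w‖ * ringWeight w = 2 * deriv smoothStep (‖w‖ ^ 2) := by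
  rcases eq_or_ne w 0 with rfl | hw
  · simp [ringWeight, deriv_smoothStep_of_lt_one]
  · have : ‖w‖ ≠ 0 := norm_ne_zero_iff.2 hw
    rw [ringWeight]
    field_simp

theorem integrable_deriv_smoothStep_norm_sq :
    Integrable fun w : Plane => 2 * deriv smoothStep (‖w‖ ^ 2) := by
  have hc := continuous_deriv_smoothStep
  refine Continuous.integrable_of_hasCompactSupport (by fun_prop)
    (HasCompactSupport.intro (isCompact_closedBall (0 : Plane) 2) fun w hw => ?_)
  have hw2 : 2 < ‖w‖ := by simpa using hw
  rw [deriv_smoothStep_of_two_lt (by nlinarith), mul_zero]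

theorem integrable_norm_mul_ringWeight : Integrable fun w : Plane => ‖w‖ * ringWeight w := by
  simp_rw [norm_mul_ringWeight]
  exact integrable_deriv_smoothStep_norm_sq

theorem integrable_ringWeight : Integrable ringWeight := by
  refine integrable_norm_mul_ringWeight.mono measurable_ringWeight.aestronglyMeasurable
    (ae_of_all _ fun w => ?_)
  rcases lt_or_ge ‖w‖ 1 with hw | hw
  · have : ‖w‖ ^ 2 < 1 := by nlinarith [norm_nonneg w]
    simp [ringWeight, deriv_smoothStep_of_lt_one this]
  · rw [norm_mul, norm_norm]
    exact le_mul_of_one_le_left (norm_nonneg _) hw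

theorem integral_two_mul_deriv_smoothStep_sq :
    ∫ r in Set.Ioi (0 : ℝ), deriv smoothStep (r ^ 2) * (2 * r) = 1 := by
  have hd : ∀ r : ℝ, HasDerivAt (fun r => smoothStep (r ^ 2)) (deriv smoothStep (r ^ 2) * (2 * r)) r :=
    fun r => by
      have h1 : HasDerivAt (fun r : ℝ => r ^ 2) (2 * r) r := by simpa using hasDerivAt_pow 2 r
      exact HasDerivAt.comp (h₂ := smoothStep) r (hasDerivAt_smoothStep (r ^ 2)) h1
  have hc := continuous_deriv_smoothStep
  have hi : Integrable fun r : ℝ => deriv smoothStep (r ^ 2) * (2 * r) := by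
    refine Continuous.integrable_of_hasCompactSupport (by fun_prop)
      (HasCompactSupport.intro (isCompact_closedBall (0 : ℝ) 2) fun w hw => ?_)
    have hw2 : 2 < |w| := by simpa using hw
    rw [deriv_smoothStep_of_two_lt (by nlinarith [sq_abs w]), zero_mul]
  have hlim : Tendsto (fun r : ℝ => smoothStep (r ^ 2)) atTop (𝓝 1) := by
    refine tendsto_const_nhds.congr' ?_
    filter_upwards [eventually_ge_atTop 2] with r hr
    rw [smoothStep_of_two_le (by nlinarith)]
  rw [integral_Ioi_of_hasDerivAt_of_tendsto (hd 0).continuousAt.continuousWithinAt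
    (fun r _ => hd r) hi.integrableOn hlim]
  rw [smoothStep_of_le_one (by norm_num)]
  norm_num

theorem IsGaussGreenPair.integral_directionalVariation_mul_ringWeight
    (h : IsGaussGreenPair Ω μ σ) :
    ∫ w, directionalVariation μ σ w * ringWeight w = 4 * μ.real Set.univ := by
  have hc := continuous_deriv_smoothStep
  have h1 := h.integral_directionalVariation_mul_radial
    (q := fun r => 2 * deriv smoothStep (r ^ 2) / r) (by fun_prop) integrable_norm_mul_ringWeight
  have h2 : ∫ r in Set.Ioi (0 : ℝ), r ^ 2 * (2 * deriv smoothStep (r ^ 2) / r) = 1 := by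
    rw [← integral_two_mul_deriv_smoothStep_sq]
    refine setIntegral_congr_fun measurableSet_Ioi fun r hr => ?_
    have hr0 : r ≠ 0 := ne_of_gt hr
    field_simp
  rw [h2, mul_one] at h1
  exact h1

theorem integral_translationDefect_mul_ringWeight {b : ℝ} (hb : 0 < b) :
    ∫ z, translationDefect Ω z * (b ^ 3 * ringWeight (b • z)) =
      ∫ w, b * translationDefect Ω (b⁻¹ • w) * ringWeight w := by
  have h1 := Measure.integral_comp_smul (volume : Measure Plane)
    (fun w => b ^ 3 * translationDefect Ω (b⁻¹ • w) * ringWeight w) b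
  simp only [smul_smul, inv_mul_cancel₀ hb.ne', one_smul, finrank_euclideanSpace,
    Fintype.card_fin, smul_eq_mul] at h1
  rw [abs_of_pos (by positivity), ← integral_const_mul] at h1
  calc _ = ∫ z, b ^ 3 * translationDefect Ω z * ringWeight (b • z) :=
        integral_congr_ae (ae_of_all _ fun z => by simp only; ring)
    _ = _ := h1
    _ = _ := integral_congr_ae (ae_of_all _ fun z => by simp only; field_simp)

theorem IsGaussGreenPair.tendsto_ringWeight_atTop (h : IsGaussGreenPair Ω μ σ)
    (hΩ : MeasurableSet Ω) (hv : volume Ω ≠ ∞) {a : ℕ → ℝ} (ha0 : ∀ n, 0 < a n)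
    (ha : Tendsto a atTop atTop) :
    Tendsto (fun n => ∫ z, translationDefect Ω z * (a n ^ 3 * ringWeight (a n • z))) atTop
      (𝓝 (4 * μ.real Set.univ)) := by
  have hg := measurable_translationDefect hΩ
  have hr := measurable_ringWeight
  simp_rw [integral_translationDefect_mul_ringWeight (ha0 _)]
  rw [← h.integral_directionalVariation_mul_ringWeight]
  refine tendsto_integral_of_dominated_convergence
    (fun w => μ.real Set.univ * ‖‖w‖ * ringWeight w‖)
    (fun n => Measurable.aestronglyMeasurable (by fun_prop))
    (integrable_norm_mul_ringWeight.norm.const_mul _) (fun n => ae_of_all _ fun w => ?_)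
    (ae_of_all _ fun w => ?_)
  · have h1 := h.translationDefect_le_directionalVariation hΩ hv ((a n)⁻¹ • w)
    rw [directionalVariation_smul, abs_of_pos (inv_pos.2 (ha0 n))] at h1
    have h2 := h.directionalVariation_le w
    have h3 : a n * translationDefect Ω ((a n)⁻¹ • w) ≤ ‖w‖ * μ.real Set.univ := by
      refine le_trans ?_ h2
      rw [mul_comm, ← le_div_iff₀ (ha0 n), div_eq_inv_mul]
      exact h1
    rw [norm_mul, norm_mul ‖w‖, norm_norm, Real.norm_of_nonneg
      (mul_nonneg (ha0 n).le (translationDefect_nonneg _ _))]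
    calc _ ≤ ‖w‖ * μ.real Set.univ * ‖ringWeight w‖ := by gcongr
      _ = _ := by ring
  · refine Tendsto.mul_const _ ?_
    have h1 : Tendsto (fun n => (a n)⁻¹) atTop (𝓝[>] 0) :=
      tendsto_nhdsWithin_iff.2 ⟨tendsto_inv_atTop_zero.comp ha,
        Eventually.of_forall fun n => inv_pos.2 (ha0 n)⟩
    have h2 := (h.tendsto_translationDefect_smul hΩ hv w).comp h1
    refine h2.congr fun n => ?_
    simp

theorem tendsto_ringWeight_zero (hΩ : MeasurableSet Ω) (hv : volume Ω ≠ ∞) {b : ℕ → ℝ}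
    (hb0 : ∀ n, 0 < b n) (hb : Tendsto b atTop (𝓝 0)) :
    Tendsto (fun n => ∫ z, translationDefect Ω z * (b n ^ 3 * ringWeight (b n • z))) atTop
      (𝓝 0) := by
  simp_rw [integral_translationDefect_mul_ringWeight (hb0 _)]
  have h1 : Tendsto (fun n => b n * (2 * volume.real Ω * ∫ w, ‖ringWeight w‖)) atTop (𝓝 0) := by
    simpa using hb.mul_const _
  refine squeeze_zero_norm (fun n => ?_) h1
  rw [← mul_assoc, ← integral_const_mul]
  refine norm_integral_le_of_norm_le (integrable_ringWeight.norm.const_mul _)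
    (ae_of_all _ fun w => ?_)
  rw [norm_mul, Real.norm_of_nonneg (mul_nonneg (hb0 n).le (translationDefect_nonneg _ _))]
  have := translationDefect_le hΩ hv ((b n)⁻¹ • w)
  have := (hb0 n).le
  gcongr

/-- The cutoff `H(a²t) - H(t/a²)`, which vanishes near `0` and near `∞`. -/
def annularProfile (a t : ℝ) : ℝ := smoothStep (a ^ 2 * t) - smoothStep ((a⁻¹) ^ 2 * t)

/-- The kernel `|z|⁻³` multiplied by a smooth cutoff near `0` and near `∞`. -/
def regularKernel (a : ℝ) (z : Plane) : ℝ := annularProfile a (‖z‖ ^ 2) / ‖z‖ ^ 3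

section profile

variable {a : ℝ}

theorem annularProfile_nonneg (ha : 1 ≤ a) {t : ℝ} (ht : 0 ≤ t) : 0 ≤ annularProfile a t := by
  refine sub_nonneg.2 (monotone_smoothStep (mul_le_mul_of_nonneg_right ?_ ht))
  have : a⁻¹ ≤ a := (inv_le_one_of_one_le₀ ha).trans ha
  gcongr

theorem annularProfile_le_one (a t : ℝ) : annularProfile a t ≤ 1 :=
  (sub_le_self _ (smoothStep_nonneg _)).trans (smoothStep_le_one _)

theorem annularProfile_of_le (ha : 1 ≤ a) {t : ℝ} (h0 : 0 ≤ t) (ht : a ^ 2 * t ≤ 1) :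
    annularProfile a t = 0 := by
  have h1 : (a⁻¹) ^ 2 * t ≤ a ^ 2 * t := by
    have : a⁻¹ ≤ a := (inv_le_one_of_one_le₀ ha).trans ha
    gcongr
  rw [annularProfile, smoothStep_of_le_one ht, smoothStep_of_le_one (h1.trans ht), sub_zero]

theorem annularProfile_of_ge (ha : 1 ≤ a) {t : ℝ} (h0 : 0 ≤ t) (ht : 2 ≤ (a⁻¹) ^ 2 * t) :
    annularProfile a t = 0 := by
  have h1 : (a⁻¹) ^ 2 * t ≤ a ^ 2 * t := by
    have : a⁻¹ ≤ a := (inv_le_one_of_one_le₀ ha).trans ha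
    gcongr
  rw [annularProfile, smoothStep_of_two_le ht, smoothStep_of_two_le (ht.trans h1), sub_self]

theorem regularKernel_nonneg (ha : 1 ≤ a) (z : Plane) : 0 ≤ regularKernel a z :=
  div_nonneg (annularProfile_nonneg ha (by positivity)) (by positivity)

theorem regularKernel_le (a : ℝ) (z : Plane) : regularKernel a z ≤ (‖z‖ ^ 3)⁻¹ := by
  rw [regularKernel, div_eq_mul_inv]
  exact mul_le_of_le_one_left (by positivity) (annularProfile_le_one _ _)

theorem regularKernel_neg (a : ℝ) (z : Plane) : regularKernel a (-z) = regularKernel a z := by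
  simp [regularKernel]

theorem regularKernel_eventually_zero (ha : 1 ≤ a) : regularKernel a =ᶠ[𝓝 0] fun _ => 0 := by
  have ha0 : 0 < a := by linarith
  filter_upwards [Metric.ball_mem_nhds (0 : Plane) (inv_pos.2 ha0)] with z hz
  have hz' : ‖z‖ < a⁻¹ := by simpa using hz
  have h1 : a * ‖z‖ ≤ 1 := by
    rw [← mul_inv_cancel₀ ha0.ne']
    gcongr
  rw [regularKernel, annularProfile_of_le ha (by positivity), zero_div]
  rw [← mul_pow]
  exact pow_le_one₀ (by positivity) h1

theorem contDiff_regularKernel (ha : 1 ≤ a) : ContDiff ℝ 1 (regularKernel a) := by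
  have hH : ContDiff ℝ 1 smoothStep := contDiff_smoothStep.of_le (by norm_num)
  rw [contDiff_iff_contDiffAt]
  intro z
  rcases eq_or_ne z 0 with rfl | hz
  · exact contDiffAt_const.congr_of_eventuallyEq (regularKernel_eventually_zero ha)
  · have h1 : ContDiff ℝ 1 fun z : Plane => annularProfile a (‖z‖ ^ 2) := by
      have hn : ContDiff ℝ 1 fun z : Plane => ‖z‖ ^ 2 := contDiff_norm_sq ℝ
      exact (hH.comp (contDiff_const.mul hn)).sub (hH.comp (contDiff_const.mul hn))
    exact h1.contDiffAt.div ((contDiffAt_norm ℝ hz).pow 3)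
      (pow_ne_zero 3 (norm_ne_zero_iff.2 hz))

theorem hasCompactSupport_regularKernel (ha : 1 ≤ a) : HasCompactSupport (regularKernel a) := by
  have ha0 : 0 < a := by linarith
  refine HasCompactSupport.intro (isCompact_closedBall (0 : Plane) (2 * a)) fun z hz => ?_
  have hz' : 2 * a < ‖z‖ := by simpa using hz
  rw [regularKernel, annularProfile_of_ge ha (by positivity), zero_div]
  rw [← mul_pow, inv_mul_eq_div]
  have : 2 ≤ ‖z‖ / a := by rw [le_div_iff₀ ha0]; exact hz'.le
  nlinarith

theorem divergence_regularKernel_smul (ha : 1 ≤ a) (z : Plane) :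
    divergence (fun z => regularKernel a z • z) z =
      a ^ 3 * ringWeight (a • z) - (a⁻¹) ^ 3 * ringWeight (a⁻¹ • z) - regularKernel a z := by
  have ha0 : 0 < a := by linarith
  have hd := (contDiff_regularKernel ha).differentiable one_ne_zero
  rw [divergence_smul_self hd]
  rcases eq_or_ne z 0 with rfl | hz
  · simp [regularKernel, ringWeight]
  have hz0 : ‖z‖ ≠ 0 := norm_ne_zero_iff.2 hz
  have h1 : HasDerivAt (fun s : ℝ => regularKernel a (s • z)) (fderiv ℝ (regularKernel a) z z) 1 := by
    have hl : HasDerivAt (fun s : ℝ => s • z) z 1 := by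
      simpa using (hasDerivAt_id (1 : ℝ)).smul_const z
    have hf : HasFDerivAt (regularKernel a) (fderiv ℝ (regularKernel a) z) ((1 : ℝ) • z) := by
      rw [one_smul]; exact (hd z).hasFDerivAt
    exact hf.comp_hasDerivAt 1 hl
  have hH : ∀ c : ℝ, HasDerivAt (fun s : ℝ => smoothStep (c ^ 2 * (s * ‖z‖) ^ 2))
      (deriv smoothStep (c ^ 2 * ‖z‖ ^ 2) * (c ^ 2 * (2 * ‖z‖ ^ 2))) 1 := fun c => by
    have e : HasDerivAt (fun s : ℝ => c ^ 2 * (s * ‖z‖) ^ 2) (c ^ 2 * (2 * ‖z‖ ^ 2)) 1 := by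
      have h4 := (hasDerivAt_pow 2 (1 : ℝ)).const_mul (c ^ 2 * ‖z‖ ^ 2)
      have h5 : (fun s : ℝ => c ^ 2 * (s * ‖z‖) ^ 2) = fun s => c ^ 2 * ‖z‖ ^ 2 * s ^ 2 := by
        ext s; ring
      rw [h5]
      refine h4.congr_deriv ?_
      norm_num
      ring
    have h3 := hasDerivAt_smoothStep (c ^ 2 * (1 * ‖z‖) ^ 2)
    refine (HasDerivAt.comp (h₂ := smoothStep) (1 : ℝ) h3 e).congr_deriv ?_
    rw [one_mul]
  have hden : HasDerivAt (fun s : ℝ => (s * ‖z‖) ^ 3) (3 * ‖z‖ ^ 3) 1 := by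
    have h5 : (fun s : ℝ => (s * ‖z‖) ^ 3) = fun s => ‖z‖ ^ 3 * s ^ 3 := by
      ext s; ring
    rw [h5]
    refine ((hasDerivAt_pow 3 (1 : ℝ)).const_mul (‖z‖ ^ 3)).congr_deriv ?_
    norm_num
    ring
  have h2 := ((hH a).sub (hH a⁻¹)).div hden (by simpa using hz0)
  have h3 : (fun s : ℝ => regularKernel a (s • z)) =ᶠ[𝓝 1] fun s =>
      (smoothStep (a ^ 2 * (s * ‖z‖) ^ 2) - smoothStep ((a⁻¹) ^ 2 * (s * ‖z‖) ^ 2)) /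
        (s * ‖z‖) ^ 3 := by
    filter_upwards [Ioi_mem_nhds (zero_lt_one' ℝ)] with s hs
    have hs0 : 0 < s := hs
    rw [regularKernel, annularProfile, norm_smul, Real.norm_of_nonneg hs0.le]
  have h4 := h1.unique (h2.congr_of_eventuallyEq h3)
  rw [h4, regularKernel, annularProfile, ringWeight, ringWeight, norm_smul, norm_smul,
    Real.norm_of_nonneg ha0.le, Real.norm_of_nonneg (inv_pos.2 ha0).le]
  simp only [one_mul, Pi.sub_apply, mul_pow]
  field_simp
  ring

theorem tendsto_regularKernel {a : ℕ → ℝ} (ha : Tendsto a atTop atTop) (z : Plane) :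
    Tendsto (fun n => regularKernel (a n) z) atTop (𝓝 (‖z‖ ^ 3)⁻¹) := by
  rcases eq_or_ne z 0 with rfl | hz
  · simp [regularKernel]
  have hz0 : 0 < ‖z‖ := norm_pos_iff.2 hz
  refine tendsto_const_nhds.congr' ?_
  have h1 : ∀ᶠ n in atTop, 2 ≤ (a n) ^ 2 * ‖z‖ ^ 2 :=
    ((((tendsto_pow_atTop two_ne_zero).comp ha)).atTop_mul_const (by positivity : 0 < ‖z‖ ^ 2)).eventually_ge_atTop 2
  have h2 : Tendsto (fun n => ((a n)⁻¹) ^ 2 * ‖z‖ ^ 2) atTop (𝓝 0) := by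
    have := ((tendsto_inv_atTop_zero.comp ha).pow 2).mul_const (‖z‖ ^ 2)
    simpa using this
  filter_upwards [h1, h2.eventually (gt_mem_nhds zero_lt_one)] with n hn1 hn2
  rw [regularKernel, annularProfile, smoothStep_of_two_le hn1, smoothStep_of_le_one hn2.le, sub_zero,
    one_div]

end profile

end DipolarDrop

end

noncomputable section

namespace DipolarDrop

variable {Ω : Set Plane} {μ : Measure Plane} {σ : Plane → Plane} {y ν : Plane} {p : Plane → ℝ}
  {a : ℕ → ℝ}

theorem integrable_mul_regularKernel {F : Plane → ℝ} (hF : Measurable F) {c : ℝ}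
    (hc : ∀ z, |F z| ≤ c * ‖z‖) {a : ℝ} (ha : 1 ≤ a) :
    Integrable fun z => F z * regularKernel a z := by
  have hp := (contDiff_regularKernel ha).continuous
  have h1 : Integrable fun z : Plane => c * (‖z‖ * regularKernel a z) := by
    refine Integrable.const_mul ?_ c
    exact Continuous.integrable_of_hasCompactSupport (by fun_prop)
      (hasCompactSupport_regularKernel ha).mul_left
  refine h1.mono' (Measurable.aestronglyMeasurable (by fun_prop)) (ae_of_all _ fun z => ?_)
  rw [norm_mul, Real.norm_of_nonneg (regularKernel_nonneg ha z), ← mul_assoc]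
  exact mul_le_mul_of_nonneg_right (hc z) (regularKernel_nonneg ha z)

theorem continuous_regularKernel {a : ℝ} (ha : 1 ≤ a) : Continuous (regularKernel a) :=
  (contDiff_regularKernel ha).continuous

theorem integrableOn_translationDefect_compl_ball (hΩ : MeasurableSet Ω) (hv : volume Ω ≠ ∞) :
    IntegrableOn (fun z => translationDefect Ω z / (4 * ‖z‖ ^ 3)) (Metric.ball (0 : Plane) 1)ᶜ := by
  have h1 := ((integrable_translationDefect_mul_truncatedKernel hΩ hv
    (one_half_pos (α := ℝ))).div_const 4).integrableOn (s := (Metric.ball (0 : Plane) 1)ᶜ)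
  refine h1.congr_fun (fun z hz => ?_) Metric.isOpen_ball.measurableSet.compl
  have hz1 : 1 ≤ ‖z‖ := by simpa using hz
  simp only
  rw [truncatedKernel_of_lt (by norm_num) (by linarith : 1 / 2 < ‖z‖)]
  field_simp

namespace IsGaussGreenPair

theorem abs_translationDefect_le (h : IsGaussGreenPair Ω μ σ) (hΩ : MeasurableSet Ω)
    (hv : volume Ω ≠ ∞) (z : Plane) : |translationDefect Ω z| ≤ μ.real Set.univ * ‖z‖ := by
  rw [abs_of_nonneg (translationDefect_nonneg _ _), mul_comm]
  exact (h.translationDefect_le_directionalVariation hΩ hv z).trans (h.directionalVariation_le z)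

theorem abs_directionalVariation_le (h : IsGaussGreenPair Ω μ σ) (z : Plane) :
    |directionalVariation μ σ z| ≤ μ.real Set.univ * ‖z‖ := by
  rw [abs_of_nonneg (directionalVariation_nonneg _ _ _), mul_comm]
  exact h.directionalVariation_le z

/-- The regularized identity between the boundary integrals and the translation defect. -/
theorem regular_identity (h : IsGaussGreenPair Ω μ σ) (hΩ : MeasurableSet Ω) (hv : volume Ω ≠ ∞)
    {a : ℝ} (ha : 1 ≤ a) :
    2⁻¹ * (∫ y, (∫ x in nearSet Ω σ y, |inner ℝ (σ y) (x - y)| * regularKernel a (x - y)) ∂μ) =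
      (∫ z in Metric.ball (0 : Plane) 1,
        (directionalVariation μ σ z - translationDefect Ω z) / 4 * regularKernel a z) +
      (-(∫ z in (Metric.ball (0 : Plane) 1)ᶜ, translationDefect Ω z / 4 * regularKernel a z) +
        4⁻¹ * ((∫ z, translationDefect Ω z * (a ^ 3 * ringWeight (a • z))) -
          ∫ z, translationDefect Ω z * ((a⁻¹) ^ 3 * ringWeight (a⁻¹ • z))) -
        2⁻¹ * ∫ y, (∫ x in Ω \ Metric.ball y 1,
          inner ℝ (σ y) (x - y) * regularKernel a (x - y)) ∂μ) := by
  have ha0 : 0 < a := by linarith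
  have hg := measurable_translationDefect hΩ
  have hV := h.measurable_directionalVariation
  have hgi := integrable_mul_regularKernel hg (h.abs_translationDefect_le hΩ hv) ha
  have hVi := integrable_mul_regularKernel hV h.abs_directionalVariation_le ha
  have key := h.integral_near_add_integral_far hΩ hv (contDiff_regularKernel ha)
    (hasCompactSupport_regularKernel ha) (regularKernel_neg a) (regularKernel_nonneg ha)
  have hbd : ∀ z, ‖translationDefect Ω z‖ ≤ 2 * volume.real Ω := fun z => by
    rw [Real.norm_of_nonneg (translationDefect_nonneg _ _)]
    exact translationDefect_le hΩ hv z
  have hr : ∀ b : ℝ, 0 < b →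
      Integrable fun z => translationDefect Ω z * (b ^ 3 * ringWeight (b • z)) := fun b hb =>
    ((integrable_ringWeight.comp_smul hb.ne').const_mul (b ^ 3)).bdd_mul hg.aestronglyMeasurable
      (ae_of_all _ hbd)
  have e1 : ∫ z, translationDefect Ω z * divergence (fun z => regularKernel a z • z) z =
      (∫ z, translationDefect Ω z * (a ^ 3 * ringWeight (a • z))) -
        (∫ z, translationDefect Ω z * ((a⁻¹) ^ 3 * ringWeight (a⁻¹ • z))) -
        ∫ z, translationDefect Ω z * regularKernel a z := by
    have h1 : Integrable fun z => translationDefect Ω z * (a ^ 3 * ringWeight (a • z)) -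
        translationDefect Ω z * ((a⁻¹) ^ 3 * ringWeight (a⁻¹ • z)) :=
      (hr a ha0).sub (hr a⁻¹ (inv_pos.2 ha0))
    rw [← integral_sub (hr a ha0) (hr a⁻¹ (inv_pos.2 ha0)), ← integral_sub h1 hgi]
    refine integral_congr_ae (ae_of_all _ fun z => ?_)
    simp only [divergence_regularKernel_smul ha z]
    ring
  have e2 : ∫ z in Metric.ball (0 : Plane) 1,
      (directionalVariation μ σ z - translationDefect Ω z) / 4 * regularKernel a z =
      4⁻¹ * ((∫ z in Metric.ball (0 : Plane) 1, directionalVariation μ σ z * regularKernel a z) -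
        ∫ z in Metric.ball (0 : Plane) 1, translationDefect Ω z * regularKernel a z) := by
    rw [← integral_sub hVi.integrableOn hgi.integrableOn, ← integral_const_mul]
    refine integral_congr_ae (ae_of_all _ fun z => ?_)
    simp only
    ring
  have e3 : ∫ z in (Metric.ball (0 : Plane) 1)ᶜ, translationDefect Ω z / 4 * regularKernel a z =
      4⁻¹ * ∫ z in (Metric.ball (0 : Plane) 1)ᶜ, translationDefect Ω z * regularKernel a z := by
    rw [← integral_const_mul]
    refine integral_congr_ae (ae_of_all _ fun z => ?_)
    simp only
    ring
  have e4 := integral_add_compl (Metric.isOpen_ball (x := (0 : Plane)) (ε := 1)).measurableSet hgi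
  rw [e1, ← e4] at key
  rw [e2, e3]
  linarith

theorem tendsto_near (h : IsGaussGreenPair Ω μ σ) (hΩ : MeasurableSet Ω) (ha1 : ∀ n, 1 ≤ a n)
    (ha : Tendsto a atTop atTop) :
    Tendsto (fun n => ENNReal.ofReal (∫ y, (∫ x in nearSet Ω σ y,
      |inner ℝ (σ y) (x - y)| * regularKernel (a n) (x - y)) ∂μ)) atTop (𝓝 (nearTerm Ω)) := by
  have hfin := h.finite
  have hm := h.measurable
  have e : ∀ n, ENNReal.ofReal (∫ y, (∫ x in nearSet Ω σ y,
      |inner ℝ (σ y) (x - y)| * regularKernel (a n) (x - y)) ∂μ) =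
      ∫⁻ y, (∫⁻ x in nearSet Ω σ y,
        ENNReal.ofReal (|inner ℝ (σ y) (x - y)| * regularKernel (a n) (x - y))) ∂μ := by
    intro n
    have hpc := continuous_regularKernel (ha1 n)
    have hs := hasCompactSupport_regularKernel (ha1 n)
    have h0 := regularKernel_nonneg (ha1 n)
    have hnn : ∀ x y : Plane, 0 ≤ |inner ℝ (σ y) (x - y)| * regularKernel (a n) (x - y) :=
      fun x y => mul_nonneg (abs_nonneg _) (h0 _)
    rw [ofReal_integral_eq_lintegral_ofReal (h.integrable_near hΩ hpc hs)
      (ae_of_all _ fun y => integral_nonneg fun x => hnn x y)]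
    refine lintegral_congr fun y => ?_
    rw [ofReal_integral_eq_lintegral_ofReal _ (ae_of_all _ fun x => hnn x y)]
    refine Integrable.integrableOn ?_
    have hc : Continuous fun z : Plane => |inner ℝ (σ y) z| * regularKernel (a n) z := by fun_prop
    exact (hc.integrable_of_hasCompactSupport hs.mul_left).comp_sub_right y
  simp_rw [e, h.nearTerm_eq hΩ]
  have hle : ∀ n (z : Plane) (y : Plane), ENNReal.ofReal (|inner ℝ (σ y) z| * regularKernel (a n) z) ≤
      ENNReal.ofReal (|inner ℝ (σ y) z| / ‖z‖ ^ 3) := fun n z y => by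
    refine ENNReal.ofReal_le_ofReal ?_
    rw [div_eq_mul_inv]
    exact mul_le_mul_of_nonneg_left (regularKernel_le _ _) (abs_nonneg _)
  refine tendsto_lintegral_of_le_of_tendsto (fun n => ?_)
    (fun n => ae_of_all _ fun y => lintegral_mono fun x => hle n (x - y) y)
    (ae_of_all _ fun y => tendsto_lintegral_of_le_of_tendsto (fun n => ?_)
      (fun n => ae_of_all _ fun x => hle n (x - y) y) (ae_of_all _ fun x => ?_))
  · have hpc := continuous_regularKernel (ha1 n)
    have hS := measurableSet_nearSet_prod hΩ hm
    have hmeas : Measurable fun q : Plane × Plane =>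
        ENNReal.ofReal (|inner ℝ (σ q.1) (q.2 - q.1)| * regularKernel (a n) (q.2 - q.1)) := by
      fun_prop
    have h1 := (hmeas.indicator hS).lintegral_prod_right' (ν := (volume : Measure Plane))
    convert h1 using 2 with y
    rw [← lintegral_indicator (measurableSet_nearSet hΩ σ y)]
    rfl
  · have hpc := continuous_regularKernel (ha1 n)
    fun_prop
  · refine (ENNReal.continuous_ofReal.tendsto _).comp ?_
    rw [div_eq_mul_inv]
    exact (tendsto_regularKernel ha (x - y)).const_mul _

theorem tendsto_far (h : IsGaussGreenPair Ω μ σ) (hΩ : MeasurableSet Ω) (hv : volume Ω ≠ ∞)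
    (ha1 : ∀ n, 1 ≤ a n) (ha : Tendsto a atTop atTop) :
    Tendsto (fun n => ∫ y, (∫ x in Ω \ Metric.ball y 1,
      inner ℝ (σ y) (x - y) * regularKernel (a n) (x - y)) ∂μ) atTop (𝓝 (farTerm Ω)) := by
  have hfin := h.finite
  rw [h.farTerm_eq hΩ]
  have hvy : ∀ y : Plane, volume (Ω \ Metric.ball y 1) ≠ ∞ := fun y =>
    measure_ne_top_of_subset Set.sdiff_subset hv
  have hmy : ∀ y : Plane, MeasurableSet (Ω \ Metric.ball y 1) := fun y =>
    hΩ.diff Metric.isOpen_ball.measurableSet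
  have hb : ∀ n y, ‖σ y‖ = 1 → ∀ x ∈ Ω \ Metric.ball y 1,
      ‖inner ℝ (σ y) (x - y) * regularKernel (a n) (x - y)‖ ≤ 1 := by
    intro n y hy x hx
    have hx1 : 1 ≤ ‖x - y‖ := by
      rw [← dist_eq_norm]
      exact not_lt.1 hx.2
    have hx0 : 0 < ‖x - y‖ := by linarith
    rw [norm_mul, Real.norm_of_nonneg (regularKernel_nonneg (ha1 n) _)]
    have h1 : ‖inner ℝ (σ y) (x - y)‖ ≤ ‖x - y‖ := by
      simpa [hy] using abs_real_inner_le_norm (σ y) (x - y)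
    calc _ ≤ ‖x - y‖ * (‖x - y‖ ^ 3)⁻¹ :=
          mul_le_mul h1 (regularKernel_le _ _) (regularKernel_nonneg (ha1 n) _) hx0.le
      _ ≤ 1 := by
          rw [← div_eq_mul_inv, div_le_one (by positivity)]
          calc ‖x - y‖ = ‖x - y‖ ^ 1 := (pow_one _).symm
            _ ≤ _ := pow_le_pow_right₀ hx1 (by norm_num)
  refine tendsto_integral_of_dominated_convergence (fun _ => volume.real Ω)
    (fun n => (h.integrable_inner_section (continuous_regularKernel (ha1 n))
      (hasCompactSupport_regularKernel (ha1 n)) (measurableSet_diff_ball_prod hΩ)).1)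
    (integrable_const _) (fun n => ?_) ?_
  · filter_upwards [h.unit] with y hy
    refine (norm_setIntegral_le_of_norm_le_const (hvy y).lt_top (hb n y hy)).trans ?_
    rw [one_mul]
    exact measureReal_mono Set.sdiff_subset hv
  · filter_upwards [h.unit] with y hy
    refine tendsto_integral_of_dominated_convergence (fun _ => 1) (fun n => ?_)
      (integrableOn_const (hvy y)) (fun n => ?_) (ae_of_all _ fun x => ?_)
    · have hpc := continuous_regularKernel (ha1 n)
      exact Continuous.aestronglyMeasurable (by fun_prop)
    · exact (ae_restrict_iff' (hmy y)).2 (ae_of_all _ (hb n y hy))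
    · rw [div_eq_mul_inv]
      exact (tendsto_regularKernel ha (x - y)).const_mul _

theorem tendsto_defect (h : IsGaussGreenPair Ω μ σ) (hΩ : MeasurableSet Ω) (hv : volume Ω ≠ ∞)
    (ha1 : ∀ n, 1 ≤ a n) (ha : Tendsto a atTop atTop) :
    Tendsto (fun n => ENNReal.ofReal (∫ z in Metric.ball (0 : Plane) 1,
        (directionalVariation μ σ z - translationDefect Ω z) / 4 * regularKernel (a n) z)) atTop
      (𝓝 (∫⁻ z in Metric.ball (0 : Plane) 1, ENNReal.ofReal (defectDensity Ω μ σ z))) := by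
  have hg := measurable_translationDefect hΩ
  have hV := h.measurable_directionalVariation
  have h0 : ∀ z, 0 ≤ (directionalVariation μ σ z - translationDefect Ω z) / 4 := fun z =>
    div_nonneg (sub_nonneg.2 (h.translationDefect_le_directionalVariation hΩ hv z)) (by norm_num)
  have hdd : ∀ z, defectDensity Ω μ σ z =
      (directionalVariation μ σ z - translationDefect Ω z) / 4 * (‖z‖ ^ 3)⁻¹ := fun z => by
    rw [defectDensity, ← div_div, div_eq_mul_inv _ (‖z‖ ^ 3)]
  have e : ∀ n, ENNReal.ofReal (∫ z in Metric.ball (0 : Plane) 1,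
        (directionalVariation μ σ z - translationDefect Ω z) / 4 * regularKernel (a n) z) =
      ∫⁻ z in Metric.ball (0 : Plane) 1, ENNReal.ofReal
        ((directionalVariation μ σ z - translationDefect Ω z) / 4 * regularKernel (a n) z) := by
    intro n
    refine ofReal_integral_eq_lintegral_ofReal (Integrable.integrableOn ?_)
      (ae_of_all _ fun z => mul_nonneg (h0 z) (regularKernel_nonneg (ha1 n) z))
    refine integrable_mul_regularKernel (c := μ.real Set.univ) (by fun_prop) (fun z => ?_) (ha1 n)
    rw [abs_of_nonneg (h0 z)]
    have h1 := translationDefect_nonneg Ω z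
    have h2 := h.directionalVariation_le z
    have h3 := directionalVariation_nonneg μ σ z
    linarith
  simp_rw [e]
  refine tendsto_lintegral_of_le_of_tendsto (fun n => ?_) (fun n => ae_of_all _ fun z => ?_)
    (ae_of_all _ fun z => ?_)
  · have hpc := continuous_regularKernel (ha1 n)
    fun_prop
  · refine ENNReal.ofReal_le_ofReal ?_
    rw [hdd]
    exact mul_le_mul_of_nonneg_left (regularKernel_le _ _) (h0 z)
  · refine (ENNReal.continuous_ofReal.tendsto _).comp ?_
    rw [hdd]
    exact (tendsto_regularKernel ha z).const_mul _

theorem tendsto_farDefect (hΩ : MeasurableSet Ω) (hv : volume Ω ≠ ∞)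
    (ha1 : ∀ n, 1 ≤ a n) (ha : Tendsto a atTop atTop) :
    Tendsto (fun n => ∫ z in (Metric.ball (0 : Plane) 1)ᶜ,
      translationDefect Ω z / 4 * regularKernel (a n) z) atTop (𝓝 (farDefect Ω)) := by
  have hg := measurable_translationDefect hΩ
  have e : ∀ z, translationDefect Ω z / (4 * ‖z‖ ^ 3) =
      translationDefect Ω z / 4 * (‖z‖ ^ 3)⁻¹ := fun z => by
    rw [← div_div, div_eq_mul_inv _ (‖z‖ ^ 3)]
  have h0 : ∀ z, 0 ≤ translationDefect Ω z / 4 := fun z =>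
    div_nonneg (translationDefect_nonneg _ _) (by norm_num)
  refine tendsto_integral_of_dominated_convergence
    (fun z => translationDefect Ω z / (4 * ‖z‖ ^ 3)) (fun n => ?_)
    (integrableOn_translationDefect_compl_ball hΩ hv) (fun n => ae_of_all _ fun z => ?_)
    (ae_of_all _ fun z => ?_)
  · have hpc := continuous_regularKernel (ha1 n)
    exact Measurable.aestronglyMeasurable (by fun_prop)
  · rw [e, Real.norm_of_nonneg (mul_nonneg (h0 z) (regularKernel_nonneg (ha1 n) z))]
    exact mul_le_mul_of_nonneg_left (regularKernel_le _ _) (h0 z)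
  · rw [e]
    exact (tendsto_regularKernel ha z).const_mul _

theorem limitEnergy_eq (h : IsGaussGreenPair Ω μ σ) (hΩ : MeasurableSet Ω) (hv : volume Ω ≠ ∞) :
    limitEnergy Ω = ((∫⁻ z in Metric.ball (0 : Plane) 1,
      ENNReal.ofReal (defectDensity Ω μ σ z) : ℝ≥0∞) : EReal) + ((-farDefect Ω : ℝ) : EReal) := by
  set a : ℕ → ℝ := fun n => (n : ℝ) + 1 with hadef
  have ha1 : ∀ n, 1 ≤ a n := fun n => by simp [hadef]
  have ha0 : ∀ n, 0 < a n := fun n => by linarith [ha1 n]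
  have ha : Tendsto a atTop atTop := tendsto_atTop_add_const_right _ _ tendsto_natCast_atTop_atTop
  set D := ∫⁻ z in Metric.ball (0 : Plane) 1, ENNReal.ofReal (defectDensity Ω μ σ z) with hD
  set P := μ.real Set.univ with hP
  have hreal := ((tendsto_farDefect hΩ hv ha1 ha).neg.add
    (((h.tendsto_ringWeight_atTop hΩ hv ha0 ha).sub (tendsto_ringWeight_zero hΩ hv
      (fun n => inv_pos.2 (ha0 n)) (tendsto_inv_atTop_zero.comp ha))).const_mul 4⁻¹)).sub
    ((h.tendsto_far hΩ hv ha1 ha).const_mul 2⁻¹)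
  have hlhs : Tendsto (fun n => ((2⁻¹ * ENNReal.ofReal (∫ y, (∫ x in nearSet Ω σ y,
      |inner ℝ (σ y) (x - y)| * regularKernel (a n) (x - y)) ∂μ) : ℝ≥0∞) : EReal)) atTop
      (𝓝 ((2⁻¹ * nearTerm Ω : ℝ≥0∞) : EReal)) :=
    (continuous_coe_ennreal_ereal.tendsto _).comp
      (ENNReal.Tendsto.const_mul (h.tendsto_near hΩ ha1 ha) (Or.inr (by simp)))
  have hrhs := (EReal.continuousAt_add (p := ((D : EReal), ((-farDefect Ω + 4⁻¹ * (4 * P - 0) -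
      2⁻¹ * farTerm Ω : ℝ) : EReal)))
    (Or.inr (EReal.coe_ne_bot _)) (Or.inr (EReal.coe_ne_top _))).tendsto.comp
    (((continuous_coe_ennreal_ereal.tendsto _).comp (h.tendsto_defect hΩ hv ha1 ha)).prodMk_nhds
      ((continuous_coe_real_ereal.tendsto _).comp hreal))
  have hnear := tendsto_nhds_unique (hlhs.congr fun n => ?_) hrhs
  · rw [limitEnergy, hnear, h.perimeter_eq]
    simp only
    rw [← add_assoc, add_comm _ (D : EReal), add_assoc, ← EReal.coe_add]
    congr 2
    rw [← measureReal_def, ← hP]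
    ring
  · have hid := h.regular_identity hΩ hv (ha1 n)
    simp only [Function.comp_apply]
    have h2 : (2⁻¹ : ℝ≥0∞) = ENNReal.ofReal 2⁻¹ := by
      rw [ENNReal.ofReal_inv_of_pos two_pos, ENNReal.ofReal_ofNat]
    have hnn : 0 ≤ ∫ y, (∫ x in nearSet Ω σ y,
        |inner ℝ (σ y) (x - y)| * regularKernel (a n) (x - y)) ∂μ :=
      integral_nonneg fun y => integral_nonneg fun x =>
        mul_nonneg (abs_nonneg _) (regularKernel_nonneg (ha1 n) _)
    have hnn2 : 0 ≤ ∫ z in Metric.ball (0 : Plane) 1,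
        (directionalVariation μ σ z - translationDefect Ω z) / 4 * regularKernel (a n) z :=
      integral_nonneg fun z => mul_nonneg (div_nonneg (sub_nonneg.2
        (h.translationDefect_le_directionalVariation hΩ hv z)) (by norm_num))
        (regularKernel_nonneg (ha1 n) z)
    rw [h2, ← ENNReal.ofReal_mul (by norm_num), EReal.coe_ennreal_ofReal, EReal.coe_ennreal_ofReal,
      max_eq_left (by positivity), max_eq_left hnn2, ← EReal.coe_add, hid]

end IsGaussGreenPair

end DipolarDrop

end

noncomputable section

namespace DipolarDrop

variable {Ω Ω' : Set Plane} {μ : Measure Plane} {σ : Plane → Plane}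

theorem perimeter_congr (h : Ω =ᵐ[volume] Ω') : perimeter Ω = perimeter Ω' := by
  simp only [perimeter, setIntegral_congr_set h]

theorem isGaussGreenPair_congr (h : Ω =ᵐ[volume] Ω') :
    IsGaussGreenPair Ω μ σ ↔ IsGaussGreenPair Ω' μ σ := by
  constructor
  · intro H
    exact ⟨H.1, H.2, H.3, fun φ hφ => by rw [← setIntegral_congr_set h, H.4 φ hφ]⟩
  · intro H
    exact ⟨H.1, H.2, H.3, fun φ hφ => by rw [setIntegral_congr_set h, H.4 φ hφ]⟩

theorem hasOuterNormal_congr (h : Ω =ᵐ[volume] Ω') : HasOuterNormal Ω = HasOuterNormal Ω' := by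
  funext y ν
  simp only [HasOuterNormal, isGaussGreenPair_congr h]

theorem reducedBoundary_congr (h : Ω =ᵐ[volume] Ω') : reducedBoundary Ω = reducedBoundary Ω' := by
  simp only [reducedBoundary, hasOuterNormal_congr h]

theorem outerNormal_congr (h : Ω =ᵐ[volume] Ω') : outerNormal Ω = outerNormal Ω' := by
  funext y
  unfold outerNormal
  rw [hasOuterNormal_congr h]

theorem limitEnergy_congr (h : Ω =ᵐ[volume] Ω') : limitEnergy Ω = limitEnergy Ω' := by
  have h1 : nearTerm Ω = nearTerm Ω' := by
    simp only [nearTerm, reducedBoundary_congr h, boundaryKernel, halfPlane, outerNormal_congr h]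
    refine lintegral_congr fun y => setLIntegral_congr ?_
    exact (ae_eq_set_symmDiff h (ae_eq_refl _)).inter (ae_eq_refl _)
  have h2 : farTerm Ω = farTerm Ω' := by
    simp only [farTerm, reducedBoundary_congr h, boundaryKernel, outerNormal_congr h]
    refine integral_congr_ae (ae_of_all _ fun y => setIntegral_congr_set ?_)
    exact h.diff (ae_eq_refl _)
  rw [limitEnergy, limitEnergy, perimeter_congr h, h1, h2]

theorem charFn_congr (h : Ω =ᵐ[volume] Ω') : charFn Ω =ᵐ[volume] charFn Ω' :=
  indicator_ae_eq_of_ae_eq_set h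

theorem scaledEnergy_congr (h : Ω =ᵐ[volume] Ω') (δ : ℝ) : scaledEnergy δ Ω = scaledEnergy δ Ω' := by
  rw [scaledEnergy, scaledEnergy, energy, energy, perimeter_congr h]
  congr 3
  refine integral_congr_ae ?_
  filter_upwards [charFn_congr h] with x hx
  refine integral_congr_ae ?_
  have h1 := (measurePreserving_add_left volume x).quasiMeasurePreserving.ae (charFn_congr h)
  filter_upwards [h1] with z hz
  rw [hx, hz]

theorem exists_measurableSet_admissible {m : ℝ} (hΩ : Ω ∈ admissible m) :
    ∃ Ω', MeasurableSet Ω' ∧ Ω' ∈ admissible m ∧ Ω =ᵐ[volume] Ω' := by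
  obtain ⟨Ω', -, h1, h2⟩ := hΩ.1.exists_measurable_superset_ae_eq
  refine ⟨Ω', h1, ⟨h1.nullMeasurableSet, ?_, ?_⟩, h2.symm⟩
  · rw [perimeter_congr h2]; exact hΩ.2.1
  · rw [measure_congr h2]; exact hΩ.2.2

theorem SetTendsto.congr {Ωs Ωs' : ℕ → Set Plane} (h : SetTendsto Ωs Ω)
    (hs : ∀ n, Ωs n =ᵐ[volume] Ωs' n) (hΩ : Ω =ᵐ[volume] Ω') : SetTendsto Ωs' Ω' := by
  refine Tendsto.congr (fun n => ?_) h
  exact measure_congr (ae_eq_set_symmDiff (hs n) hΩ)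

theorem integral_abs_charFn_sub (hΩ : MeasurableSet Ω) (hΩ' : MeasurableSet Ω') :
    ∫ x, |charFn Ω x - charFn Ω' x| = volume.real (symmDiff Ω Ω') := by
  rw [← integral_charFn (hΩ.symmDiff hΩ')]
  refine integral_congr_ae (ae_of_all _ fun x => ?_)
  by_cases h1 : x ∈ Ω <;> by_cases h2 : x ∈ Ω' <;> simp [charFn, h1, h2, Set.mem_symmDiff]

theorem abs_setIntegral_sub_le (hΩ : MeasurableSet Ω) (hv : volume Ω ≠ ∞) (hΩ' : MeasurableSet Ω')
    (hv' : volume Ω' ≠ ∞) {f : Plane → ℝ} (hf : Measurable f) {c : ℝ} (hc : ∀ x, |f x| ≤ c) :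
    |(∫ x in Ω, f x) - ∫ x in Ω', f x| ≤ c * volume.real (symmDiff Ω Ω') := by
  have hi := (integrable_charFn hΩ hv).bdd_mul hf.aestronglyMeasurable (ae_of_all _ hc)
  have hi' := (integrable_charFn hΩ' hv').bdd_mul hf.aestronglyMeasurable (ae_of_all _ hc)
  rw [← integral_mul_charFn hΩ, ← integral_mul_charFn hΩ', ← integral_sub hi hi',
    ← integral_abs_charFn_sub hΩ hΩ', ← integral_const_mul, ← Real.norm_eq_abs]
  refine norm_integral_le_of_norm_le
    (((integrable_charFn hΩ hv).sub (integrable_charFn hΩ' hv')).abs.const_mul c)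
    (ae_of_all _ fun x => ?_)
  rw [← mul_sub, norm_mul]
  exact mul_le_mul_of_nonneg_right (hc x) (norm_nonneg _)

theorem abs_translationDefect_sub_le (hΩ : MeasurableSet Ω) (hv : volume Ω ≠ ∞)
    (hΩ' : MeasurableSet Ω') (hv' : volume Ω' ≠ ∞) (z : Plane) :
    |translationDefect Ω z - translationDefect Ω' z| ≤ 2 * volume.real (symmDiff Ω Ω') := by
  have hi := integrable_charFn_sub hΩ hv z
  have hi' := integrable_charFn_sub hΩ' hv' z
  have hd : Integrable fun x => |charFn Ω x - charFn Ω' x| :=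
    ((integrable_charFn hΩ hv).sub (integrable_charFn hΩ' hv')).abs
  have hd2 : Integrable fun x => |charFn Ω (x + z) - charFn Ω' (x + z)| := hd.comp_add_right z
  rw [translationDefect, translationDefect, ← integral_sub hi.abs hi'.abs, two_mul]
  nth_rewrite 1 [← integral_abs_charFn_sub hΩ hΩ']
  rw [← integral_abs_charFn_sub hΩ hΩ',
    ← integral_add_right_eq_self (fun x => |charFn Ω x - charFn Ω' x|) z]
  nth_rewrite 2 [integral_add_right_eq_self (fun x => |charFn Ω x - charFn Ω' x|) z]
  rw [← integral_add hd2 hd, ← Real.norm_eq_abs]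
  refine norm_integral_le_of_norm_le (hd2.add hd) (ae_of_all _ fun x => ?_)
  refine (abs_abs_sub_abs_le_abs_sub _ _).trans ?_
  rw [show charFn Ω (x + z) - charFn Ω x - (charFn Ω' (x + z) - charFn Ω' x) =
    (charFn Ω (x + z) - charFn Ω' (x + z)) - (charFn Ω x - charFn Ω' x) by ring]
  exact abs_sub _ _

theorem SetTendsto.tendsto_real {Ωs : ℕ → Set Plane} (h : SetTendsto Ωs Ω) :
    Tendsto (fun n => volume.real (symmDiff (Ωs n) Ω)) atTop (𝓝 0) := by
  exact (ENNReal.tendsto_toReal (by simp : (0 : ℝ≥0∞) ≠ ∞)).comp h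

/-- Lower semicontinuity of the perimeter. -/
theorem SetTendsto.eventually_lt_perimeter {Ωs : ℕ → Set Plane} (h : SetTendsto Ωs Ω)
    (hΩ : MeasurableSet Ω) (hv : volume Ω ≠ ∞) (hΩs : ∀ n, MeasurableSet (Ωs n))
    (hvs : ∀ n, volume (Ωs n) ≠ ∞) {c : ℝ≥0∞} (hc : c < perimeter Ω) :
    ∀ᶠ n in atTop, c < perimeter (Ωs n) := by
  obtain ⟨φ, hφ⟩ := lt_iSup_iff.1 hc
  obtain ⟨hφ1, hφ2⟩ := lt_iSup_iff.1 hφ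
  have hdc := continuous_divergence hφ1.1.1
  obtain ⟨b, hb⟩ := hdc.bounded_above_of_compact_support (hasCompactSupport_divergence hφ1.1.2)
  have hlim : Tendsto (fun n => ∫ x in Ωs n, divergence φ x) atTop
      (𝓝 (∫ x in Ω, divergence φ x)) := by
    rw [tendsto_iff_norm_sub_tendsto_zero]
    refine squeeze_zero (fun _ => norm_nonneg _) (fun n => abs_setIntegral_sub_le (hΩs n) (hvs n) hΩ hv
      hdc.measurable hb) ?_
    simpa using h.tendsto_real.const_mul b
  have h2 := ((ENNReal.continuous_ofReal.tendsto _).comp hlim).eventually (lt_mem_nhds hφ2)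
  filter_upwards [h2] with n hn
  exact hn.trans_le (le_iSup₂ (f := fun (φ : Plane → Plane) (_ : IsTestField φ ∧ ∀ x, ‖φ x‖ ≤ 1) =>
    ENNReal.ofReal (∫ x in Ωs n, divergence φ x)) φ hφ1)

theorem SetTendsto.tendsto_integral_translationDefect {Ωs : ℕ → Set Plane} (h : SetTendsto Ωs Ω)
    (hΩ : MeasurableSet Ω) (hv : volume Ω ≠ ∞) (hΩs : ∀ n, MeasurableSet (Ωs n))
    (hvs : ∀ n, volume (Ωs n) ≠ ∞) {δ : ℝ} (hδ : 0 < δ) :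
    Tendsto (fun n => ∫ z, translationDefect (Ωs n) z * truncatedKernel δ z) atTop
      (𝓝 (∫ z, translationDefect Ω z * truncatedKernel δ z)) := by
  rw [tendsto_iff_norm_sub_tendsto_zero]
  have h1 : Tendsto (fun n => 2 * volume.real (symmDiff (Ωs n) Ω) * ∫ z, truncatedKernel δ z) atTop
      (𝓝 0) := by
    simpa using (h.tendsto_real.const_mul 2).mul_const (∫ z, truncatedKernel δ z)
  refine squeeze_zero (fun _ => norm_nonneg _) (fun n => ?_) h1
  rw [← integral_sub (integrable_translationDefect_mul_truncatedKernel (hΩs n) (hvs n) hδ)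
    (integrable_translationDefect_mul_truncatedKernel hΩ hv hδ), ← integral_const_mul]
  refine norm_integral_le_of_norm_le ((integrable_truncatedKernel hδ).const_mul _)
    (ae_of_all _ fun z => ?_)
  rw [← sub_mul, norm_mul, Real.norm_of_nonneg (truncatedKernel_nonneg δ z)]
  exact mul_le_mul_of_nonneg_right (abs_translationDefect_sub_le (hΩs n) (hvs n) hΩ hv z)
    (truncatedKernel_nonneg δ z)

theorem SetTendsto.eventually_lt_scaledEnergy {Ωs : ℕ → Set Plane} (h : SetTendsto Ωs Ω)
    (hΩ : MeasurableSet Ω) (hv : volume Ω ≠ ∞) (hΩs : ∀ n, MeasurableSet (Ωs n))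
    (hvs : ∀ n, volume (Ωs n) ≠ ∞) (hPs : ∀ n, perimeter (Ωs n) ≠ ∞) {δ : ℝ}
    (hδ : δ ∈ Set.Ioo (0 : ℝ) 1) {c : ℝ} (hc : c < scaledEnergy δ Ω) :
    ∀ᶠ n in atTop, c < scaledEnergy δ (Ωs n) := by
  have hl : 0 < |Real.log δ| := abs_pos.2 (Real.log_neg hδ.1 hδ.2).ne
  have hlim := h.tendsto_integral_translationDefect hΩ hv hΩs hvs hδ.1
  set ε : ℝ := scaledEnergy δ Ω - c with hε
  have hε0 : 0 < ε := by rw [hε]; linarith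
  have h1 : ∀ᶠ n in atTop, (perimeter Ω).toReal - ε / (2 * |Real.log δ|) ≤
      (perimeter (Ωs n)).toReal := by
    rcases le_or_gt ((perimeter Ω).toReal - ε / (2 * |Real.log δ|)) 0 with h0 | h0
    · exact Eventually.of_forall fun n => h0.trans ENNReal.toReal_nonneg
    · have hPne : perimeter Ω ≠ ∞ := by
        intro hP
        rw [hP] at h0
        simp only [ENNReal.toReal_top] at h0
        have : 0 < ε / (2 * |Real.log δ|) := by positivity
        linarith
      have hlt : ENNReal.ofReal ((perimeter Ω).toReal - ε / (2 * |Real.log δ|)) < perimeter Ω := by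
        rw [ENNReal.ofReal_lt_iff_lt_toReal h0.le hPne]
        have : 0 < ε / (2 * |Real.log δ|) := by positivity
        linarith
      filter_upwards [h.eventually_lt_perimeter hΩ hv hΩs hvs hlt] with n hn
      rw [ENNReal.ofReal_lt_iff_lt_toReal h0.le (hPs n)] at hn
      exact hn.le
  have h2 := hlim.eventually (gt_mem_nhds (show _ < (∫ z, translationDefect Ω z * truncatedKernel δ z) + ε by
    linarith))
  filter_upwards [h1, h2] with n hn1 hn2
  rw [scaledEnergy_eq hΩ hv hδ] at hε
  rw [scaledEnergy_eq (hΩs n) (hvs n) hδ]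
  have h3 := mul_le_mul_of_nonneg_left hn1 hl.le
  have h4 : |Real.log δ| * (ε / (2 * |Real.log δ|)) = ε / 2 := by field_simp
  rw [mul_sub, h4] at h3
  linarith

end DipolarDrop

end

noncomputable section

namespace DipolarDrop

variable {Ω Ω' : Set Plane} {μ : Measure Plane} {σ : Plane → Plane}

theorem exists_subseq_tendsto_volume_inter {A : ℕ → Set Plane} (hA : ∀ n, MeasurableSet (A n))
    {M : ℝ≥0∞} (hM : M ≠ ∞) (hAM : ∀ n, volume (A n) ≤ M) :
    ∃ k : ℕ → ℕ, StrictMono k ∧ ∀ B : Set Plane, MeasurableSet B → volume B ≠ ∞ →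
      ∃ l : ℝ, Tendsto (fun n => volume.real (A (k n) ∩ B)) atTop (𝓝 l) := by
  have : Fact ((2 : ℝ≥0∞) ≠ ∞) := ⟨by norm_num⟩
  have hfin : ∀ n, volume (A n) ≠ ∞ := fun n => ((hAM n).trans_lt hM.lt_top).ne
  set f : ℕ → Lp ℝ 2 (volume : Measure Plane) := fun n => indicatorConstLp 2 (hA n) (hfin n) 1 with hf
  have hn : ∀ n, ‖f n‖ ≤ M.toReal ^ (1 / (2 : ℝ≥0∞).toReal) := fun n => by
    rw [hf, norm_indicatorConstLp (by norm_num) (by norm_num), norm_one, one_mul]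
    refine Real.rpow_le_rpow measureReal_nonneg (ENNReal.toReal_mono hM (hAM n)) ?_
    positivity
  obtain ⟨x, -, k, hk, hlim⟩ := WeakDual.isSeqCompact_closedBall ℝ (Lp ℝ 2 (volume : Measure Plane)) 0
    (M.toReal ^ (1 / (2 : ℝ≥0∞).toReal))
    (x := fun n => StrongDual.toWeakDual (innerSL ℝ (f n))) (fun n => by
      change innerSL ℝ (f n) ∈ Metric.closedBall 0 _
      rw [mem_closedBall_zero_iff, innerSL_apply_norm]
      exact hn n)
  refine ⟨k, hk, fun B hB hvB => ⟨x (indicatorConstLp 2 hB hvB 1), ?_⟩⟩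
  have h1 := ((WeakDual.eval_continuous (𝕜 := ℝ)
    (indicatorConstLp 2 hB hvB (1 : ℝ) : Lp ℝ 2 (volume : Measure Plane))).tendsto x).comp hlim
  refine h1.congr fun n => ?_
  change inner ℝ (f (k n)) (indicatorConstLp 2 hB hvB (1 : ℝ)) = _
  exact L2.real_inner_indicatorConstLp_one_indicatorConstLp_one (hA (k n)) hB (hfin (k n)) hvB

theorem setIntegral_charFn_translate (hΩ : MeasurableSet Ω) (ρ : ℝ) (x : Plane) :
    ∫ z in Metric.ball (0 : Plane) ρ, charFn Ω (x + z) = volume.real (Ω ∩ Metric.ball x ρ) := by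
  rw [← integral_charFn (hΩ.inter Metric.isOpen_ball.measurableSet),
    ← integral_indicator Metric.isOpen_ball.measurableSet,
    ← integral_add_left_eq_self (charFn (Ω ∩ Metric.ball x ρ)) x]
  refine integral_congr_ae (ae_of_all _ fun z => ?_)
  by_cases hz : ‖z‖ < ρ <;> by_cases hx : x + z ∈ Ω <;>
    simp [charFn, Set.indicator, hz, hx]

theorem measurable_volume_inter_ball (hΩ : MeasurableSet Ω) (ρ : ℝ) :
    Measurable fun x => volume.real (Ω ∩ Metric.ball x ρ) := by
  have hm := measurable_charFn hΩ
  simp_rw [← setIntegral_charFn_translate hΩ]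
  refine (StronglyMeasurable.integral_prod_right' (f := fun p : Plane × Plane =>
    charFn Ω (p.1 + p.2)) ?_).measurable
  exact Measurable.stronglyMeasurable (by fun_prop)

theorem charFn_mul_sub_volume_inter_ball (hΩ : MeasurableSet Ω) (ρ : ℝ) (x : Plane) :
    volume.real (Metric.ball (0 : Plane) ρ) * charFn Ω x - volume.real (Ω ∩ Metric.ball x ρ) =
      ∫ z in Metric.ball (0 : Plane) ρ, (charFn Ω x - charFn Ω (x + z)) := by
  have hb : volume (Metric.ball (0 : Plane) ρ) ≠ ∞ := volume_ball_ne_top _ _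
  have h1 : IntegrableOn (fun z => charFn Ω (x + z)) (Metric.ball (0 : Plane) ρ) := by
    have hm := measurable_charFn hΩ
    refine Measure.integrableOn_of_bounded hb (M := 1)
      (Measurable.aestronglyMeasurable (by fun_prop)) (ae_of_all _ fun z => ?_)
    rw [Real.norm_of_nonneg (charFn_nonneg _ _)]
    exact charFn_le_one _ _
  have h0 : IntegrableOn (fun _ => charFn Ω x) (Metric.ball (0 : Plane) ρ) := integrableOn_const hb
  rw [integral_sub h0 h1, setIntegral_charFn_translate hΩ, setIntegral_const, smul_eq_mul]

theorem integral_abs_charFn_sub_average_le (hΩ : MeasurableSet Ω) (hv : volume Ω ≠ ∞)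
    (hP : perimeter Ω ≠ ∞) (ρ : ℝ) :
    ∫ x, |volume.real (Metric.ball (0 : Plane) ρ) * charFn Ω x - volume.real (Ω ∩ Metric.ball x ρ)| ≤
      volume.real (Metric.ball (0 : Plane) ρ) * (ρ * (perimeter Ω).toReal) := by
  have hm := measurable_charFn hΩ
  have hb : volume (Metric.ball (0 : Plane) ρ) ≠ ∞ := volume_ball_ne_top _ _
  have hbf : IsFiniteMeasure (volume.restrict (Metric.ball (0 : Plane) ρ)) :=
    ⟨by simpa using hb.lt_top⟩
  have hg := measurable_translationDefect hΩ
  have hgi : IntegrableOn (translationDefect Ω) (Metric.ball (0 : Plane) ρ) :=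
    Measure.integrableOn_of_bounded hb (M := 2 * volume.real Ω) hg.aestronglyMeasurable
      (ae_of_all _ fun z => by
        rw [Real.norm_of_nonneg (translationDefect_nonneg _ _)]
        exact translationDefect_le hΩ hv z)
  have hprod : Integrable (Function.uncurry fun x z : Plane => |charFn Ω (x + z) - charFn Ω x|)
      (volume.prod (volume.restrict (Metric.ball (0 : Plane) ρ))) := by
    refine (integrable_prod_iff' (Measurable.aestronglyMeasurable (by fun_prop))).2 ⟨?_, ?_⟩
    · exact ae_of_all _ fun z => (integrable_charFn_sub hΩ hv z).abs
    · refine hgi.congr (ae_of_all _ fun z => ?_)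
      simp [translationDefect, Function.uncurry]
  calc _ ≤ ∫ x, ∫ z in Metric.ball (0 : Plane) ρ, |charFn Ω (x + z) - charFn Ω x| := by
        refine integral_mono_of_nonneg (ae_of_all _ fun x => abs_nonneg _)
          hprod.integral_prod_left (ae_of_all _ fun x => ?_)
        simp only
        rw [charFn_mul_sub_volume_inter_ball hΩ]
        refine (abs_integral_le_integral_abs).trans (le_of_eq ?_)
        refine integral_congr_ae (ae_of_all _ fun z => ?_)
        exact abs_sub_comm _ _
    _ = ∫ z in Metric.ball (0 : Plane) ρ, translationDefect Ω z := by
        rw [integral_integral_swap hprod]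
        rfl
    _ ≤ ∫ z in Metric.ball (0 : Plane) ρ, ρ * (perimeter Ω).toReal := by
        refine setIntegral_mono_on hgi (integrableOn_const hb) Metric.isOpen_ball.measurableSet
          fun z hz => ?_
        refine (integral_abs_charFn_translate_sub_le hΩ hv hP z).trans ?_
        refine mul_le_mul_of_nonneg_right ?_ ENNReal.toReal_nonneg
        exact (mem_ball_zero_iff.1 hz).le
    _ = _ := by rw [setIntegral_const, smul_eq_mul]

theorem volume_inter_ball_le_indicator {R ρ : ℝ} (hR : Ω ⊆ Metric.ball 0 R) (x : Plane) :
    volume.real (Ω ∩ Metric.ball x ρ) ≤ (Metric.ball (0 : Plane) (R + ρ)).indicator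
      (fun _ => volume.real (Metric.ball (0 : Plane) R)) x := by
  by_cases hx : x ∈ Metric.ball (0 : Plane) (R + ρ)
  · rw [Set.indicator_of_mem hx]
    exact measureReal_mono (Set.inter_subset_left.trans hR) (volume_ball_ne_top _ _)
  · rw [Set.indicator_of_notMem hx]
    have : Ω ∩ Metric.ball x ρ = ∅ := by
      refine Set.eq_empty_of_forall_notMem fun w hw => hx ?_
      have h1 := mem_ball_zero_iff.1 (hR hw.1)
      have h2 := Metric.mem_ball'.1 hw.2
      rw [mem_ball_zero_iff]
      have h3 := dist_triangle x w 0
      rw [dist_zero_right, dist_zero_right] at h3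
      linarith
    simp [this]

theorem exists_subseq_cauchySeq {A : ℕ → Set Plane} (hA : ∀ n, MeasurableSet (A n)) {R C : ℝ}
    (hAR : ∀ n, A n ⊆ Metric.ball 0 R) (hPf : ∀ n, perimeter (A n) ≠ ∞)
    (hP : ∀ n, (perimeter (A n)).toReal ≤ C) :
    ∃ k : ℕ → ℕ, StrictMono k ∧ ∀ ε > 0, ∃ N, ∀ n ≥ N, ∀ l ≥ N,
      ∫ x, |charFn (A (k n)) x - charFn (A (k l)) x| < ε := by
  have hv : ∀ n, volume (A n) ≠ ∞ := fun n =>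
    measure_ne_top_of_subset (hAR n) (volume_ball_ne_top _ _)
  have hC : 0 ≤ C := ENNReal.toReal_nonneg.trans (hP 0)
  obtain ⟨k, hk, hlim⟩ := exists_subseq_tendsto_volume_inter hA (volume_ball_ne_top 0 R)
    fun n => measure_mono (hAR n)
  refine ⟨k, hk, fun ε hε => ?_⟩
  set ρ : ℝ := ε / (4 * (C + 1)) with hρ
  have hρ0 : 0 < ρ := by positivity
  set V : ℝ := volume.real (Metric.ball (0 : Plane) ρ) with hV
  have hV0 : 0 < V := by
    rw [hV, volume_real_ball _ hρ0.le]
    have := Real.pi_pos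
    positivity
  choose w hw using fun x : Plane => hlim (Metric.ball x ρ) Metric.isOpen_ball.measurableSet
    (volume_ball_ne_top x ρ)
  set W : ℕ → Plane → ℝ := fun n x => volume.real (A (k n) ∩ Metric.ball x ρ) with hW
  have hWm : ∀ n, Measurable (W n) := fun n => measurable_volume_inter_ball (hA (k n)) ρ
  have hwm : Measurable w :=
    measurable_of_tendsto_metrizable hWm (tendsto_pi_nhds.2 hw)
  set b : Plane → ℝ := (Metric.ball (0 : Plane) (R + ρ)).indicator
    (fun _ => volume.real (Metric.ball (0 : Plane) R)) with hb
  have hbi : Integrable b :=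
    (integrable_indicator_iff Metric.isOpen_ball.measurableSet).2
      (integrableOn_const (volume_ball_ne_top _ _))
  have hWb : ∀ n x, W n x ≤ b x := fun n x => volume_inter_ball_le_indicator (hAR (k n)) x
  have hW0 : ∀ n x, 0 ≤ W n x := fun n x => measureReal_nonneg
  have hwb : ∀ x, w x ≤ b x := fun x => le_of_tendsto' (hw x) fun n => hWb n x
  have hw0 : ∀ x, 0 ≤ w x := fun x => ge_of_tendsto' (hw x) fun n => hW0 n x
  have hWi : ∀ n, Integrable (W n) := fun n => hbi.mono' (hWm n).aestronglyMeasurable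
    (ae_of_all _ fun x => by rw [Real.norm_of_nonneg (hW0 n x)]; exact hWb n x)
  have hwi : Integrable w := hbi.mono' hwm.aestronglyMeasurable
    (ae_of_all _ fun x => by rw [Real.norm_of_nonneg (hw0 x)]; exact hwb x)
  have hconv : Tendsto (fun n => ∫ x, |W n x - w x|) atTop (𝓝 0) := by
    have h1 := tendsto_integral_of_dominated_convergence (F := fun n x => |W n x - w x|)
      (f := fun _ => (0 : ℝ)) b (fun n => ((hWi n).sub hwi).abs.1) hbi
      (fun n => ae_of_all _ fun x => ?_) (ae_of_all _ fun x => ?_)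
    · simpa using h1
    · rw [Real.norm_eq_abs, abs_abs, abs_le]
      exact ⟨by linarith [hW0 n x, hwb x], by linarith [hWb n x, hw0 x]⟩
    · have := ((hw x).sub_const (w x)).abs
      simpa using this
  obtain ⟨N, hN⟩ := eventually_atTop.1 (hconv.eventually (gt_mem_nhds
    (show 0 < V * ε / 8 by positivity)))
  have hχ : ∀ n, Integrable fun x => |V * charFn (A (k n)) x - W n x| := fun n =>
    (((integrable_charFn (hA _) (hv _)).const_mul V).sub (hWi n)).abs
  have hχb : ∀ n, ∫ x, |V * charFn (A (k n)) x - W n x| ≤ V * (ρ * C) := fun n =>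
    (integral_abs_charFn_sub_average_le (hA _) (hv _) (hPf _) ρ).trans (by
      have := hP (k n)
      gcongr)
  have hd : ∀ n, Integrable fun x => |W n x - w x| := fun n => ((hWi n).sub hwi).abs
  refine ⟨N, fun n hn l hl => ?_⟩
  have hs1 : Integrable fun x => |V * charFn (A (k n)) x - W n x| + |W n x - w x| :=
    (hχ n).add (hd n)
  have hs2 : Integrable fun x => |V * charFn (A (k l)) x - W l x| + |W l x - w x| :=
    (hχ l).add (hd l)
  have key : V * ∫ x, |charFn (A (k n)) x - charFn (A (k l)) x| ≤
      (∫ x, |V * charFn (A (k n)) x - W n x|) + (∫ x, |W n x - w x|) +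
        ((∫ x, |V * charFn (A (k l)) x - W l x|) + ∫ x, |W l x - w x|) := by
    rw [← integral_const_mul, ← integral_add (hχ n) (hd n), ← integral_add (hχ l) (hd l),
      ← integral_add hs1 hs2]
    refine integral_mono ((((integrable_charFn (hA _) (hv _)).sub
      (integrable_charFn (hA _) (hv _))).abs).const_mul V) (hs1.add hs2) fun x => ?_
    simp only
    rw [← abs_of_pos hV0, ← abs_mul, abs_of_pos hV0]
    have e : V * (charFn (A (k n)) x - charFn (A (k l)) x) =
        ((V * charFn (A (k n)) x - W n x) + (W n x - w x)) -
          ((V * charFn (A (k l)) x - W l x) + (W l x - w x)) := by ring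
    rw [e]
    exact (abs_sub _ _).trans (add_le_add (abs_add_le _ _) (abs_add_le _ _))
  have h1 := hN n hn
  have h2 := hN l hl
  have h3 := hχb n
  have h4 := hχb l
  have h5 : ρ * C ≤ ε / 4 := by
    rw [hρ, div_mul_eq_mul_div, div_le_div_iff₀ (by positivity) (by norm_num)]
    nlinarith
  have h6 : V * (ρ * C) ≤ V * (ε / 4) := mul_le_mul_of_nonneg_left h5 hV0.le
  have h7 : V * ∫ x, |charFn (A (k n)) x - charFn (A (k l)) x| < V * ε := by
    have : 0 < V * ε := by positivity
    linarith
  exact lt_of_mul_lt_mul_left h7 hV0.le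

theorem exists_subseq_setTendsto {A : ℕ → Set Plane} (hA : ∀ n, MeasurableSet (A n)) {R C : ℝ}
    (hAR : ∀ n, A n ⊆ Metric.ball 0 R) (hPf : ∀ n, perimeter (A n) ≠ ∞)
    (hP : ∀ n, (perimeter (A n)).toReal ≤ C) :
    ∃ (k : ℕ → ℕ) (Ω : Set Plane), StrictMono k ∧ MeasurableSet Ω ∧
      SetTendsto (fun n => A (k n)) Ω := by
  have hv : ∀ n, volume (A n) ≠ ∞ := fun n =>
    measure_ne_top_of_subset (hAR n) (volume_ball_ne_top _ _)
  obtain ⟨k, hk, hc⟩ := exists_subseq_cauchySeq hA hAR hPf hP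
  have hi : ∀ n, Integrable (charFn (A (k n))) := fun n => integrable_charFn (hA _) (hv _)
  set u : ℕ → Lp ℝ 1 (volume : Measure Plane) := fun n => (hi n).toL1 (charFn (A (k n))) with hu
  have hcs : CauchySeq u := by
    refine Metric.cauchySeq_iff.2 fun ε hε => ?_
    obtain ⟨N, hN⟩ := hc ε hε
    refine ⟨N, fun n hn l hl => ?_⟩
    rw [dist_eq_norm, hu, ← Integrable.toL1_sub, L1.norm_of_fun_eq_integral_norm]
    exact hN n hn l hl
  obtain ⟨f, hf⟩ := cauchySeq_tendsto_of_complete hcs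
  obtain ⟨ns, hns, hae⟩ := (tendstoInMeasure_of_tendsto_Lp hf).exists_seq_tendsto_ae
  have hall : ∀ᵐ x, ∀ n, u n x = charFn (A (k n)) x := ae_all_iff.2 fun n => (hi n).coeFn_toL1
  set Ω : Set Plane := {x | f x = 1} with hΩ
  have hfm : Measurable f := (Lp.stronglyMeasurable f).measurable
  have hΩm : MeasurableSet Ω := hfm (measurableSet_singleton 1)
  have h01 : ∀ᵐ x, f x = charFn Ω x := by
    filter_upwards [hae, hall] with x hx hx2
    have hmem : f x ∈ ({0, 1} : Set ℝ) := by
      refine (Set.toFinite {0, 1}).isClosed.mem_of_tendsto hx (Eventually.of_forall fun i => ?_)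
      rw [hx2]
      by_cases hxA : x ∈ A (k (ns i)) <;> simp [charFn, hxA]
    rcases hmem with h0 | h1
    · have : x ∉ Ω := fun hx => by
        have h1 : f x = 1 := hx
        rw [h0] at h1
        norm_num at h1
      rw [h0, charFn_of_notMem this]
    · have h1' : f x = 1 := h1
      rw [h1', charFn_of_mem h1']
  refine ⟨k, Ω, hk, hΩm, ?_⟩
  have h1 : Tendsto (fun n => edist (u n) f) atTop (𝓝 0) := tendsto_iff_edist_tendsto_0.1 hf
  refine h1.congr fun n => ?_
  rw [L1.edist_def, ← lintegral_indicator_one ((hA (k n)).symmDiff hΩm)]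
  refine lintegral_congr_ae ?_
  filter_upwards [hall, h01] with x hx hx2
  rw [hx, hx2]
  by_cases h1 : x ∈ A (k n) <;> by_cases h2 : x ∈ Ω <;>
    simp [charFn, h1, h2, Set.mem_symmDiff, edist_dist]

end DipolarDrop

end

noncomputable section

namespace DipolarDrop

variable {Ω : Set Plane} {m : ℝ}

theorem volume_ne_top_of_admissible (h : Ω ∈ admissible m) : volume Ω ≠ ∞ := by
  rw [h.2.2]; exact ENNReal.ofReal_ne_top

theorem antitoneOn_scaledEnergy_of_admissible (h : Ω ∈ admissible m) :
    AntitoneOn (fun δ => scaledEnergy δ Ω) (Set.Ioo 0 1) := by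
  obtain ⟨Ω', hm, h', he⟩ := exists_measurableSet_admissible h
  have hv := volume_ne_top_of_admissible h'
  obtain ⟨μ, σ, hp⟩ := exists_isGaussGreenPair hm hv h'.2.1.ne
  simp_rw [scaledEnergy_congr he]
  exact hp.antitoneOn_scaledEnergy hm hv

theorem tendsto_scaledEnergy_of_admissible (h : Ω ∈ admissible m) :
    Tendsto (fun δ => ((scaledEnergy δ Ω : ℝ) : EReal)) (𝓝[>] 0) (𝓝 (limitEnergy Ω)) := by
  obtain ⟨Ω', hm, h', he⟩ := exists_measurableSet_admissible h
  have hv := volume_ne_top_of_admissible h'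
  obtain ⟨μ, σ, hp⟩ := exists_isGaussGreenPair hm hv h'.2.1.ne
  simp_rw [scaledEnergy_congr he]
  rw [limitEnergy_congr he, hp.limitEnergy_eq hm hv]
  exact hp.tendsto_scaledEnergy hm hv

theorem limitEnergy_ne_bot (Ω : Set Plane) : limitEnergy Ω ≠ ⊥ := by
  rw [limitEnergy, Ne, EReal.add_eq_bot_iff]
  rintro (h | h)
  · exact EReal.coe_ne_bot _ h
  · exact EReal.coe_ennreal_ne_bot _ h

theorem limitEnergy_le_liminf {Ωs : ℕ → Set Plane} {δ : ℕ → ℝ} (h : Ω ∈ admissible m)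
    (hs : ∀ n, Ωs n ∈ admissible m) (hlim : SetTendsto Ωs Ω) (hδ0 : ∀ n, 0 < δ n)
    (hδ : Tendsto δ atTop (𝓝 0)) :
    limitEnergy Ω ≤ liminf (fun n => ((scaledEnergy (δ n) (Ωs n) : ℝ) : EReal)) atTop := by
  obtain ⟨Ω', hm, h', he⟩ := exists_measurableSet_admissible h
  choose A hAm hA hAe using fun n => exists_measurableSet_admissible (hs n)
  have hlim' : SetTendsto A Ω' := hlim.congr hAe he
  refine le_of_forall_lt fun c hc => ?_
  obtain ⟨c', hcc', hc'⟩ := EReal.lt_iff_exists_real_btwn.1 hc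
  have h1 := (tendsto_scaledEnergy_of_admissible h).eventually (lt_mem_nhds hc')
  obtain ⟨δ₀, hδ₀c, hδ₀⟩ := (h1.and (Ioo_mem_nhdsGT (zero_lt_one' ℝ))).exists
  have h2 : c' < scaledEnergy δ₀ Ω' := by
    rw [← scaledEnergy_congr he]
    exact EReal.coe_lt_coe_iff.1 hδ₀c
  have h3 := hlim'.eventually_lt_scaledEnergy hm (volume_ne_top_of_admissible h') hAm
    (fun n => volume_ne_top_of_admissible (hA n)) (fun n => (hA n).2.1.ne) hδ₀ h2
  refine hcc'.trans_le (le_liminf_of_le (by isBoundedDefault) ?_)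
  filter_upwards [h3, hδ.eventually (gt_mem_nhds hδ₀.1)] with n hn1 hn2
  rw [EReal.coe_le_coe_iff]
  refine hn1.le.trans ?_
  rw [← scaledEnergy_congr (hAe n)]
  exact antitoneOn_scaledEnergy_of_admissible (hs n) ⟨hδ0 n, hn2.trans hδ₀.2⟩ hδ₀ hn2.le

/-- The energy at a fixed scale controls the perimeter. -/
theorem perimeter_le_of_scaledEnergy_le (hΩ : MeasurableSet Ω) (h : Ω ∈ admissible m) (hm : 0 ≤ m)
    {δ c : ℝ} (hδ : δ ∈ Set.Ioo (0 : ℝ) 1) (hc : scaledEnergy δ Ω ≤ c) :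
    (perimeter Ω).toReal ≤ (c + m * ∫ z, truncatedKernel δ z) / |Real.log δ| := by
  have hl : 0 < |Real.log δ| := abs_pos.2 (Real.log_neg hδ.1 hδ.2).ne
  have hv := volume_ne_top_of_admissible h
  have hvm : volume.real Ω = m := by
    rw [measureReal_def, h.2.2, ENNReal.toReal_ofReal hm]
  have hK : 0 ≤ ∫ z, truncatedKernel δ z := integral_nonneg fun z => truncatedKernel_nonneg δ z
  have h1 : ∫ z, translationDefect Ω z * truncatedKernel δ z ≤
      (2 * m) * ∫ z, truncatedKernel δ z := by
    rw [← integral_const_mul]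
    refine integral_mono (integrable_translationDefect_mul_truncatedKernel hΩ hv hδ.1)
      ((integrable_truncatedKernel hδ.1).const_mul _) fun z => ?_
    have := translationDefect_le hΩ hv z
    rw [hvm] at this
    exact mul_le_mul_of_nonneg_right this (truncatedKernel_nonneg δ z)
  rw [scaledEnergy_eq hΩ hv hδ] at hc
  rw [le_div_iff₀ hl]
  have h2 : 0 ≤ m * ∫ z, truncatedKernel δ z := mul_nonneg hm hK
  linarith

theorem SetTendsto.volume_eq {A : ℕ → Set Plane} (h : SetTendsto A Ω) {v : ℝ≥0∞}
    (hv : ∀ n, volume (A n) = v) : volume Ω = v := by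
  have hle : ∀ S T : Set Plane, volume S ≤ volume T + volume (symmDiff T S) := fun S T => by
    refine (measure_mono fun x hx => ?_).trans (measure_union_le _ _)
    by_cases hT : x ∈ T
    · exact Or.inl hT
    · exact Or.inr (Or.inr ⟨hx, hT⟩)
  refine le_antisymm ?_ ?_
  · have h1 : Tendsto (fun n => v + volume (symmDiff (A n) Ω)) atTop (𝓝 (v + 0)) :=
      tendsto_const_nhds.add h
    rw [add_zero] at h1
    exact ge_of_tendsto' h1 fun n => by rw [← hv n]; exact hle _ _
  · have h1 : Tendsto (fun n => volume Ω + volume (symmDiff (A n) Ω)) atTop (𝓝 (volume Ω + 0)) :=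
      tendsto_const_nhds.add h
    rw [add_zero] at h1
    refine ge_of_tendsto' h1 fun n => ?_
    rw [← hv n, symmDiff_comm]
    exact hle _ _

theorem exists_subseq_of_limsup_scaledEnergy_lt_top {Ωs : ℕ → Set Plane} {δ : ℕ → ℝ} {R : ℝ}
    (hm : 0 ≤ m) (hs : ∀ n, Ωs n ∈ admissible m) (hδ0 : ∀ n, 0 < δ n)
    (hδ : Tendsto δ atTop (𝓝 0))
    (hsup : limsup (fun n => ((scaledEnergy (δ n) (Ωs n) : ℝ) : EReal)) atTop < ⊤)
    (hR : ∀ n, Ωs n ⊆ Metric.ball 0 R) :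
    ∃ (k : ℕ → ℕ) (Ω : Set Plane), StrictMono k ∧ Ω ∈ admissible m ∧
      SetTendsto (fun n => Ωs (k n)) Ω := by
  have hex : ∀ n, ∃ A, MeasurableSet A ∧ A ⊆ Metric.ball 0 R ∧ A ∈ admissible m ∧
      Ωs n =ᵐ[volume] A := by
    intro n
    obtain ⟨A, hAm, hA, hAe⟩ := exists_measurableSet_admissible (hs n)
    have he : Ωs n =ᵐ[volume] (A ∩ Metric.ball 0 R : Set Plane) := by
      have := hAe.inter (ae_eq_refl (Metric.ball (0 : Plane) R))
      rwa [Set.inter_eq_self_of_subset_left (hR n)] at this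
    have hmeas := hAm.inter (Metric.isOpen_ball (x := (0 : Plane)) (ε := R)).measurableSet
    refine ⟨A ∩ Metric.ball 0 R, hmeas, Set.inter_subset_right,
      ⟨hmeas.nullMeasurableSet, ?_, ?_⟩, he⟩
    · rw [← perimeter_congr he]; exact (hs n).2.1
    · rw [← measure_congr he]; exact (hs n).2.2
  choose A hAm hAR hA hAe using hex
  obtain ⟨c, hc, -⟩ := EReal.lt_iff_exists_real_btwn.1 hsup
  have hq : (1 / 4 : ℝ) ∈ Set.Ioo (0 : ℝ) 1 := by norm_num
  have hev : ∀ᶠ n in atTop, scaledEnergy (1 / 4) (A n) ≤ c := by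
    filter_upwards [eventually_lt_of_limsup_lt hc, hδ.eventually (gt_mem_nhds hq.1)] with n h1 h2
    rw [← scaledEnergy_congr (hAe n)]
    exact (antitoneOn_scaledEnergy_of_admissible (hs n) ⟨hδ0 n, h2.trans hq.2⟩ hq h2.le).trans
      (EReal.coe_lt_coe_iff.1 h1).le
  obtain ⟨N, hN⟩ := eventually_atTop.1 hev
  obtain ⟨k, Ω, hk, hΩ, hlim⟩ := exists_subseq_setTendsto (A := fun n => A (n + N))
    (fun n => hAm _) (fun n => hAR _) (fun n => (hA _).2.1.ne)
    fun n => perimeter_le_of_scaledEnergy_le (hAm _) (hA _) hm hq (hN (n + N) (by omega))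
  have hvol : volume Ω = ENNReal.ofReal m := hlim.volume_eq fun n => (hA _).2.2
  have hP : perimeter Ω ≤
      ENNReal.ofReal ((c + m * ∫ z, truncatedKernel (1 / 4) z) / |Real.log (1 / 4)|) := by
    by_contra hlt
    obtain ⟨n, hn⟩ := (hlim.eventually_lt_perimeter hΩ (by rw [hvol]; exact ENNReal.ofReal_ne_top)
      (fun n => hAm _) (fun n => volume_ne_top_of_admissible (hA _)) (not_le.1 hlt)).exists
    refine absurd hn (not_lt.2 ?_)
    rw [← ENNReal.ofReal_toReal (hA (k n + N)).2.1.ne]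
    exact ENNReal.ofReal_le_ofReal
      (perimeter_le_of_scaledEnergy_le (hAm _) (hA _) hm hq (hN (k n + N) (by omega)))
  refine ⟨fun n => k n + N, Ω, fun a b hab => Nat.add_lt_add_right (hk hab) N,
    ⟨hΩ.nullMeasurableSet, hP.trans_lt ENNReal.ofReal_lt_top, hvol⟩, ?_⟩
  exact hlim.congr (fun n => (hAe _).symm) (ae_eq_refl _)

end DipolarDrop

end

theorem mainTheorem2 (m : ℝ) (hm : 0 < m) :
    -- lower bound
    (∀ (Ω : Set DipolarDrop.Plane) (Ωs : ℕ → Set DipolarDrop.Plane) (δ : ℕ → ℝ),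
      Ω ∈ DipolarDrop.admissible m → (∀ n, Ωs n ∈ DipolarDrop.admissible m) →
      DipolarDrop.SetTendsto Ωs Ω →
      (∀ n, 0 < δ n) → Tendsto δ atTop (𝓝 0) →
      DipolarDrop.limitEnergy Ω ≤
        liminf (fun n => ((DipolarDrop.scaledEnergy (δ n) (Ωs n) : ℝ) : EReal)) atTop) ∧
    -- upper bound: the constant sequence is a recovery sequence, by monotone convergence
    (∀ Ω : Set DipolarDrop.Plane, Ω ∈ DipolarDrop.admissible m →
      AntitoneOn (fun δ : ℝ => DipolarDrop.scaledEnergy δ Ω) (Set.Ioo 0 (1 / 2)) ∧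
      Tendsto (fun δ : ℝ => ((DipolarDrop.scaledEnergy δ Ω : ℝ) : EReal)) (𝓝[>] 0)
        (𝓝 (DipolarDrop.limitEnergy Ω)) ∧
      DipolarDrop.limitEnergy Ω ≠ ⊥) ∧
    -- compactness
    (∀ (Ωs : ℕ → Set DipolarDrop.Plane) (δ : ℕ → ℝ) (R : ℝ),
      (∀ n, Ωs n ∈ DipolarDrop.admissible m) →
      (∀ n, 0 < δ n) → Tendsto δ atTop (𝓝 0) →
      limsup (fun n => ((DipolarDrop.scaledEnergy (δ n) (Ωs n) : ℝ) : EReal)) atTop < ⊤ →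
      0 < R → (∀ n, Ωs n ⊆ Metric.ball 0 R) →
      ∃ (k : ℕ → ℕ) (Ω : Set DipolarDrop.Plane), StrictMono k ∧
        Ω ∈ DipolarDrop.admissible m ∧ DipolarDrop.SetTendsto (fun n => Ωs (k n)) Ω) := by
  refine ⟨fun Ω Ωs δ h hs hlim hδ0 hδ => DipolarDrop.limitEnergy_le_liminf h hs hlim hδ0 hδ,
    fun Ω h => ⟨(DipolarDrop.antitoneOn_scaledEnergy_of_admissible h).mono ?_,
      DipolarDrop.tendsto_scaledEnergy_of_admissible h, DipolarDrop.limitEnergy_ne_bot Ω⟩,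
    fun Ωs δ R hs hδ0 hδ hsup _ hR =>
      DipolarDrop.exists_subseq_of_limsup_scaledEnergy_lt_top hm.le hs hδ0 hδ hsup hR⟩
  exact Set.Ioo_subset_Ioo_right (by norm_num)
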